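/- Let $d\ge 4$, let $n=\lfloor (d-1)/2\rfloor$, and consider $(\mathbb C^d)^{\otimes 3}$ with parties $A,B,C$ and computational basis $|p\rangle_A|q\rangle_B|r\rangle_C$, $0\le p,q,r\le d-1$. For each layer $k=0,\dots,n-1$ (counted from the outside) put $L=k$, $H=d-1-k$, $m_k=H-L$; let $\{\eta_i\}_{i=0}^{m_k-1}$ be nonzero, pairwise orthogonal linear combinations of $|L\rangle,\dots,|H-1\rangle$ with $\eta_0=|L\rangle+\dots+|H-1\rangle$, and $\{\xi_j\}_{j=0}^{m_k-1}$ nonzero, pairwise orthogonal linear combinations of $|L+1\rangle,\dots,|H\rangle$ with $\xi_0=|L+1\rangle+\dots+|H\rangle$ (the families depend on $k$). The facial blocks of layer $k$ are, with $0\le i,j<m_k$ and tensor factors in the order $A,B,C$, $$\mathcal B_1=\{|L\rangle\,\eta_i\,\xi_j\},\quad \mathcal B_2=\{\eta_i\,|H\rangle\,\xi_j\},\quad \mathcal B_3=\{|H\rangle\,\xi_j\,\eta_i\},$$ $$\mathcal B_4=\{\eta_i\,\xi_j\,|L\rangle\},\quad \mathcal B_5=\{\xi_j\,|L\rangle\,\eta_i\},\quad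 \mathcal B_6=\{\xi_j\,\eta_i\,|H\rangle\}.$$ Write $\psi(i,j)^{(k)}_p$ for the elements of $\mathcal B^{(k)}_p$. For odd $d$ let $\mathcal B_0=\{|aaa\rangle: 0\le a<d\}$ and $\mathcal B_0'=\emptyset$. For even $d$ let $\mathcal B_0=\{|aaa\rangle: a\ne \tfrac d2-1,\tfrac d2\}$ and $\mathcal B_0'=\{\phi_l\otimes\phi_m\otimes\phi_p: l,m,p\in\{0,1\}\}$ with $\phi_{0}=|\tfrac d2-1\rangle+|\tfrac d2\rangle$, $\phi_1=|\tfrac d2-1\rangle-|\tfrac d2\rangle$. Let $|S\rangle=(\sum_{a=0}^{d-1}|a\rangle)^{\otimes 3}$ and $$\mathcal U_{PB}=\bigcup_{k,p}\bigl(\mathcal B^{(k)}_p\setminus\{\psi(0,0)^{(k)}_p\}\bigr)\cup\bigl(\mathcal B_0'\setminus\{\phi_0\otimes\phi_0\otimes\phi_0\}\bigr)\cup\{|S\rangle\},$$ $$\mathcal U^{S}_{BB}=\mathcal U_{PB}\cup\bigcup_k\{\psi^{(k)-}_{12},\psi^{(k)-}_{34},\psi^{(k)-}_{56}\},\qquad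 \mathcal U^{AB|C}_{BB}=\mathcal U_{PB}\cup\bigcup_k\{\psi^{(k)-}_{12},\psi^{(k)-}_{35},\psi^{(k)-}_{(L)4},\psi^{(k)-}_{(H)6}\},$$ where $\psi^{(k)-}_{pq}=\psi(0,0)^{(k)}_p-\psi(0,0)^{(k)}_q$ and $\psi^{(k)-}_{(a)p}=m_k^2|aaa\rangle-\psi(0,0)^{(k)}_p$. A vector is biseparable if it is a tensor product across at least one of the bipartitions $A|BC$, $B|AC$, $C|AB$. A UPB (UBB) is a set of nonzero pairwise orthogonal fully product (biseparable) vectors that spans a proper subspace whose orthogonal complement contains no nonzero fully product (biseparable) vector; a UPB in a cut is defined in the same way with vectors that are product across that cut. A density matrix is genuinely entangled if it is not a convex mixture of pure biseparable states. A bipartite state $\rho$ is $1$-distillable if local filters $F,G$ into $\mathbb C^2$ exist such that $(F\otimes G)\rho(F\otimes G)^\dagger$ has a non-positive partial transpose, distillable if $\rho^{\otimes N}$ is $1$-distillable for some $N\ge1$, and bound entangled if it is not separable and not distillable. Such families $\eta,\xi$ exist, and for every choice of them: 1. $\mathcal B_0\cup\mathcal B_0'\cup\bigcup_{k,p}\mathcal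 B^{(k)}_p$ is an orthogonal product basis of $(\mathbb C^d)^{\otimes3}$. 2. $\mathcal U_{PB}$ is a UPB with $d^3-8n$ elements; its complementary subspace has dimension $8n$. 3. $\mathcal U^{S}_{BB}$ is a UBB with $d^3-5n$ elements; its complementary subspace has dimension $5n$. 4. Every density matrix supported on the complementary subspace of $\mathcal U^{S}_{BB}$ is genuinely entangled, and it is $1$-distillable (hence distillable) across every bipartition. 5. $\mathcal U^{AB|C}_{BB}$ is a UBB, and a UPB in the cut $AB|C$, with $d^3-4n$ elements; its complementary subspace has dimension $4n$, and every density matrix supported on it is genuinely entangled. 6. The normalized projector onto the complementary subspace of $\mathcal U^{AB|C}_{BB}$ has positive partial transpose and is bound entangled in the cut $AB|C$, and it is $1$-distillable in the cuts $A|BC$ and $B|AC$. 7. The normalized projector onto the complementary subspace of $\mathcal U_{PB}$ has positive partial transpose and is bound entangled in every bipartition. Moreover, for every bipartition $\alpha|\beta$ of the three parties and every subspace $\mathcal S\subseteq(\mathbb C^d)^{\otimes3}$ with orthogonal projector $P$: if $\operatorname{rank}P<\max[\operatorname{rank}\operatorname{Tr}_\beta P,\operatorname{rank}\operatorname{Tr}_\alpha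 P]$, then every density matrix of rank $\dim\mathcal S$ supported on $\mathcal S$ is $1$-distillable across $\alpha|\beta$. -/

import Mathlib

open scoped Kronecker ComplexOrder

namespace BlockCube

noncomputable section

/-! ## Three qudits, bipartitions, product vectors -/

/-- The local space `ℂ^d`. -/
abbrev Qudit (d : ℕ) : Type := EuclideanSpace ℂ (Fin d)

/-- Labels `(p, q, r)` of the basic blocks of the `d × d × d` block-cube. -/
abbrev Cube (d : ℕ) : Type := Fin d × Fin d × Fin d

/-- The space `(ℂ^d)^{⊗3}` of Alice, Bob and Charlie, in the computational basis. -/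
abbrev ThreeQudit (d : ℕ) : Type := EuclideanSpace ℂ (Cube d)

/-- The computational basis vector `|k⟩`. -/
def ket {d : ℕ} (k : Fin d) : Qudit d := EuclideanSpace.single k 1

/-- The product vector `|x⟩_A ⊗ |y⟩_B ⊗ |z⟩_C`. -/
def tri {d : ℕ} (x y z : Qudit d) : ThreeQudit d :=
  WithLp.toLp 2 fun t => x t.1 * y t.2.1 * z t.2.2

/-- The three bipartitions `A|BC`, `B|AC`, `C|AB` of the parties `A`, `B`, `C`. -/
inductive Cut
  | A_BC
  | B_AC
  | C_AB

/-- Regrouping of the three party indices along a bipartition: the single party first, then the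
pair of the two other parties. -/
def cutEquiv (d : ℕ) : Cut → Cube d ≃ Fin d × (Fin d × Fin d)
  | .A_BC => Equiv.refl _
  | .B_AC =>
    { toFun := fun t => (t.2.1, t.1, t.2.2)
      invFun := fun s => (s.2.1, s.1, s.2.2)
      left_inv := fun _ => rfl
      right_inv := fun _ => rfl }
  | .C_AB =>
    { toFun := fun t => (t.2.2, t.1, t.2.1)
      invFun := fun s => (s.2.1, s.2.2, s.1)
      left_inv := fun _ => rfl
      right_inv := fun _ => rfl }

/-- Fully product vectors. -/
def IsFullyProduct {d : ℕ} (v : ThreeQudit d) : Prop :=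
  ∃ x y z : Qudit d, v = tri x y z

/-- Vectors that are a tensor product across the bipartition `c`. -/
def IsProductAcross {d : ℕ} (c : Cut) (v : ThreeQudit d) : Prop :=
  ∃ (x : Qudit d) (y : EuclideanSpace ℂ (Fin d × Fin d)),
    ∀ t : Cube d, v t = x (cutEquiv d c t).1 * y (cutEquiv d c t).2

/-- Biseparable vectors: product across at least one bipartition. -/
def IsBiseparable {d : ℕ} (v : ThreeQudit d) : Prop :=
  ∃ c : Cut, IsProductAcross c v

/-! ## Orthogonal, unextendible and complete bases of a given type -/

/-- `U` is a set of nonzero pairwise orthogonal vectors with the property `P`. -/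
structure IsOrthogonalFamily {d : ℕ} (P : ThreeQudit d → Prop) (U : Set (ThreeQudit d)) :
    Prop where
  ne_zero : ∀ v ∈ U, v ≠ 0
  orthogonal : U.Pairwise fun v w => inner ℂ v w = 0
  mem : ∀ v ∈ U, P v

/-- An orthogonal basis of the whole space consisting of product vectors. -/
def IsOrthogonalProductBasis {d : ℕ} (U : Set (ThreeQudit d)) : Prop :=
  IsOrthogonalFamily IsFullyProduct U ∧ Submodule.span ℂ U = ⊤

/-- The subspace complementary (orthogonal) to the span of `U`. -/
def complementary {d : ℕ} (U : Set (ThreeQudit d)) : Submodule ℂ (ThreeQudit d) :=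
  (Submodule.span ℂ U)ᗮ

/-- `U` consists of nonzero pairwise orthogonal vectors with the property `P`, spans a proper
subspace, and no nonzero vector with the property `P` is orthogonal to all of `U`. -/
structure IsUnextendible {d : ℕ} (P : ThreeQudit d → Prop) (U : Set (ThreeQudit d)) :
    Prop where
  family : IsOrthogonalFamily P U
  proper : Submodule.span ℂ U ≠ ⊤
  unextendible : ∀ v ∈ complementary U, P v → v = 0

/-- Unextendible product basis. -/
def IsUPB {d : ℕ} (U : Set (ThreeQudit d)) : Prop := IsUnextendible IsFullyProduct U

/-- Unextendible biseparable basis. -/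
def IsUBB {d : ℕ} (U : Set (ThreeQudit d)) : Prop := IsUnextendible IsBiseparable U

/-- Unextendible product basis of the bipartite system obtained by the bipartition `c`. -/
def IsUPBAcross {d : ℕ} (c : Cut) (U : Set (ThreeQudit d)) : Prop :=
  IsUnextendible (IsProductAcross c) U

/-! ## Density matrices, separability, distillability -/

/-- Density matrices. -/
def IsDensity {ι : Type*} [Fintype ι] (ρ : Matrix ι ι ℂ) : Prop :=
  ρ.PosSemidef ∧ ρ.trace = 1

/-- The rank one operator `|v⟩⟨v|`. -/
def pureState {ι : Type*} (v : EuclideanSpace ℂ ι) : Matrix ι ι ℂ :=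
  Matrix.of fun s t => v s * star (v t)

/-- `ρ` is supported on `S`: the range of `ρ` is contained in `S`. -/
def SupportedOn {ι : Type*} [Fintype ι] (ρ : Matrix ι ι ℂ)
    (S : Submodule ℂ (EuclideanSpace ℂ ι)) : Prop :=
  ∀ v : ι → ℂ, WithLp.toLp 2 (ρ.mulVec v) ∈ S

/-- The matrix of the orthogonal projector onto `S`. -/
def projMatrix {ι : Type*} [Fintype ι] [DecidableEq ι]
    (S : Submodule ℂ (EuclideanSpace ℂ ι)) : Matrix ι ι ℂ :=
  Matrix.of fun s t => S.starProjection (EuclideanSpace.single t (1 : ℂ)) s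

/-- The normalized projector onto `S`. -/
def projState {ι : Type*} [Fintype ι] [DecidableEq ι]
    (S : Submodule ℂ (EuclideanSpace ℂ ι)) : Matrix ι ι ℂ :=
  ((Module.finrank ℂ S : ℂ)⁻¹) • projMatrix S

/-- A three-qudit density matrix is genuinely entangled if it is not a convex mixture of
biseparable pure states (which may be product across different bipartitions). -/
def IsGenuinelyEntangled {d : ℕ} (ρ : Matrix (Cube d) (Cube d) ℂ) : Prop :=
  ρ ∉ convexHull ℝ {σ | ∃ v : ThreeQudit d, ‖v‖ = 1 ∧ IsBiseparable v ∧ σ = pureState v}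

/-- A three-qudit operator regarded as an operator of the bipartite system given by `c`. -/
def across {d : ℕ} (c : Cut) (ρ : Matrix (Cube d) (Cube d) ℂ) :
    Matrix (Fin d × (Fin d × Fin d)) (Fin d × (Fin d × Fin d)) ℂ :=
  Matrix.reindex (cutEquiv d c) (cutEquiv d c) ρ

section Bipartite

variable {α β : Type*}

/-- Bipartite product pure states: `v (a, b) = x a * y b`. -/
def IsProduct (v : EuclideanSpace ℂ (α × β)) : Prop :=
  ∃ (x : EuclideanSpace ℂ α) (y : EuclideanSpace ℂ β), ∀ t : α × β, v t = x t.1 * y t.2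

/-- Separable states: convex mixtures of product pure states. -/
def IsSeparable [Fintype α] [Fintype β] (ρ : Matrix (α × β) (α × β) ℂ) : Prop :=
  ρ ∈ convexHull ℝ {σ | ∃ v : EuclideanSpace ℂ (α × β),
    ‖v‖ = 1 ∧ IsProduct v ∧ σ = pureState v}

/-- Partial transposition in the second factor. -/
def partialTranspose (ρ : Matrix (α × β) (α × β) ℂ) : Matrix (α × β) (α × β) ℂ :=
  Matrix.of fun s t => ρ (s.1, t.2) (t.1, s.2)

/-- Positive partial transpose. -/
def IsPPT [Fintype α] [Fintype β] (ρ : Matrix (α × β) (α × β) ℂ) : Prop :=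
  (partialTranspose ρ).PosSemidef

/-- The reduced operator of the first factor (partial trace over the second factor). -/
def reducedFst [Fintype β] (ρ : Matrix (α × β) (α × β) ℂ) : Matrix α α ℂ :=
  Matrix.of fun a a' => ∑ b, ρ (a, b) (a', b)

/-- The reduced operator of the second factor (partial trace over the first factor). -/
def reducedSnd [Fintype α] (ρ : Matrix (α × β) (α × β) ℂ) : Matrix β β ℂ :=
  Matrix.of fun b b' => ∑ a, ρ (a, b) (a, b')

/-- `1`-distillability of a bipartite state: local filters into a two-qubit system turn a single
copy of `ρ` into an (unnormalized) two-qubit state with negative partial transpose. -/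
def IsOneDistillable [Fintype α] [Fintype β] (ρ : Matrix (α × β) (α × β) ℂ) : Prop :=
  ∃ (F : Matrix (Fin 2) α ℂ) (G : Matrix (Fin 2) β ℂ),
    ¬ IsPPT ((F ⊗ₖ G) * ρ * (F ⊗ₖ G).conjTranspose)

/-- The bipartite state of `n` copies of `ρ`, each side holding its `n` subsystems. -/
def copies (n : ℕ) (ρ : Matrix (α × β) (α × β) ℂ) :
    Matrix ((Fin n → α) × (Fin n → β)) ((Fin n → α) × (Fin n → β)) ℂ :=
  Matrix.of fun s t => ∏ i, ρ (s.1 i, s.2 i) (t.1 i, t.2 i)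

/-- Distillable: some finite number of copies is `1`-distillable. -/
def IsDistillable [Fintype α] [Fintype β] (ρ : Matrix (α × β) (α × β) ℂ) : Prop :=
  ∃ n : ℕ, 1 ≤ n ∧ IsOneDistillable (copies n ρ)

/-- Bound entangled: entangled, but not distillable. -/
def IsBoundEntangled [Fintype α] [Fintype β] (ρ : Matrix (α × β) (α × β) ℂ) : Prop :=
  ¬ IsSeparable ρ ∧ ¬ IsDistillable ρ

end Bipartite

/-! ## The layered block structure

The layers of facial blocks are indexed from the outside by `k = 0, 1, …, ⌊(d-1)/2⌋ - 1`. Layer `k`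
lives on the faces of the sub-cube with coordinates from `low = k` to `high = d - 1 - k`. -/

/-- Number of layers: `(d-1)/2` for odd `d`, and `d/2 - 1` for even `d`. -/
def numLayers (d : ℕ) : ℕ := (d - 1) / 2

/-- `high - low` for layer `k`, the side length of the facial blocks of that layer. -/
def side (d : ℕ) (k : Fin (numLayers d)) : ℕ := d - 1 - 2 * (k : ℕ)

theorem two_mul_lt {d : ℕ} (k : Fin (numLayers d)) : 2 * (k : ℕ) + 2 < d := by
  have := k.2
  unfold numLayers at this
  omega

theorem side_pos {d : ℕ} (k : Fin (numLayers d)) : 0 < side d k := by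
  have := two_mul_lt k
  unfold side
  omega

/-- The lowest coordinate of layer `k`. -/
def low {d : ℕ} (k : Fin (numLayers d)) : Fin d :=
  ⟨k, by have := two_mul_lt k; omega⟩

/-- The highest coordinate of layer `k`. -/
def high {d : ℕ} (k : Fin (numLayers d)) : Fin d :=
  ⟨d - 1 - k, by have := two_mul_lt k; omega⟩

/-- The index `0` of the families `η`, `ξ` of layer `k`. -/
def zeroIdx {d : ℕ} (k : Fin (numLayers d)) : Fin (side d k) := ⟨0, side_pos k⟩

/-- A choice of the local vectors of all layers. In layer `k`, `η_0 = |low⟩ + ⋯ + |high - 1⟩` is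
completed by linear combinations of `|low⟩, …, |high - 1⟩` to a family of `high - low` nonzero
pairwise orthogonal vectors, and similarly `ξ_0 = |low + 1⟩ + ⋯ + |high⟩`. -/
structure LayerVectors (d : ℕ) where
  eta : (k : Fin (numLayers d)) → Fin (side d k) → Qudit d
  xi : (k : Fin (numLayers d)) → Fin (side d k) → Qudit d
  eta_zero : ∀ k, eta k (zeroIdx k) = ∑ a ∈ Finset.Ico (low k) (high k), ket a
  xi_zero : ∀ k, xi k (zeroIdx k) = ∑ a ∈ Finset.Ioc (low k) (high k), ket a
  eta_mem : ∀ k i, eta k i ∈ Submodule.span ℂ (ket '' Set.Ico (low k) (high k))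
  xi_mem : ∀ k j, xi k j ∈ Submodule.span ℂ (ket '' Set.Ioc (low k) (high k))
  eta_ne_zero : ∀ k i, eta k i ≠ 0
  xi_ne_zero : ∀ k j, xi k j ≠ 0
  eta_orthogonal : ∀ k, Pairwise fun i i' => inner ℂ (eta k i) (eta k i') = 0
  xi_orthogonal : ∀ k, Pairwise fun j j' => inner ℂ (xi k j) (xi k j') = 0

/-- The six facial blocks of a layer. -/
inductive Face
  | f1
  | f2
  | f3
  | f4
  | f5
  | f6

section Construction

variable {d : ℕ} (V : LayerVectors d)

/-- The state `|ψ(i,j)⟩` of the facial block `p` of layer `k`. -/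
def psi (k : Fin (numLayers d)) (p : Face) (i j : Fin (side d k)) : ThreeQudit d :=
  match p with
  | .f1 => tri (ket (low k)) (V.eta k i) (V.xi k j)
  | .f2 => tri (V.eta k i) (ket (high k)) (V.xi k j)
  | .f3 => tri (ket (high k)) (V.xi k j) (V.eta k i)
  | .f4 => tri (V.eta k i) (V.xi k j) (ket (low k))
  | .f5 => tri (V.xi k j) (ket (low k)) (V.eta k i)
  | .f6 => tri (V.xi k j) (V.eta k i) (ket (high k))

/-- The state `|ψ(0,0)⟩` of the facial block `p` of layer `k`. -/
def psi00 (k : Fin (numLayers d)) (p : Face) : ThreeQudit d :=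
  psi V k p (zeroIdx k) (zeroIdx k)

/-- The facial block `p` of layer `k`. -/
def faceBlock (k : Fin (numLayers d)) (p : Face) : Set (ThreeQudit d) :=
  {v | ∃ i j : Fin (side d k), v = psi V k p i j}

/-- The basic block states `|kkk⟩`. -/
def diag (a : Fin d) : ThreeQudit d := tri (ket a) (ket a) (ket a)

/-- For even `d`, the two middle coordinates `d/2 - 1` and `d/2`; none for odd `d`. -/
def IsMiddle (a : Fin d) : Prop := Even d ∧ (2 * (a : ℕ) + 2 = d ∨ 2 * (a : ℕ) = d)

/-- The body-diagonal block: all `|kkk⟩`, except the two middle ones for even `d`. -/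
def diagBlock (d : ℕ) : Set (ThreeQudit d) := {v | ∃ a : Fin d, ¬ IsMiddle a ∧ v = diag a}

/-- For even `d`, `|φ_0⟩ = |d/2 - 1⟩ + |d/2⟩` and `|φ_1⟩ = |d/2 - 1⟩ - |d/2⟩`. -/
def phi (d : ℕ) (l : Fin 2) : Qudit d :=
  WithLp.toLp 2 fun a =>
    if 2 * (a : ℕ) + 2 = d then 1 else if 2 * (a : ℕ) = d then (-1) ^ (l : ℕ) else 0

/-- The central `2 × 2 × 2` block for even `d` (empty for odd `d`). -/
def centralBlock (d : ℕ) : Set (ThreeQudit d) :=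
  {v | Even d ∧ ∃ l m p : Fin 2, v = tri (phi d l) (phi d m) (phi d p)}

/-- The layered twisted product basis. -/
def twistedBasis : Set (ThreeQudit d) :=
  diagBlock d ∪ centralBlock d ∪ ⋃ (k : Fin (numLayers d)) (p : Face), faceBlock V k p

/-- The stopper state `|0 + 1 + ⋯ + (d-1)⟩^{⊗3}`. -/
def stopper (d : ℕ) : ThreeQudit d := tri (∑ a, ket a) (∑ a, ket a) (∑ a, ket a)

/-- The set `U_PB`. -/
def productBasis : Set (ThreeQudit d) :=
  (⋃ (k : Fin (numLayers d)) (p : Face), (faceBlock V k p \ {psi00 V k p})) ∪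
    (centralBlock d \ {tri (phi d 0) (phi d 0) (phi d 0)}) ∪ {stopper d}

/-- `|ψ⟩^-_{pq} = |ψ(0,0)⟩_p - |ψ(0,0)⟩_q` in layer `k`. -/
def psiMinus (k : Fin (numLayers d)) (p q : Face) : ThreeQudit d :=
  psi00 V k p - psi00 V k q

/-- `|ψ⟩^-_{(a)p} = m² |aaa⟩ - |ψ(0,0)⟩_p` in layer `k`, with `m²` the number of basic blocks in
a facial block of that layer. -/
def psiMinusDiag (k : Fin (numLayers d)) (a : Fin d) (p : Face) : ThreeQudit d :=
  ((side d k : ℂ) ^ 2) • diag a - psi00 V k p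

/-- The symmetric set of biseparable vectors. -/
def symmetricBasis : Set (ThreeQudit d) :=
  productBasis V ∪ ⋃ k : Fin (numLayers d),
    {psiMinus V k .f1 .f2, psiMinus V k .f3 .f4, psiMinus V k .f5 .f6}

/-- The asymmetric set of biseparable vectors, for the cut `AB|C`. -/
def asymmetricBasis : Set (ThreeQudit d) :=
  productBasis V ∪ ⋃ k : Fin (numLayers d),
    {psiMinus V k .f1 .f2, psiMinus V k .f3 .f5,
      psiMinusDiag V k (low k) .f4, psiMinusDiag V k (high k) .f6}

end Construction

end

end BlockCube

/-! The labels of the cube are cut into cells: six faces and two diagonal ends per layer, and the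
core. The twisted basis is the union of product bases of the cells, each containing the indicator
vector of its cell. Without these 8n+1 indicators, the complement consists of the functions constant
on the cells. The stopper is the sum of all indicators and adds the condition that the entries sum
to zero; each difference vector forces two cells to carry the same value. Cardinalities and
dimensions follow by counting.

The engine is `eq_zero_of_two_valued`: a function with zero sum and at most one nonzero value
vanishes. Layers are peeled from the outside (`eq_zero_of_layers`): the conditions on a layer either
make its face and end values vanish, or leave a single nonzero value altogether. For product vectors
the conditions are 2×2 minors (`IsFstProduct.layerMinors`), which settle the fully product and the
asymmetric case.

For states, ρ is written as the Gram matrix of vectors Φ(t). Every linear relation valid on the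
supporting subspace passes to Φ, which is thus a vector-valued cell-constant function with zero sum.
If ρ is not 1-distillable, then Φ(x,y) = 0 forces Φ(x,y') ⟂ Φ(x',y) for all x', y' (`NoFilter`). In
`symmetric_layer` these orthogonalities, combined with the zero sum, kill each layer. A product
vector satisfies `NoFilter` as a scalar family, so the same lemma gives unextendibility of the
symmetric basis.

Genuine and bound entanglement come from the range criterion. The projectors are PPT because partial
transposition conjugates one factor of each product vector and preserves orthogonality. The
complement of `productBasis` does contain product vectors across each cut, but by
`IsFstProduct.face_add_eq_zero` they satisfy one more linear equation and do not span it. The rank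
criterion rests on `exists_minimal_kernel`. -/

namespace BlockCube

open Matrix Module

/-! ### Gram vectors of a state and the condition forced by non-distillability -/

section Gram

variable {α β ι κ H : Type*} [Fintype α] [Fintype β] [Fintype ι] [Fintype κ]
  [NormedAddCommGroup H] [InnerProductSpace ℂ H]

/-- `ρ` is the Gram matrix of the vectors `Φ`. -/
def IsGram (Φ : ι → H) (ρ : Matrix ι ι ℂ) : Prop :=
  ∀ s t, ρ s t = inner ℂ (Φ t) (Φ s)

theorem exists_factorization {ρ : Matrix ι ι ℂ} (h : ρ.PosSemidef) :
    ∃ (m : ℕ) (Q : Matrix ι (Fin m) ℂ), ρ = Q * Qᴴ := by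
  obtain ⟨m, v, hv⟩ := Matrix.posSemidef_iff_eq_sum_vecMulVec.1 h
  refine ⟨m, Matrix.of fun s i => v i s, ?_⟩
  ext s t
  simp [hv, Matrix.mul_apply, Matrix.sum_apply, vecMulVec_apply]

/-- The rows of `Q`, as vectors of a Hilbert space. -/
def rowVec (Q : Matrix ι κ ℂ) (s : ι) : EuclideanSpace ℂ κ := WithLp.toLp 2 (Q s)

omit [Fintype ι] in
theorem isGram_rowVec (Q : Matrix ι κ ℂ) : IsGram (rowVec Q) (Q * Qᴴ) := by
  intro s t
  simp [rowVec, Matrix.mul_apply, PiLp.inner_apply]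

theorem exists_isGram {ρ : Matrix ι ι ℂ} (h : ρ.PosSemidef) :
    ∃ (m : ℕ) (Φ : ι → EuclideanSpace ℂ (Fin m)), IsGram Φ ρ := by
  obtain ⟨m, Q, rfl⟩ := exists_factorization h
  exact ⟨m, _, isGram_rowVec Q⟩

theorem IsGram.inner_sum {Φ : ι → H} {ρ : Matrix ι ι ℂ} (h : IsGram Φ ρ) (u v : ι → ℂ) :
    inner ℂ (∑ t, v t • Φ t) (∑ s, u s • Φ s) = (u ᵥ* ρ) ⬝ᵥ star v := by
  simp only [sum_inner, _root_.inner_sum, inner_smul_left, inner_smul_right, ← h _ _, dotProduct,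
    vecMul, Finset.sum_mul, Finset.mul_sum, Pi.star_apply, Complex.star_def]
  rw [Finset.sum_comm]
  exact Finset.sum_congr rfl fun _ _ => Finset.sum_congr rfl fun _ _ => by ring

/-- The squared norm of the combination is the quadratic form of ρ at u. Hence the linear relations
among Gram vectors depend only on the left kernel of ρ, which is how information on the support
reaches Φ. -/
theorem IsGram.sum_eq_zero_iff {Φ : ι → H} {ρ : Matrix ι ι ℂ} (h : IsGram Φ ρ) (u : ι → ℂ) :
    ∑ s, u s • Φ s = 0 ↔ u ᵥ* ρ = 0 := by
  constructor
  · intro hu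
    ext t
    have h1 : ∀ t, (u ᵥ* ρ) t = inner ℂ (Φ t) (∑ s, u s • Φ s) := by
      intro t
      simp [vecMul, dotProduct, h _ _]
    rw [h1, hu]
    simp
  · intro hu
    rw [← inner_self_eq_zero (𝕜 := ℂ), h.inner_sum, hu, zero_dotProduct]

theorem IsGram.posSemidef {Φ : ι → H} {ρ : Matrix ι ι ℂ} (h : IsGram Φ ρ) : ρ.PosSemidef := by
  refine Matrix.PosSemidef.of_dotProduct_mulVec_nonneg ?_ fun x => ?_
  · ext s t
    simp [h _ _]
  · have h1 := h.inner_sum (star x) (star x)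
    rw [star_star, ← dotProduct_mulVec] at h1
    rw [← h1, inner_self_eq_norm_sq_to_K]
    positivity

theorem isGram_entry_eq_zero {ρ : Matrix ι ι ℂ} (h : ρ.PosSemidef) {s : ι} (hs : ρ s s = 0)
    (t : ι) : ρ s t = 0 := by
  obtain ⟨m, Φ, hΦ⟩ := exists_isGram h
  rw [hΦ, inner_self_eq_zero] at hs
  rw [hΦ, hs, inner_zero_right]

/-- The combination of the vectors `Φ` with the coefficients of the product vector `x ⊗ y`. -/
def pair (Φ : α × β → H) (x : α → ℂ) (y : β → ℂ) : H := ∑ t, (x t.1 * y t.2) • Φ t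

/-- The property of a Gram system that expresses that no local filters into two qubits produce
a negative partial transpose out of a zero of the quadratic form. -/
def NoFilter (Φ : α × β → H) : Prop :=
  ∀ (x x' : α → ℂ) (y y' : β → ℂ), pair Φ x y = 0 → inner ℂ (pair Φ x y') (pair Φ x' y) = 0

theorem filtered_apply {Φ : α × β → H} {ρ : Matrix (α × β) (α × β) ℂ} (h : IsGram Φ ρ)
    (F : Matrix (Fin 2) α ℂ) (G : Matrix (Fin 2) β ℂ) (s t : Fin 2 × Fin 2) :
    ((F ⊗ₖ G) * ρ * (F ⊗ₖ G).conjTranspose) s t =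
      inner ℂ (pair Φ (F t.1) (G t.2)) (pair Φ (F s.1) (G s.2)) := by
  rw [pair, pair, h.inner_sum (fun r => F s.1 r.1 * G s.2 r.2) (fun r => F t.1 r.1 * G t.2 r.2)]
  rw [Matrix.mul_apply]
  rfl

/-- With filters of rows x, x' and y, y', the (0,0) diagonal entry of the partial transpose is the
squared norm of `pair Φ x y`. When it vanishes, positivity kills its whole row, and the entry in
column (1,1) is the conjugate of the inner product in `NoFilter`. -/
theorem noFilter_of_not_isOneDistillable {Φ : α × β → H} {ρ : Matrix (α × β) (α × β) ℂ}
    (h : IsGram Φ ρ) (hρ : ¬ IsOneDistillable ρ) : NoFilter Φ := by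
  intro x x' y y' hxy
  have h1 : IsPPT ((Matrix.of ![x, x'] ⊗ₖ Matrix.of ![y, y']) * ρ *
      (Matrix.of ![x, x'] ⊗ₖ Matrix.of ![y, y']).conjTranspose) := by
    by_contra h2
    exact hρ ⟨_, _, h2⟩
  have h2 := isGram_entry_eq_zero h1 (s := ((0, 0) : Fin 2 × Fin 2)) ?_ (1, 1)
  · rw [partialTranspose, of_apply, filtered_apply h] at h2
    rw [← inner_conj_symm, map_eq_zero]
    exact h2
  · rw [partialTranspose, of_apply, filtered_apply h]
    exact inner_self_eq_zero.2 hxy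

end Gram

/-! ### Rank criterion for 1-distillability -/

section RankCriterion

variable {α β κ H : Type*} [Fintype α] [Fintype β] [Fintype κ]
  [NormedAddCommGroup H] [InnerProductSpace ℂ H]

theorem pair_add_left (Φ : α × β → H) (x x' : α → ℂ) (y : β → ℂ) :
    pair Φ (x + x') y = pair Φ x y + pair Φ x' y := by
  simp [pair, add_mul, add_smul, Finset.sum_add_distrib]

theorem pair_smul_left (Φ : α × β → H) (c : ℂ) (x : α → ℂ) (y : β → ℂ) :
    pair Φ (c • x) y = c • pair Φ x y := by
  simp [pair, Finset.smul_sum, mul_smul]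

theorem pair_add_right (Φ : α × β → H) (x : α → ℂ) (y y' : β → ℂ) :
    pair Φ x (y + y') = pair Φ x y + pair Φ x y' := by
  simp [pair, mul_add, add_smul, Finset.sum_add_distrib]

theorem pair_smul_right (Φ : α × β → H) (c : ℂ) (x : α → ℂ) (y : β → ℂ) :
    pair Φ x (c • y) = c • pair Φ x y := by
  simp only [pair, Finset.smul_sum, Pi.smul_apply, smul_eq_mul, ← mul_smul]
  exact Finset.sum_congr rfl fun _ _ => by congr 1; ring

/-- `pair`, linear in the second argument. -/
def pairLin (Φ : α × β → H) (x : α → ℂ) : (β → ℂ) →ₗ[ℂ] H where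
  toFun := pair Φ x
  map_add' := pair_add_right Φ x
  map_smul' c y := pair_smul_right Φ c x y

@[simp] theorem pairLin_apply (Φ : α × β → H) (x : α → ℂ) (y : β → ℂ) :
    pairLin Φ x y = pair Φ x y := rfl

/-- A vector a with kernel of least dimension works. If some x' did not vanish on that kernel, the
common kernel K₀ of a and x' would lie below the minimum, so every a + t x' would have a null vector
z t outside K₀. `NoFilter` makes the z t orthogonal for the positive form that adds the squared
norms at a and at x', and this form is nonzero at each z t. That gives infinitely many independent
vectors in a finite-dimensional space. -/
theorem exists_minimal_kernel {Φ : α × β → H} (h : NoFilter Φ) :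
    ∃ x : α → ℂ, ∀ y, pair Φ x y = 0 → ∀ x', pair Φ x' y = 0 := by
  obtain ⟨a, ha⟩ : ∃ a : α → ℂ, ∀ a' : α → ℂ,
      finrank ℂ (LinearMap.ker (pairLin Φ a)) ≤ finrank ℂ (LinearMap.ker (pairLin Φ a')) := by
    obtain ⟨a, ha⟩ := exists_minimal_of_wellFoundedLT (α := ℕ)
      (fun n => ∃ a : α → ℂ, n = finrank ℂ (LinearMap.ker (pairLin Φ a))) ⟨_, 0, rfl⟩
    obtain ⟨⟨a, rfl⟩, hmin⟩ := ha
    refine ⟨a, fun a' => ?_⟩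
    by_contra hlt
    exact hlt (hmin ⟨a', rfl⟩ (not_le.1 hlt).le)
  refine ⟨a, fun y hy x' => ?_⟩
  by_contra hne
  set K₀ := LinearMap.ker (pairLin Φ a) ⊓ LinearMap.ker (pairLin Φ x') with hK₀
  have hlt : finrank ℂ K₀ < finrank ℂ (LinearMap.ker (pairLin Φ a)) := by
    apply Submodule.finrank_lt_finrank_of_lt
    refine lt_of_le_of_ne inf_le_left fun heq => hne ?_
    have : y ∈ K₀ := by rw [heq]; simpa using hy
    simpa using this.2
  have hex : ∀ t : ℂ, ∃ z, pair Φ (a + t • x') z = 0 ∧ z ∉ K₀ := by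
    intro t
    have h1 : ¬ LinearMap.ker (pairLin Φ (a + t • x')) ≤ K₀ := fun hle =>
      absurd (Submodule.finrank_mono hle) (not_le.2 (hlt.trans_le (ha _)))
    obtain ⟨z, hz, hz'⟩ := SetLike.not_le_iff_exists.1 h1
    exact ⟨z, by simpa using hz, hz'⟩
  choose z hz hz' using hex
  -- the form `⟪Φ(a, ·), Φ(a, ·)⟫ + ⟪Φ(x', ·), Φ(x', ·)⟫` is diagonal on the vectors `z t`
  have horth : ∀ s t, s ≠ t →
      inner ℂ (pair Φ a (z s)) (pair Φ a (z t)) + inner ℂ (pair Φ x' (z s)) (pair Φ x' (z t)) = 0 := by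
    intro s t hst
    have e : ∀ r, pair Φ a (z r) = -(r • pair Φ x' (z r)) := by
      intro r
      have := hz r
      rw [pair_add_left, pair_smul_left] at this
      exact eq_neg_of_add_eq_zero_left this
    have k := h (a + t • x') x' (z t) (z s) (hz t)
    have k2 : pair Φ (a + t • x') (z s) = (t - s) • pair Φ x' (z s) := by
      rw [pair_add_left, pair_smul_left, e s, sub_smul]
      abel
    rw [k2, inner_smul_left, mul_eq_zero, map_eq_zero, sub_eq_zero] at k
    have k3 := k.resolve_left hst.symm
    rw [e s, e t, inner_neg_neg, inner_smul_left, inner_smul_right, k3]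
    simp
  refine Module.Finite.not_linearIndependent_of_infinite (R := ℂ) z ?_
  rw [linearIndependent_iff']
  intro S c hc s hs
  have h1 : ∀ x : α → ℂ, ∑ t ∈ S, c t • pair Φ x (z t) = 0 := by
    intro x
    have := congrArg (pairLin Φ x) hc
    rw [map_zero, map_sum] at this
    simpa only [map_smul, pairLin_apply] using this
  -- Pairing the linear relation with z s under the form isolates c s times the value of the form at
  -- z s.
  have h2 : ∑ t ∈ S, c t * (inner ℂ (pair Φ a (z s)) (pair Φ a (z t)) +
      inner ℂ (pair Φ x' (z s)) (pair Φ x' (z t))) = 0 := by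
    simp_rw [mul_add, Finset.sum_add_distrib, ← inner_smul_right, ← inner_sum, h1]
    simp
  rw [Finset.sum_eq_single s (fun t _ hts => by rw [horth s t hts.symm, mul_zero])
    (fun hn => absurd hs hn)] at h2
  refine (mul_eq_zero.1 h2).resolve_right fun h3 => hz' s ?_
  rw [inner_self_eq_norm_sq_to_K, inner_self_eq_norm_sq_to_K] at h3
  have h4 : ‖pair Φ a (z s)‖ ^ 2 + ‖pair Φ x' (z s)‖ ^ 2 = 0 := by
    apply Complex.ofReal_injective
    push_cast
    exact h3
  have h5 : ‖pair Φ a (z s)‖ = 0 := by nlinarith [sq_nonneg ‖pair Φ a (z s)‖, sq_nonneg ‖pair Φ x' (z s)‖]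
  have h6 : ‖pair Φ x' (z s)‖ = 0 := by nlinarith [sq_nonneg ‖pair Φ a (z s)‖, sq_nonneg ‖pair Φ x' (z s)‖]
  exact ⟨by simpa using h5, by simpa using h6⟩

theorem rank_le_rank_of_vecMul {m κ' : Type*} [Fintype m] [Fintype κ'] (A : Matrix m κ ℂ)
    (B : Matrix m κ' ℂ)
    (h : ∀ y : m → ℂ, y ᵥ* B = 0 → y ᵥ* A = 0) : A.rank ≤ B.rank := by
  rw [← rank_transpose A, ← rank_transpose B]
  have e1 := LinearMap.finrank_range_add_finrank_ker (Aᵀ.mulVecLin)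
  have e2 := LinearMap.finrank_range_add_finrank_ker (Bᵀ.mulVecLin)
  have h1 : LinearMap.ker Bᵀ.mulVecLin ≤ LinearMap.ker Aᵀ.mulVecLin := by
    intro y hy
    simp only [LinearMap.mem_ker, mulVecLin_apply, mulVec_transpose] at hy ⊢
    exact h y hy
  have := Submodule.finrank_mono h1
  unfold Matrix.rank
  omega

theorem sum_prod_smul_eq_pair (Φ : α × β → H) (x : α → ℂ) (y : β → ℂ) :
    pair Φ x y = ∑ b, y b • ∑ a, x a • Φ (a, b) := by
  rw [pair, Fintype.sum_prod_type_right]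
  refine Finset.sum_congr rfl fun b _ => ?_
  rw [Finset.smul_sum]
  exact Finset.sum_congr rfl fun a _ => by rw [smul_smul, mul_comm]

/-- The rank of the reduced operator is the codimension of the common kernel of all y ↦ Φ(a, y).
This is the kernel of the single map at a minimal x, and that map factors through P. Only null
relations enter, so P need not be the Gram matrix of Φ itself; this is what allows states that
differ from the projector. -/
theorem rank_reducedSnd_le {Φ : α × β → H} (h : NoFilter Φ) {P : Matrix (α × β) (α × β) ℂ}
    (hP : P.PosSemidef) (hΦ : ∀ u : α × β → ℂ, ∑ s, u s • Φ s = 0 ↔ u ᵥ* P = 0) :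
    (reducedSnd P).rank ≤ P.rank := by
  classical
  obtain ⟨x, hx⟩ := exists_minimal_kernel h
  obtain ⟨m, Q, rfl⟩ := exists_factorization hP
  have hQ := isGram_rowVec Q
  have hpair : ∀ x y, pair (rowVec Q) x y = 0 ↔ pair Φ x y = 0 := fun x y =>
    (hQ.sum_eq_zero_iff _).trans (hΦ _).symm
  let Q' : Matrix β (α × Fin m) ℂ := Matrix.of fun b r => Q (r.1, b) r.2
  have e1 : reducedSnd (Q * Qᴴ) = Q' * Q'ᴴ := by
    ext b b'
    simp [reducedSnd, Q', Matrix.mul_apply, Fintype.sum_prod_type]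
  -- X inserts x in the first factor: `y ᵥ* X` is the product vector x ⊗ y.
  let X : Matrix β (α × β) ℂ := Matrix.of fun b t => if t.2 = b then x t.1 else 0
  rw [e1, rank_self_mul_conjTranspose, rank_self_mul_conjTranspose]
  refine le_trans (rank_le_rank_of_vecMul Q' (X * Q) fun y hy => ?_) (rank_mul_le_right X Q)
  have h0 : pair (rowVec Q) x y = 0 := by
    ext k
    have := congrFun hy k
    rw [← vecMul_vecMul] at this
    have h2 : y ᵥ* X = fun t => x t.1 * y t.2 := by
      ext t
      simp [vecMul, dotProduct, X, mul_comm]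
    rw [h2] at this
    simpa [pair, rowVec, vecMul, dotProduct] using this
  ext ⟨a, k⟩
  have h1 := (hpair (Pi.single a 1) y).2 (hx y ((hpair x y).1 h0) _)
  have h2 := congrArg (fun v : EuclideanSpace ℂ (Fin m) => v k) h1
  rw [sum_prod_smul_eq_pair] at h2
  simpa [vecMul, dotProduct, Q', rowVec, Pi.single_apply] using h2

theorem NoFilter.swap {Φ : α × β → H} (h : NoFilter Φ) :
    NoFilter (fun t : β × α => Φ t.swap) := by
  have e : ∀ x y, pair (fun t : β × α => Φ t.swap) x y = pair Φ y x := by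
    intro x y
    unfold pair
    rw [← Equiv.sum_comp (Equiv.prodComm β α)]
    exact Finset.sum_congr rfl fun t _ => by simp [mul_comm]
  intro x x' y y' hxy
  rw [e] at hxy
  rw [e, e, ← inner_conj_symm, h _ _ _ _ hxy, map_zero]

theorem rank_reduced_le {Φ : α × β → H} (h : NoFilter Φ) {P : Matrix (α × β) (α × β) ℂ}
    (hP : P.PosSemidef) (hΦ : ∀ u : α × β → ℂ, ∑ s, u s • Φ s = 0 ↔ u ᵥ* P = 0) :
    max (reducedFst P).rank (reducedSnd P).rank ≤ P.rank := by
  refine max_le ?_ (rank_reducedSnd_le h hP hΦ)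
  have := rank_reducedSnd_le h.swap (P := P.submatrix Prod.swap Prod.swap) (hP.submatrix _) ?_
  · have e : (P.submatrix Prod.swap Prod.swap).rank = P.rank :=
      rank_submatrix P (Equiv.prodComm β α) (Equiv.prodComm β α)
    rw [e] at this
    exact this
  · intro u
    rw [← Equiv.sum_comp (Equiv.prodComm α β)]
    have := hΦ (fun t => u t.swap)
    simp only [Equiv.prodComm_apply, Prod.swap_swap]
    rw [this]
    have e2 : ∀ t, (u ᵥ* P.submatrix Prod.swap Prod.swap) t = ((fun t => u t.swap) ᵥ* P) t.swap := by
      intro t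
      simp only [vecMul, dotProduct, submatrix_apply]
      rw [← Equiv.sum_comp (Equiv.prodComm α β)]
      rfl
    constructor
    · intro h0
      ext t
      rw [e2, h0]
      rfl
    · intro h0
      ext t
      have := congrFun h0 t.swap
      rw [e2] at this
      simpa using this

end RankCriterion

/-! ### PPT states are not distillable -/

section PPT

variable {α β : Type*} [Fintype α] [Fintype β]

/-- Partial transposition turns the filter F ⊗ G into F ⊗ conj G, so it commutes with local
filtering up to this replacement and positivity survives. -/
theorem IsPPT.not_isOneDistillable {ρ : Matrix (α × β) (α × β) ℂ} (h : IsPPT ρ) :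
    ¬ IsOneDistillable ρ := by
  rintro ⟨F, G, hFG⟩
  apply hFG
  have e : partialTranspose ((F ⊗ₖ G) * ρ * (F ⊗ₖ G).conjTranspose) =
      (F ⊗ₖ G.map star) * partialTranspose ρ * (F ⊗ₖ G.map star).conjTranspose := by
    ext ⟨i, j⟩ ⟨k, l⟩
    simp only [partialTranspose, Matrix.mul_apply, of_apply, kroneckerMap_apply,
      conjTranspose_apply, Finset.sum_mul, map_apply, Fintype.sum_prod_type, star_mul', star_star]
    calc _ = ∑ a, ∑ b, ∑ a', ∑ b', F i a' * G l b' * ρ (a', b') (a, b) * (star (F k a) * star (G j b)) := rfl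
      _ = ∑ a, ∑ a', ∑ b, ∑ b', F i a' * G l b' * ρ (a', b') (a, b) * (star (F k a) * star (G j b)) :=
        Finset.sum_congr rfl fun _ _ => Finset.sum_comm
      _ = ∑ a, ∑ a', ∑ b', ∑ b, F i a' * G l b' * ρ (a', b') (a, b) * (star (F k a) * star (G j b)) :=
        Finset.sum_congr rfl fun _ _ => Finset.sum_congr rfl fun _ _ => Finset.sum_comm
      _ = ∑ a, ∑ b', ∑ a', ∑ b, F i a' * G l b' * ρ (a', b') (a, b) * (star (F k a) * star (G j b)) :=
        Finset.sum_congr rfl fun _ _ => Finset.sum_comm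
      _ = _ := by
        refine Finset.sum_congr rfl fun _ _ => Finset.sum_congr rfl fun _ _ =>
          Finset.sum_congr rfl fun _ _ => Finset.sum_congr rfl fun _ _ => ?_
        ring
  rw [IsPPT, e]
  exact h.mul_mul_conjTranspose_same _

theorem posSemidef_copies {ρ : Matrix (α × β) (α × β) ℂ} (h : ρ.PosSemidef) (n : ℕ) :
    (copies n ρ).PosSemidef := by
  obtain ⟨m, Q, rfl⟩ := exists_factorization h
  let R : Matrix ((Fin n → α) × (Fin n → β)) (Fin n → Fin m) ℂ :=
    Matrix.of fun s k => ∏ i, Q (s.1 i, s.2 i) (k i)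
  have e : copies n (Q * Qᴴ) = R * Rᴴ := by
    ext s t
    simp only [copies, of_apply, Matrix.mul_apply, conjTranspose_apply, R]
    rw [Finset.prod_univ_sum]
    simp [Finset.prod_mul_distrib, star_prod]
  rw [e]
  exact posSemidef_self_mul_conjTranspose R

theorem IsPPT.not_isDistillable {ρ : Matrix (α × β) (α × β) ℂ} (h : IsPPT ρ) :
    ¬ IsDistillable ρ := by
  rintro ⟨n, -, hn⟩
  refine IsPPT.not_isOneDistillable ?_ hn
  -- The partial transpose of the copies is, by unfolding, the copies of the partial transpose.
  exact posSemidef_copies h n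

theorem IsOneDistillable.isDistillable {ρ : Matrix (α × β) (α × β) ℂ} (h : IsOneDistillable ρ) :
    IsDistillable ρ := by
  obtain ⟨F, G, hFG⟩ := h
  let f : (Fin 1 → α) ≃ α := Equiv.funUnique (Fin 1) α
  let g : (Fin 1 → β) ≃ β := Equiv.funUnique (Fin 1) β
  refine ⟨1, le_rfl, F.submatrix id f, G.submatrix id g, ?_⟩
  have e1 : copies 1 ρ = ρ.submatrix (f.prodCongr g) (f.prodCongr g) := by
    ext s t
    simp only [copies, of_apply, Fintype.prod_unique]
    rfl
  have e2 : (F.submatrix id f ⊗ₖ G.submatrix id g) = (F ⊗ₖ G).submatrix id (f.prodCongr g) := by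
    ext s t
    simp
  rw [e1, e2, submatrix_mul_equiv, conjTranspose_submatrix, submatrix_mul_equiv, submatrix_id_id]
  exact hFG

end PPT

/-! ### Range criterion for convex mixtures of pure states -/

section ConvexHull

variable {ι : Type*} [Fintype ι]

theorem vecMul_pureState (w : ι → ℂ) (v : EuclideanSpace ℂ ι) :
    w ᵥ* pureState v ⬝ᵥ star w = ‖w ⬝ᵥ v.ofLp‖ ^ 2 := by
  have e : w ᵥ* pureState v = (w ⬝ᵥ v.ofLp) • star v.ofLp := by
    ext t
    simp [vecMul, dotProduct, pureState, Finset.sum_mul, mul_assoc]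
  rw [e, smul_dotProduct, ← Complex.mul_conj', smul_eq_mul]
  congr 1
  simp [dotProduct, mul_comm]

/-- If w annihilates ρ from the left, the nonnegative numbers c i |w · v i|² add up to zero. So
every pure state of nonzero weight is killed by all such w, which means that it lies in the range of
ρ. -/
theorem exists_decomposition {p : EuclideanSpace ℂ ι → Prop} {ρ : Matrix ι ι ℂ}
    (h : ρ ∈ convexHull ℝ {σ | ∃ v : EuclideanSpace ℂ ι, ‖v‖ = 1 ∧ p v ∧ σ = pureState v}) :
    ∃ (κ : Type) (_ : Fintype κ) (c : κ → ℝ) (v : κ → EuclideanSpace ℂ ι), (∑ i, c i = 1) ∧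
      (∀ i, 0 ≤ c i) ∧ (∀ i, ‖v i‖ = 1 ∧ p (v i)) ∧ ρ = ∑ i, c i • pureState (v i) ∧
      ∀ i, c i ≠ 0 → ∀ w : ι → ℂ, w ᵥ* ρ = 0 → w ⬝ᵥ (v i).ofLp = 0 := by
  obtain ⟨κ, _, c, z, hc, hc1, hz, rfl⟩ := mem_convexHull_iff_exists_fintype.1 h
  choose v hv hp hzv using hz
  obtain rfl : z = fun i => pureState (v i) := funext hzv
  refine ⟨κ, ‹_›, c, v, hc1, hc, fun i => ⟨hv i, hp i⟩, rfl, fun i hi w hw => ?_⟩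
  have h1 : ∑ j, c j * ‖w ⬝ᵥ (v j).ofLp‖ ^ 2 = 0 := by
    have h2 : w ᵥ* (∑ j, c j • pureState (v j)) ⬝ᵥ star w = 0 := by rw [hw, zero_dotProduct]
    rw [vecMul_sum, sum_dotProduct] at h2
    have h3 : ∀ j, w ᵥ* (c j • pureState (v j)) ⬝ᵥ star w =
        ((c j * ‖w ⬝ᵥ (v j).ofLp‖ ^ 2 : ℝ) : ℂ) := by
      intro j
      rw [vecMul_smul, smul_dotProduct, vecMul_pureState]
      simp
    simp_rw [h3] at h2
    exact_mod_cast h2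
  have h4 := (Finset.sum_eq_zero_iff_of_nonneg
    fun j _ => mul_nonneg (hc j) (sq_nonneg _)).1 h1 i (Finset.mem_univ i)
  simpa using (mul_eq_zero.1 h4).resolve_left hi

theorem exists_mem_of_mem_convexHull {p : EuclideanSpace ℂ ι → Prop} {ρ : Matrix ι ι ℂ}
    (h : ρ ∈ convexHull ℝ {σ | ∃ v : EuclideanSpace ℂ ι, ‖v‖ = 1 ∧ p v ∧ σ = pureState v}) :
    ∃ v : EuclideanSpace ℂ ι, ‖v‖ = 1 ∧ p v ∧ ∀ w : ι → ℂ, w ᵥ* ρ = 0 → w ⬝ᵥ v.ofLp = 0 := by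
  obtain ⟨κ, _, c, v, hc1, -, hv, -, hr⟩ := exists_decomposition h
  obtain ⟨i, hi⟩ : ∃ i, c i ≠ 0 := by
    by_contra! hcon
    simp [hcon] at hc1
  exact ⟨v i, (hv i).1, (hv i).2, hr i hi⟩

/-- A functional vanishing on the product vectors in the range of a separable state vanishes on
the whole range. -/
theorem vecMul_eq_zero_of_mem_convexHull {p : EuclideanSpace ℂ ι → Prop} {ρ : Matrix ι ι ℂ}
    (h : ρ ∈ convexHull ℝ {σ | ∃ v : EuclideanSpace ℂ ι, ‖v‖ = 1 ∧ p v ∧ σ = pureState v})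
    {w : ι → ℂ} (hw : ∀ v : EuclideanSpace ℂ ι, p v →
      (∀ u : ι → ℂ, u ᵥ* ρ = 0 → u ⬝ᵥ v.ofLp = 0) → w ⬝ᵥ v.ofLp = 0) : w ᵥ* ρ = 0 := by
  obtain ⟨κ, _, c, v, -, -, hv, hρ, hr⟩ := exists_decomposition h
  have e : ∀ i, w ᵥ* (c i • pureState (v i)) = 0 := by
    intro i
    by_cases hi : c i = 0
    · simp [hi]
    · have h0 := hw (v i) (hv i).2 (hr i hi)
      rw [vecMul_smul]
      have : w ᵥ* pureState (v i) = (w ⬝ᵥ (v i).ofLp) • star (v i).ofLp := by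
        ext t
        simp [vecMul, dotProduct, pureState, Finset.sum_mul, mul_assoc]
      rw [this, h0, zero_smul, smul_zero]
  rw [hρ, vecMul_sum]
  exact Finset.sum_eq_zero fun i _ => e i

end ConvexHull

end BlockCube

namespace BlockCube

open Matrix Module

/-! ### Projectors onto complements of orthogonal families -/

section Projector

variable {ι κ : Type*} [Fintype ι] [DecidableEq ι] [Fintype κ]

theorem projMatrix_mulVec (S : Submodule ℂ (EuclideanSpace ℂ ι)) (w : ι → ℂ) :
    projMatrix S *ᵥ w = (S.starProjection (WithLp.toLp 2 w)).ofLp := by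
  have e : WithLp.toLp 2 w = ∑ t, w t • EuclideanSpace.single t (1 : ℂ) := by
    ext s
    simp [Finset.sum_apply, Pi.single_apply]
  ext s
  rw [e, map_sum]
  simp [mulVec, dotProduct, projMatrix, mul_comm]

theorem vecMul_eq_zero_iff_forall (ρ : Matrix ι ι ℂ) (u : ι → ℂ) :
    u ᵥ* ρ = 0 ↔ ∀ z, u ⬝ᵥ (ρ *ᵥ z) = 0 := by
  simp_rw [dotProduct_mulVec]
  constructor
  · intro h z
    rw [h, zero_dotProduct]
  · intro h
    ext t
    simpa using h (Pi.single t 1)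

theorem vecMul_projMatrix_eq_zero_iff (S : Submodule ℂ (EuclideanSpace ℂ ι)) (u : ι → ℂ) :
    u ᵥ* projMatrix S = 0 ↔ ∀ f ∈ S, u ⬝ᵥ f.ofLp = 0 := by
  rw [vecMul_eq_zero_iff_forall]
  simp_rw [projMatrix_mulVec]
  constructor
  · intro h f hf
    have := h f.ofLp
    rwa [WithLp.toLp_ofLp, Submodule.starProjection_eq_self_iff.2 hf] at this
  · intro h z
    exact h _ (Submodule.starProjection_apply_mem S _)

theorem projMatrix_posSemidef (S : Submodule ℂ (EuclideanSpace ℂ ι)) :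
    (projMatrix S).PosSemidef := by
  -- In the index convention of `IsGram`, the columns of the projector have its transpose as Gram
  -- matrix.
  have h : IsGram (fun s => S.starProjection (EuclideanSpace.single s (1 : ℂ))) (projMatrix S)ᵀ := by
    intro s t
    rw [Submodule.inner_starProjection_left_eq_right,
      Submodule.starProjection_eq_self_iff.2 (Submodule.starProjection_apply_mem S _)]
    rw [EuclideanSpace.inner_single_left]
    simp [projMatrix]
  simpa using h.posSemidef.transpose

theorem supportedOn_projMatrix_smul (S : Submodule ℂ (EuclideanSpace ℂ ι)) (c : ℂ) :
    SupportedOn (c • projMatrix S) S := by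
  intro v
  rw [smul_mulVec, projMatrix_mulVec, WithLp.toLp_smul]
  exact S.smul_mem _ (Submodule.starProjection_apply_mem S _)

/-- Weighted sum of the rank one projectors onto the vectors of an orthogonal family. -/
noncomputable def familyProj (v : κ → EuclideanSpace ℂ ι) : Matrix ι ι ℂ :=
  ∑ i, ((‖v i‖ : ℂ) ^ 2)⁻¹ • pureState (v i)

theorem projMatrix_orthogonal_span {v : κ → EuclideanSpace ℂ ι} (h0 : ∀ i, v i ≠ 0)
    (hv : Pairwise fun i j => inner ℂ (v i) (v j) = 0) :
    projMatrix (Submodule.span ℂ (Set.range v))ᗮ = 1 - familyProj v := by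
  have key : ∀ w : EuclideanSpace ℂ ι, (Submodule.span ℂ (Set.range v)).starProjection w =
      ∑ i, (((‖v i‖ : ℂ) ^ 2)⁻¹ * inner ℂ (v i) w) • v i := by
    intro w
    refine Submodule.eq_starProjection_of_mem_of_inner_eq_zero ?_ ?_
    · exact Submodule.sum_mem _ fun i _ => Submodule.smul_mem _ _
        (Submodule.subset_span ⟨i, rfl⟩)
    · intro u hu
      induction hu using Submodule.span_induction with
      | mem x hx =>
        obtain ⟨j, rfl⟩ := hx
        rw [inner_eq_zero_symm, inner_sub_right, inner_sum,
          Finset.sum_eq_single j (fun i _ hij => by rw [inner_smul_right, hv hij.symm, mul_zero])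
          (fun hj => absurd (Finset.mem_univ j) hj), inner_smul_right, inner_self_eq_norm_sq_to_K]
        have : (‖v j‖ : ℂ) ≠ 0 := by simpa using h0 j
        simp only [Complex.coe_algebraMap]
        field_simp
        ring
      | zero => simp
      | add x y _ _ hx hy => rw [inner_add_right, hx, hy, add_zero]
      | smul a x _ hx => rw [inner_smul_right, hx, mul_zero]
  ext s t
  have e : projMatrix (Submodule.span ℂ (Set.range v))ᗮ s t =
      (projMatrix (Submodule.span ℂ (Set.range v))ᗮ *ᵥ (EuclideanSpace.single t (1 : ℂ)).ofLp) s := by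
    simp
  rw [e, projMatrix_mulVec, WithLp.toLp_ofLp, Submodule.starProjection_orthogonal_val, key]
  simp [familyProj, Matrix.sum_apply, pureState, Matrix.one_apply,
    EuclideanSpace.inner_single_right, mul_comm, mul_assoc]

end Projector

/-! ### Positive partial transpose of the complement of an orthogonal product family -/

section ProductProjector

variable {α β κ : Type*} [Fintype α] [Fintype β] [Fintype κ]

theorem inner_of_product {v w : EuclideanSpace ℂ (α × β)} {x x' : EuclideanSpace ℂ α}
    {y y' : EuclideanSpace ℂ β} (hv : ∀ t : α × β, v t = x t.1 * y t.2)
    (hw : ∀ t : α × β, w t = x' t.1 * y' t.2) :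
    inner ℂ v w = inner ℂ x x' * inner ℂ y y' := by
  simp only [PiLp.inner_apply, hv, hw, Fintype.sum_prod_type, RCLike.inner_apply,
    Finset.sum_mul_sum, map_mul]
  exact Finset.sum_congr rfl fun _ _ => Finset.sum_congr rfl fun _ _ => by ring

/-- Partial transposition conjugates the second factor of every product vector. Inner products of
second factors are merely conjugated, so norms and orthogonality persist. The partial transpose is
therefore again the projector onto the complement of an orthogonal family. -/
theorem isPPT_one_sub_familyProj [DecidableEq α] [DecidableEq β] {v : κ → EuclideanSpace ℂ (α × β)} (h0 : ∀ i, v i ≠ 0)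
    (hv : Pairwise fun i j => inner ℂ (v i) (v j) = 0) (hp : ∀ i, IsProduct (v i)) :
    IsPPT (1 - familyProj v) := by
  choose x y hxy using hp
  let yc : κ → EuclideanSpace ℂ β := fun i => WithLp.toLp 2 fun b => star (y i b)
  let w : κ → EuclideanSpace ℂ (α × β) := fun i => WithLp.toLp 2 fun t => x i t.1 * yc i t.2
  have hw : ∀ i t, w i t = x i t.1 * yc i t.2 := fun _ _ => rfl
  have hyc : ∀ i j, inner ℂ (yc i) (yc j) = star (inner ℂ (y i) (y j)) := by
    intro i j
    simp [PiLp.inner_apply, yc, mul_comm]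
  have hin : ∀ i j, inner ℂ (w i) (w j) = inner ℂ (x i) (x j) * star (inner ℂ (y i) (y j)) := by
    intro i j
    rw [inner_of_product (hw i) (hw j), hyc]
  have hin' : ∀ i j, inner ℂ (v i) (v j) = inner ℂ (x i) (x j) * inner ℂ (y i) (y j) :=
    fun i j => inner_of_product (hxy i) (hxy j)
  have hnorm : ∀ i, (‖w i‖ : ℂ) ^ 2 = (‖v i‖ : ℂ) ^ 2 := by
    intro i
    have h1 := inner_self_eq_norm_sq_to_K (𝕜 := ℂ) (w i)
    have h2 := inner_self_eq_norm_sq_to_K (𝕜 := ℂ) (v i)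
    simp only [Complex.coe_algebraMap] at h1 h2
    rw [← h1, ← h2, hin, hin', inner_self_eq_norm_sq_to_K (y i)]
    simp
  have hw0 : ∀ i, w i ≠ 0 := by
    intro i hi
    apply h0 i
    have := hnorm i
    rw [hi] at this
    simpa using this.symm
  have horth : Pairwise fun i j => inner ℂ (w i) (w j) = 0 := by
    intro i j hij
    have h1 := hv hij
    simp only [hin', mul_eq_zero] at h1
    simp only [hin, mul_eq_zero, star_eq_zero]
    exact h1
  have e : partialTranspose (1 - familyProj v) = 1 - familyProj w := by
    ext ⟨a, b⟩ ⟨a', b'⟩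
    simp only [partialTranspose, of_apply, Matrix.sub_apply, one_apply, Prod.mk.injEq, familyProj, hnorm,
      Matrix.sum_apply, Matrix.smul_apply, pureState, hxy, hw, smul_eq_mul, star_mul', yc, star_star]
    congr 1
    · simp only [eq_comm (a := b) (b := b')]
    · exact Finset.sum_congr rfl fun _ _ => by ring
  rw [IsPPT, e, ← projMatrix_orthogonal_span hw0 horth]
  exact projMatrix_posSemidef _

end ProductProjector

/-! ### Orthogonal sets: dimension, unions, complements -/

section OrthogonalSets

variable {E : Type*} [NormedAddCommGroup E] [InnerProductSpace ℂ E]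

/-- Nonzero pairwise orthogonal vectors. -/
structure IsOrthSet (U : Set E) : Prop where
  ne_zero : ∀ v ∈ U, v ≠ 0
  orthogonal : U.Pairwise fun v w => inner ℂ v w = 0

theorem IsOrthSet.linearIndependent {U : Set E} (h : IsOrthSet U) :
    LinearIndependent ℂ (fun u : U => (u : E)) := by
  refine linearIndependent_of_ne_zero_of_inner_eq_zero (fun u => h.ne_zero u u.2) ?_
  intro u v huv
  exact h.orthogonal u.2 v.2 fun e => huv (Subtype.ext e)

theorem IsOrthSet.finite [FiniteDimensional ℂ E] {U : Set E} (h : IsOrthSet U) : U.Finite :=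
  h.linearIndependent.set_finite_of_isNoetherian

theorem IsOrthSet.finrank_span [FiniteDimensional ℂ E] {U : Set E} (h : IsOrthSet U) :
    finrank ℂ (Submodule.span ℂ U) = U.ncard := by
  have := h.finite.fintype
  rw [finrank_span_set_eq_card h.linearIndependent, Set.ncard_eq_toFinset_card']

theorem IsOrthSet.mono {U U' : Set E} (h : IsOrthSet U) (hs : U' ⊆ U) : IsOrthSet U' :=
  ⟨fun v hv => h.ne_zero v (hs hv), h.orthogonal.mono hs⟩

theorem isOrthSet_range {κ : Type*} {w : κ → E} (h0 : ∀ i, w i ≠ 0)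
    (hw : Pairwise fun i j => inner ℂ (w i) (w j) = 0) : IsOrthSet (Set.range w) := by
  refine ⟨by rintro _ ⟨i, rfl⟩; exact h0 i, ?_⟩
  rintro _ ⟨i, rfl⟩ _ ⟨j, rfl⟩ hij
  exact hw fun e => hij (e ▸ rfl)

theorem ncard_range_of_orthogonal {κ : Type*} {w : κ → E} (h0 : ∀ i, w i ≠ 0)
    (hw : Pairwise fun i j => inner ℂ (w i) (w j) = 0) : (Set.range w).ncard = Nat.card κ := by
  have hinj : Function.Injective w := by
    intro i j hij
    by_contra hne
    have : inner ℂ (w i) (w j) = 0 := hw hne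
    rw [hij, inner_self_eq_zero] at this
    exact h0 j this
  rw [← Set.image_univ, Set.ncard_image_of_injective _ hinj, Set.ncard_univ]

theorem IsOrthSet.union {U U' : Set E} (h : IsOrthSet U) (h' : IsOrthSet U')
    (hU : ∀ u ∈ U, ∀ v ∈ U', inner ℂ u v = 0) : IsOrthSet (U ∪ U') := by
  refine ⟨fun v hv => hv.elim (h.ne_zero v) (h'.ne_zero v), ?_⟩
  rintro u (hu | hu) v (hv | hv) huv
  · exact h.orthogonal hu hv huv
  · exact hU u hu v hv
  · exact inner_eq_zero_symm.1 (hU v hv u hu)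
  · exact h'.orthogonal hu hv huv

theorem IsOrthSet.ncard_union [FiniteDimensional ℂ E] {U U' : Set E} (h : IsOrthSet U)
    (h' : IsOrthSet U') (hU : ∀ u ∈ U, ∀ v ∈ U', inner ℂ u v = 0) :
    (U ∪ U').ncard = U.ncard + U'.ncard := by
  refine Set.ncard_union_eq ?_ h.finite h'.finite
  rw [Set.disjoint_left]
  intro u hu hu'
  exact h.ne_zero u hu (inner_self_eq_zero.1 (hU u hu u hu'))

theorem IsOrthSet.ncard_add_finrank_orthogonal [FiniteDimensional ℂ E] {U : Set E}
    (h : IsOrthSet U) : U.ncard + finrank ℂ (Submodule.span ℂ U)ᗮ = finrank ℂ E := by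
  rw [← h.finrank_span]
  exact Submodule.finrank_add_finrank_orthogonal _

theorem mem_orthogonal_span_iff {U : Set E} {f : E} :
    f ∈ (Submodule.span ℂ U)ᗮ ↔ ∀ u ∈ U, inner ℂ u f = 0 := by
  rw [Submodule.mem_orthogonal]
  constructor
  · exact fun h u hu => h u (Submodule.subset_span hu)
  · intro h u hu
    induction hu using Submodule.span_induction with
    | mem x hx => exact h x hx
    | zero => simp
    | add x y _ _ hx hy => rw [inner_add_left, hx, hy, add_zero]
    | smul a x _ hx => rw [inner_smul_left, hx, mul_zero]

/-- In an orthogonal spanning set, the complement of one part is spanned by the rest. -/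
theorem IsOrthSet.orthogonal_le_span {U U' : Set E} (hU : ∀ u ∈ U, ∀ v ∈ U', inner ℂ u v = 0)
    (htop : Submodule.span ℂ (U ∪ U') = ⊤) :
    (Submodule.span ℂ U)ᗮ ≤ Submodule.span ℂ U' := by
  intro f hf
  have h1 : f ∈ Submodule.span ℂ U ⊔ Submodule.span ℂ U' := by
    rw [← Submodule.span_union, htop]
    trivial
  obtain ⟨a, ha, b, hb, rfl⟩ := Submodule.mem_sup.1 h1
  have hb' : b ∈ (Submodule.span ℂ U)ᗮ := by
    have : Submodule.span ℂ U' ≤ (Submodule.span ℂ U)ᗮ :=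
      Submodule.span_le.2 fun v hv => mem_orthogonal_span_iff.2 fun u hu => hU u hu v hv
    exact this hb
  have ha' : a ∈ (Submodule.span ℂ U)ᗮ := by
    have := Submodule.sub_mem _ hf hb'
    rwa [add_sub_cancel_right] at this
  have : a = 0 := by
    have := Submodule.inner_right_of_mem_orthogonal ha ha'
    rwa [inner_self_eq_zero] at this
  rwa [this, zero_add]

end OrthogonalSets

/-! ### Zero-sum functions with one nonzero value -/

section TwoValued

/-- A function with vanishing sum and at most one nonzero value vanishes. -/
theorem eq_zero_of_two_valued {ι H : Type*} [Fintype ι] [AddCommGroup H] [Module ℂ H]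
    {h : ι → H} {c : H} (hc : ∀ t, h t = 0 ∨ h t = c) (hs : ∑ t, h t = 0) : ∀ t, h t = 0 := by
  classical
  intro t
  by_contra ht
  have htc : h t = c := (hc t).resolve_left ht
  have e : ∀ s, h s = (if h s = 0 then (0 : ℂ) else 1) • c := by
    intro s
    by_cases h0 : h s = 0
    · simp [h0]
    · rw [if_neg h0, one_smul]
      exact (hc s).resolve_left h0
  -- The sum is the number of nonzero terms times c, and in ℂ this number is zero only if there are
  -- none.
  rw [Finset.sum_congr rfl fun s _ => e s, ← Finset.sum_smul, smul_eq_zero] at hs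
  rcases hs with hs | hs
  · rw [Finset.sum_ite] at hs
    simp only [Finset.sum_const_zero, Finset.sum_const, zero_add, nsmul_eq_mul, mul_one,
      Nat.cast_eq_zero, Finset.card_eq_zero] at hs
    have : t ∈ Finset.filter (fun x => ¬ h x = 0) Finset.univ := by simp [ht]
    rw [hs] at this
    simp at this
  · exact ht (htc.trans hs)

end TwoValued

end BlockCube

namespace BlockCube

noncomputable section

open Module

variable {d : ℕ}

/-! ## Product vectors and local bases -/

@[simp] theorem ket_apply (a b : Fin d) : ket a b = if b = a then 1 else 0 := by
  simp [ket]

@[simp] theorem tri_apply (x y z : Qudit d) (t : Cube d) :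
    tri x y z t = x t.1 * y t.2.1 * z t.2.2 := rfl

theorem inner_tri (x y z x' y' z' : Qudit d) :
    inner ℂ (tri x y z) (tri x' y' z') = inner ℂ x x' * inner ℂ y y' * inner ℂ z z' := by
  simp only [PiLp.inner_apply, tri_apply, RCLike.inner_apply, map_mul]
  rw [Finset.sum_mul_sum, Finset.sum_mul, Fintype.sum_prod_type]
  refine Finset.sum_congr rfl fun a _ => ?_
  rw [Finset.sum_mul_sum, Fintype.sum_prod_type]
  exact Finset.sum_congr rfl fun _ _ => Finset.sum_congr rfl fun _ _ => by ring

/-- The sum of the computational basis vectors with labels in `s`. -/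
def indVec (s : Finset (Fin d)) : Qudit d := ∑ a ∈ s, ket a

@[simp] theorem indVec_apply (s : Finset (Fin d)) (b : Fin d) :
    indVec s b = if b ∈ s then 1 else 0 := by
  simp [indVec, Finset.sum_apply]

theorem eq_sum_ket (u : Qudit d) : u = ∑ a, u a • ket a := by
  ext b
  simp [Finset.sum_apply]

theorem mem_span_ket_iff {s : Finset (Fin d)} {u : Qudit d} :
    u ∈ Submodule.span ℂ (ket '' (s : Set (Fin d))) ↔ ∀ a ∉ s, u a = 0 := by
  constructor
  · intro h a ha
    induction h using Submodule.span_induction with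
    | mem x hx =>
      obtain ⟨b, hb, rfl⟩ := hx
      have : a ≠ b := fun e => ha (e ▸ hb)
      simp [this]
    | zero => simp
    | add x y _ _ hx hy => simp [hx, hy]
    | smul c x _ hx => simp [hx]
  · intro h
    rw [eq_sum_ket u]
    refine Submodule.sum_mem _ fun a _ => ?_
    by_cases ha : a ∈ s
    · exact Submodule.smul_mem _ _ (Submodule.subset_span ⟨a, ha, rfl⟩)
    · rw [h a ha, zero_smul]
      exact Submodule.zero_mem _

theorem finrank_span_ket (s : Finset (Fin d)) :
    finrank ℂ (Submodule.span ℂ (ket '' (s : Set (Fin d)))) = s.card := by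
  have h0 : ∀ a : s, (ket (a : Fin d)) ≠ 0 := by
    intro a ha
    have := congrArg (fun v : Qudit d => v a) ha
    simp at this
  have h1 : Pairwise fun a b : s => inner ℂ (ket (a : Fin d)) (ket (b : Fin d)) = 0 := by
    intro a b hab
    have : (a : Fin d) ≠ b := fun e => hab (Subtype.ext e)
    simp [ket, EuclideanSpace.inner_single_left, this]
  have e : ket '' (s : Set (Fin d)) = Set.range fun a : s => ket (a : Fin d) := by
    ext v
    simp
  rw [e, (isOrthSet_range h0 h1).finrank_span, ncard_range_of_orthogonal h0 h1]
  simp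

/-- An orthogonal basis of the space spanned by the `|a⟩` with `a ∈ s`, containing their sum. -/
structure IsLocalBasis (s : Finset (Fin d)) (E : Set (Qudit d)) : Prop where
  orth : IsOrthSet E
  indVec_mem : indVec s ∈ E
  span_eq : Submodule.span ℂ E = Submodule.span ℂ (ket '' (s : Set (Fin d)))

theorem IsLocalBasis.apply_eq_zero {s : Finset (Fin d)} {E : Set (Qudit d)}
    (h : IsLocalBasis s E) {u : Qudit d} (hu : u ∈ E) {a : Fin d} (ha : a ∉ s) : u a = 0 :=
  mem_span_ket_iff.1 (h.span_eq ▸ Submodule.subset_span hu) a ha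

/-- Orthogonal nonzero vectors of the span, as many as its dimension, generate it. -/
theorem isLocalBasis_range {κ : Type*} [Finite κ] {s : Finset (Fin d)} {w : κ → Qudit d}
    (h0 : ∀ i, w i ≠ 0) (hw : Pairwise fun i j => inner ℂ (w i) (w j) = 0)
    (hmem : ∀ i, w i ∈ Submodule.span ℂ (ket '' (s : Set (Fin d))))
    (hcard : Nat.card κ = s.card) {i₀ : κ} (hi : w i₀ = indVec s) :
    IsLocalBasis s (Set.range w) := by
  refine ⟨isOrthSet_range h0 hw, ⟨i₀, hi⟩, ?_⟩
  refine Submodule.eq_of_le_of_finrank_eq (Submodule.span_le.2 ?_) ?_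
  · rintro _ ⟨i, rfl⟩
    exact hmem i
  · rw [(isOrthSet_range h0 hw).finrank_span, ncard_range_of_orthogonal h0 hw, hcard,
      finrank_span_ket]

theorem isLocalBasis_singleton (a : Fin d) : IsLocalBasis {a} {ket a} := by
  have e : indVec {a} = ket a := by simp [indVec]
  have h := isLocalBasis_range (κ := Unit) (s := {a}) (w := fun _ => ket a) (i₀ := ()) ?_ ?_ ?_ ?_
    e.symm
  · simpa using h
  · intro _ h
    have := congrArg (fun v : Qudit d => v a) h
    simp at this
  · intro i j hij
    exact absurd (Subsingleton.elim i j) hij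
  · intro _
    exact Submodule.subset_span ⟨a, by simp, rfl⟩
  · simp

/-! ## Cells: the supports of the blocks -/

/-- The ranges of one coordinate in a block. -/
inductive Side (d : ℕ)
  | low (k : Fin (numLayers d))
  | high (k : Fin (numLayers d))
  | eta (k : Fin (numLayers d))
  | xi (k : Fin (numLayers d))
  | core

/-- The blocks: the facial blocks, the ends of the body diagonal and the centre. -/
inductive Cell (d : ℕ)
  | face (k : Fin (numLayers d)) (p : Face)
  | lo (k : Fin (numLayers d))
  | hi (k : Fin (numLayers d))
  | core

/-- The coordinates of the central block. -/
def coreSet (d : ℕ) : Finset (Fin d) :=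
  Finset.univ.filter fun a => numLayers d ≤ (a : ℕ) ∧ (a : ℕ) + numLayers d < d

/-- The set of coordinates of a side. -/
def Side.set : Side d → Finset (Fin d)
  | .low k => {BlockCube.low k}
  | .high k => {BlockCube.high k}
  | .eta k => Finset.Ico (BlockCube.low k) (BlockCube.high k)
  | .xi k => Finset.Ioc (BlockCube.low k) (BlockCube.high k)
  | .core => coreSet d

/-- The local basis of a side. -/
def Side.basis (V : LayerVectors d) : Side d → Set (Qudit d)
  | .low k => {ket (BlockCube.low k)}
  | .high k => {ket (BlockCube.high k)}
  | .eta k => Set.range (V.eta k)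
  | .xi k => Set.range (V.xi k)
  | .core => {u | Even d ∧ ∃ l, u = phi d l} ∪ {u | ¬ Even d ∧ u = indVec (coreSet d)}

/-- The first side of a cell. -/
def Cell.fst : Cell d → Side d
  | .face k .f1 => .low k
  | .face k .f2 => .eta k
  | .face k .f3 => .high k
  | .face k .f4 => .eta k
  | .face k .f5 => .xi k
  | .face k .f6 => .xi k
  | .lo k => .low k
  | .hi k => .high k
  | .core => .core

/-- The second side of a cell. -/
def Cell.snd : Cell d → Side d
  | .face k .f1 => .eta k
  | .face k .f2 => .high k
  | .face k .f3 => .xi k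
  | .face k .f4 => .xi k
  | .face k .f5 => .low k
  | .face k .f6 => .eta k
  | .lo k => .low k
  | .hi k => .high k
  | .core => .core

/-- The third side of a cell. -/
def Cell.trd : Cell d → Side d
  | .face k .f1 => .xi k
  | .face k .f2 => .xi k
  | .face k .f3 => .eta k
  | .face k .f4 => .low k
  | .face k .f5 => .eta k
  | .face k .f6 => .high k
  | .lo k => .low k
  | .hi k => .high k
  | .core => .core

/-- The labels of the basic blocks of a cell. -/
def Cell.Mem (c : Cell d) (t : Cube d) : Prop :=
  t.1 ∈ c.fst.set ∧ t.2.1 ∈ c.snd.set ∧ t.2.2 ∈ c.trd.set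

theorem Side.mem_low {k : Fin (numLayers d)} {a : Fin d} :
    a ∈ (Side.low k).set ↔ (a : ℕ) = k := by
  simp [Side.set, BlockCube.low, Fin.ext_iff]

theorem Side.mem_high {k : Fin (numLayers d)} {a : Fin d} :
    a ∈ (Side.high k).set ↔ (a : ℕ) = d - 1 - k := by
  simp [Side.set, BlockCube.high, Fin.ext_iff]

theorem Side.mem_eta {k : Fin (numLayers d)} {a : Fin d} :
    a ∈ (Side.eta k).set ↔ (k : ℕ) ≤ a ∧ (a : ℕ) < d - 1 - k := by
  simp [Side.set, BlockCube.low, BlockCube.high, Fin.le_def, Fin.lt_def]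

theorem Side.mem_xi {k : Fin (numLayers d)} {a : Fin d} :
    a ∈ (Side.xi k).set ↔ (k : ℕ) < a ∧ (a : ℕ) ≤ d - 1 - k := by
  simp [Side.set, BlockCube.low, BlockCube.high, Fin.le_def, Fin.lt_def]

theorem Side.mem_core {a : Fin d} :
    a ∈ (Side.core : Side d).set ↔ numLayers d ≤ (a : ℕ) ∧ (a : ℕ) + numLayers d < d := by
  simp [Side.set, coreSet]

/-- Cells are boxes given by linear inequalities in the coordinates and the layer index; those of
cells of different kind or layer are contradictory. -/
theorem Cell.eq_of_mem {c c' : Cell d} {t : Cube d} (h : c.Mem t) (h' : c'.Mem t) : c = c' := by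
  obtain ⟨a, b, r⟩ := t
  have hn : ∀ k : Fin (numLayers d), 2 * (k : ℕ) + 2 < d ∧ (k : ℕ) < numLayers d :=
    fun k => ⟨two_mul_lt k, k.2⟩
  have key : ∀ k k' : Fin (numLayers d), (k : ℕ) = k' → k = k' := fun k k' e => Fin.ext e
  rcases c with ⟨k, (_ | _)⟩ | k | k | _ <;> rcases c' with ⟨k', (_ | _)⟩ | k' | k' | _ <;>
    simp only [Cell.Mem, Cell.fst, Cell.snd, Cell.trd, Side.mem_low, Side.mem_high, Side.mem_eta,
      Side.mem_xi, Side.mem_core] at h h' <;>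
    first
    | rfl
    | (exfalso; have := hn k; have := hn k'; omega)
    | (exfalso; have := hn k; omega)
    | (exfalso; have := hn k'; omega)
    | (have h1 := hn k; have h2 := hn k'; rw [key k k' (by omega)])

theorem Cell.exists_mem_layer (k : Fin (numLayers d)) (t : Cube d)
    (h1 : (k : ℕ) ≤ t.1 ∧ (t.1 : ℕ) ≤ d - 1 - k) (h2 : (k : ℕ) ≤ t.2.1 ∧ (t.2.1 : ℕ) ≤ d - 1 - k)
    (h3 : (k : ℕ) ≤ t.2.2 ∧ (t.2.2 : ℕ) ≤ d - 1 - k) :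
    (Cell.lo k).Mem t ∨ (Cell.hi k).Mem t ∨ (∃ p, (Cell.face k p).Mem t) ∨
      (((k : ℕ) < t.1 ∧ (t.1 : ℕ) < d - 1 - k) ∧ ((k : ℕ) < t.2.1 ∧ (t.2.1 : ℕ) < d - 1 - k) ∧
        ((k : ℕ) < t.2.2 ∧ (t.2.2 : ℕ) < d - 1 - k)) := by
  obtain ⟨a, b, r⟩ := t
  have hk := two_mul_lt k
  have hf : ∀ p, (Cell.face k p).Mem (a, b, r) → (Cell.lo k).Mem (a, b, r) ∨
      (Cell.hi k).Mem (a, b, r) ∨ (∃ p, (Cell.face k p).Mem (a, b, r)) ∨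
      (((k : ℕ) < a ∧ (a : ℕ) < d - 1 - k) ∧ ((k : ℕ) < b ∧ (b : ℕ) < d - 1 - k) ∧
        ((k : ℕ) < r ∧ (r : ℕ) < d - 1 - k)) := fun p hp => Or.inr (Or.inr (Or.inl ⟨p, hp⟩))
  have g1 := hf .f1
  have g2 := hf .f2
  have g3 := hf .f3
  have g4 := hf .f4
  have g5 := hf .f5
  have g6 := hf .f6
  clear hf
  -- The existential is hidden behind a variable, so that `simp` turns only the remaining
  -- memberships into inequalities.
  generalize hE : (∃ p, (Cell.face k p).Mem (a, b, r)) = E at g1 g2 g3 g4 g5 g6 ⊢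
  simp only [Cell.Mem, Cell.fst, Cell.snd, Cell.trd, Side.mem_low, Side.mem_high, Side.mem_eta,
      Side.mem_xi] at g1 g2 g3 g4 g5 g6 h1 h2 h3 ⊢
  by_cases e1 : (a : ℕ) = k
  · by_cases e3 : (r : ℕ) = k
    · by_cases e2 : (b : ℕ) = k
      · exact Or.inl ⟨e1, e2, e3⟩
      · exact g4 (by omega)
    · by_cases e2 : (b : ℕ) = d - 1 - k
      · exact g2 (by omega)
      · exact g1 (by omega)
  by_cases e2 : (a : ℕ) = d - 1 - k
  · by_cases e3 : (r : ℕ) = d - 1 - k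
    · by_cases e2 : (b : ℕ) = d - 1 - k
      · exact Or.inr (Or.inl ⟨by omega, e2, e3⟩)
      · exact g6 (by omega)
    · by_cases e2 : (b : ℕ) = k
      · exact g5 (by omega)
      · exact g3 (by omega)
  by_cases e3 : (b : ℕ) = k
  · by_cases e4 : (r : ℕ) = d - 1 - k
    · exact g6 (by omega)
    · exact g5 (by omega)
  by_cases e4 : (b : ℕ) = d - 1 - k
  · by_cases e5 : (r : ℕ) = k
    · exact g4 (by omega)
    · exact g2 (by omega)
  by_cases e5 : (r : ℕ) = k
  · exact g4 (by omega)
  by_cases e6 : (r : ℕ) = d - 1 - k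
  · exact g6 (by omega)
  exact Or.inr (Or.inr (Or.inr (by omega)))

/-- The label lies in the sub-cube of layer `j`. -/
def InCube (d j : ℕ) (t : Cube d) : Prop :=
  (j ≤ (t.1 : ℕ) ∧ (t.1 : ℕ) ≤ d - 1 - j) ∧ (j ≤ (t.2.1 : ℕ) ∧ (t.2.1 : ℕ) ≤ d - 1 - j) ∧
    (j ≤ (t.2.2 : ℕ) ∧ (t.2.2 : ℕ) ≤ d - 1 - j)

theorem inCube_zero (t : Cube d) : InCube d 0 t := by
  obtain ⟨⟨a, ha⟩, ⟨b, hb⟩, ⟨r, hr⟩⟩ := t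
  simp only [InCube]
  omega

theorem inCube_core {t : Cube d} (h : InCube d (numLayers d) t) : (Cell.core : Cell d).Mem t := by
  obtain ⟨a, b, r⟩ := t
  simp only [InCube] at h
  simp only [Cell.Mem, Cell.fst, Cell.snd, Cell.trd, Side.mem_core]
  have ha := a.2
  have : 2 * numLayers d < d := by unfold numLayers; omega
  omega

theorem Cell.layer_cases (k : Fin (numLayers d)) {t : Cube d} (h : InCube d k t) :
    (Cell.lo k).Mem t ∨ (Cell.hi k).Mem t ∨ (∃ p, (Cell.face k p).Mem t) ∨
      InCube d (k + 1) t := by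
  refine (Cell.exists_mem_layer k t h.1 h.2.1 h.2.2).imp_right (Or.imp_right (Or.imp_right ?_))
  intro h
  simp only [InCube]
  omega

/-- A label on no face and no diagonal end passes from the sub-cube of each layer to the next one
and ends in the core. -/
theorem Cell.exists_mem (t : Cube d) : ∃ c : Cell d, c.Mem t := by
  by_contra hcon
  push Not at hcon
  have : ∀ j ≤ numLayers d, InCube d j t := by
    intro j
    induction j with
    | zero => exact fun _ => inCube_zero t
    | succ j ih =>
      intro hj
      rcases Cell.layer_cases ⟨j, hj⟩ (ih (by omega)) with h | h | ⟨p, h⟩ | h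
      · exact absurd h (hcon _)
      · exact absurd h (hcon _)
      · exact absurd h (hcon _)
      · exact h
  exact hcon _ (inCube_core (this _ le_rfl))

end

end BlockCube

namespace BlockCube

noncomputable section

open Module

variable {d : ℕ}

/-! ## Local bases of the sides -/

theorem card_eta (k : Fin (numLayers d)) : (Side.eta k).set.card = side d k := by
  simp only [Side.set, Fin.card_Ico, low, high, side]
  omega

theorem card_xi (k : Fin (numLayers d)) : (Side.xi k).set.card = side d k := by
  simp only [Side.set, Fin.card_Ioc, low, high, side]
  omega

theorem middle_iff (he : Even d) (_hd : 1 ≤ numLayers d) (a : Fin d) :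
    a ∈ coreSet d ↔ (2 * (a : ℕ) + 2 = d ∨ 2 * (a : ℕ) = d) := by
  obtain ⟨m, hm⟩ := he
  simp only [coreSet, Finset.mem_filter, Finset.mem_univ, true_and]
  unfold numLayers at *
  omega

theorem phi_zero (he : Even d) (hd : 1 ≤ numLayers d) : phi d 0 = indVec (coreSet d) := by
  ext a
  simp only [phi, indVec_apply, middle_iff he hd]
  by_cases h1 : 2 * (a : ℕ) + 2 = d <;> by_cases h2 : 2 * (a : ℕ) = d <;> simp [h1, h2]

theorem isLocalBasis_core_even (he : Even d) (hd : 1 ≤ numLayers d) :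
    IsLocalBasis (coreSet d) (Set.range (phi d)) := by
  have hlt : d / 2 - 1 < d ∧ d / 2 < d := by unfold numLayers at hd; omega
  obtain ⟨m, hm⟩ := id he
  have hm2 : 2 ≤ m := by unfold numLayers at hd; omega
  let a₁ : Fin d := ⟨d / 2 - 1, hlt.1⟩
  let a₂ : Fin d := ⟨d / 2, hlt.2⟩
  have hne : a₁ ≠ a₂ := by
    intro h
    have := congrArg Fin.val h
    simp only [a₁, a₂] at this
    omega
  have hset : coreSet d = {a₁, a₂} := by
    ext a
    rw [middle_iff he hd]
    simp only [Finset.mem_insert, Finset.mem_singleton, Fin.ext_iff, a₁, a₂]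
    omega
  have hphi : ∀ l, phi d l = ket a₁ + ((-1) ^ (l : ℕ) : ℂ) • ket a₂ := by
    intro l
    ext a
    simp only [phi, PiLp.add_apply, PiLp.smul_apply, ket_apply, Fin.ext_iff, a₁, a₂, smul_eq_mul]
    have e1 : ((a : ℕ) = d / 2 - 1) ↔ 2 * (a : ℕ) + 2 = d := by omega
    have e2 : ((a : ℕ) = d / 2) ↔ 2 * (a : ℕ) = d := by omega
    simp only [e1, e2]
    by_cases h1 : 2 * (a : ℕ) + 2 = d
    · have h2 : ¬ 2 * (a : ℕ) = d := by omega
      simp [h1, h2]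
    · simp [h1]
  have hin : ∀ a b : Fin d, inner ℂ (ket a) (ket b) = if a = b then (1 : ℂ) else 0 := by
    intro a b
    simp [ket, EuclideanSpace.inner_single_left]
  refine isLocalBasis_range (i₀ := (0 : Fin 2)) ?_ ?_ ?_ ?_ (phi_zero he hd)
  · intro l h
    have := congrArg (fun v : Qudit d => v a₁) h
    simp [hphi, hne] at this
  · intro l l' hl
    simp only [hphi, inner_add_left, inner_add_right, inner_smul_left, inner_smul_right, hin, hne,
      hne.symm]
    fin_cases l <;> fin_cases l' <;> simp at hl ⊢
  · intro l
    rw [mem_span_ket_iff]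
    intro a ha
    rw [middle_iff he hd] at ha
    push Not at ha
    simp [phi, ha.1, ha.2]
  · rw [hset, Finset.card_pair hne]
    simp

theorem Side.isLocalBasis (V : LayerVectors d) (hd : 1 ≤ numLayers d) (s : Side d) :
    IsLocalBasis s.set (s.basis V) := by
  rcases s with k | k | k | k | _
  · exact isLocalBasis_singleton _
  · exact isLocalBasis_singleton _
  · refine isLocalBasis_range (V.eta_ne_zero k) (V.eta_orthogonal k) (fun i => ?_) ?_
      (V.eta_zero k)
    · simpa [Side.set] using V.eta_mem k i
    · rw [card_eta, Nat.card_eq_fintype_card, Fintype.card_fin]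
  · refine isLocalBasis_range (V.xi_ne_zero k) (V.xi_orthogonal k) (fun i => ?_) ?_
      (V.xi_zero k)
    · simpa [Side.set] using V.xi_mem k i
    · rw [card_xi, Nat.card_eq_fintype_card, Fintype.card_fin]
  · by_cases he : Even d
    · have : (Side.core : Side d).basis V = Set.range (phi d) := by
        ext u
        simp [Side.basis, he, eq_comm]
      rw [this]
      exact isLocalBasis_core_even he hd
    · have hlt : numLayers d < d := by unfold numLayers at *; omega
      have hset : coreSet d = {⟨numLayers d, hlt⟩} := by
        ext a
        rw [Nat.not_even_iff_odd] at he
        obtain ⟨m, hm⟩ := he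
        simp only [coreSet, Finset.mem_filter, Finset.mem_univ, true_and, Finset.mem_singleton,
          Fin.ext_iff]
        unfold numLayers
        omega
      have : (Side.core : Side d).basis V = {indVec (coreSet d)} := by
        ext u
        simp [Side.basis, he]
      rw [this]
      have h := isLocalBasis_singleton (⟨numLayers d, hlt⟩ : Fin d)
      have e : indVec {(⟨numLayers d, hlt⟩ : Fin d)} = ket ⟨numLayers d, hlt⟩ := by simp [indVec]
      rw [← e, ← hset] at h
      exact h

/-! ## Blocks -/

/-- The product vectors of a block. -/
def block (V : LayerVectors d) (c : Cell d) : Set (ThreeQudit d) :=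
  {v | ∃ x ∈ c.fst.basis V, ∃ y ∈ c.snd.basis V, ∃ z ∈ c.trd.basis V, v = tri x y z}

/-- The indicator vector of a cell. -/
def cellVec (c : Cell d) : ThreeQudit d :=
  tri (indVec c.fst.set) (indVec c.snd.set) (indVec c.trd.set)

open Classical in
theorem cellVec_apply (c : Cell d) (t : Cube d) : cellVec c t = if c.Mem t then 1 else 0 := by
  simp only [cellVec, tri_apply, indVec_apply, Cell.Mem]
  split_ifs <;> simp_all

variable (V : LayerVectors d) (hd : 1 ≤ numLayers d)

include hd

theorem cellVec_mem_block (c : Cell d) : cellVec c ∈ block V c :=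
  ⟨_, (c.fst.isLocalBasis V hd).indVec_mem, _, (c.snd.isLocalBasis V hd).indVec_mem, _,
    (c.trd.isLocalBasis V hd).indVec_mem, rfl⟩

variable {V}

theorem apply_eq_zero_of_mem_block {c : Cell d} {v : ThreeQudit d} (hv : v ∈ block V c)
    {t : Cube d} (ht : ¬ c.Mem t) : v t = 0 := by
  obtain ⟨x, hx, y, hy, z, hz, rfl⟩ := hv
  rw [tri_apply]
  by_cases h1 : t.1 ∈ c.fst.set
  · by_cases h2 : t.2.1 ∈ c.snd.set
    · have h3 : t.2.2 ∉ c.trd.set := fun h3 => ht ⟨h1, h2, h3⟩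
      rw [(c.trd.isLocalBasis V hd).apply_eq_zero hz h3, mul_zero]
    · rw [(c.snd.isLocalBasis V hd).apply_eq_zero hy h2, mul_zero, zero_mul]
  · rw [(c.fst.isLocalBasis V hd).apply_eq_zero hx h1, zero_mul, zero_mul]

theorem isOrthSet_block (c : Cell d) : IsOrthSet (block V c) := by
  refine ⟨?_, ?_⟩
  · rintro _ ⟨x, hx, y, hy, z, hz, rfl⟩ h0
    have h : inner ℂ (tri x y z) (tri x y z) = (0 : ℂ) := by rw [h0, inner_zero_left]
    rw [inner_tri, mul_eq_zero, mul_eq_zero, inner_self_eq_zero, inner_self_eq_zero,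
      inner_self_eq_zero] at h
    rcases h with (h | h) | h
    · exact (c.fst.isLocalBasis V hd).orth.ne_zero x hx h
    · exact (c.snd.isLocalBasis V hd).orth.ne_zero y hy h
    · exact (c.trd.isLocalBasis V hd).orth.ne_zero z hz h
  · rintro _ ⟨x, hx, y, hy, z, hz, rfl⟩ _ ⟨x', hx', y', hy', z', hz', rfl⟩ hne
    rw [inner_tri]
    by_cases h1 : x = x'
    · by_cases h2 : y = y'
      · have h3 : z ≠ z' := fun h3 => hne (by rw [h1, h2, h3])
        rw [(c.trd.isLocalBasis V hd).orth.orthogonal hz hz' h3, mul_zero]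
      · rw [(c.snd.isLocalBasis V hd).orth.orthogonal hy hy' h2, mul_zero, zero_mul]
    · rw [(c.fst.isLocalBasis V hd).orth.orthogonal hx hx' h1, zero_mul, zero_mul]

/-- Vectors of a block vanish off its cell, and distinct cells are disjoint. -/
theorem inner_eq_zero_of_mem_blocks {c c' : Cell d} (hc : c ≠ c') {v w : ThreeQudit d}
    (hv : v ∈ block V c) (hw : w ∈ block V c') : inner ℂ v w = 0 := by
  rw [PiLp.inner_apply]
  refine Finset.sum_eq_zero fun t _ => ?_
  by_cases h : c.Mem t
  · have h' : ¬ c'.Mem t := fun h' => hc (Cell.eq_of_mem h h')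
    simp [apply_eq_zero_of_mem_block hd hw h']
  · simp [apply_eq_zero_of_mem_block hd hv h]

variable (V)

theorem isOrthSet_iUnion_block : IsOrthSet (⋃ c, block V c) := by
  refine ⟨?_, ?_⟩
  · intro v hv
    obtain ⟨c, hc⟩ := Set.mem_iUnion.1 hv
    exact (isOrthSet_block hd c).ne_zero v hc
  · intro v hv w hw hne
    obtain ⟨c, hc⟩ := Set.mem_iUnion.1 hv
    obtain ⟨c', hc'⟩ := Set.mem_iUnion.1 hw
    by_cases h : c = c'
    · subst h
      exact (isOrthSet_block hd c).orthogonal hc hc' hne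
    · exact inner_eq_zero_of_mem_blocks hd h hc hc'

omit hd

theorem tri_mem_span {A B C : Set (Qudit d)} {x y z : Qudit d} (hx : x ∈ Submodule.span ℂ A)
    (hy : y ∈ Submodule.span ℂ B) (hz : z ∈ Submodule.span ℂ C) :
    tri x y z ∈ Submodule.span ℂ {v | ∃ x ∈ A, ∃ y ∈ B, ∃ z ∈ C, v = tri x y z} := by
  have h0 : ∀ y z : Qudit d, tri 0 y z = 0 ∧ tri y 0 z = 0 ∧ tri y z 0 = 0 := by
    intro y z
    refine ⟨?_, ?_, ?_⟩ <;> ext t <;> simp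
  induction hx using Submodule.span_induction with
  | mem x hx =>
    induction hy using Submodule.span_induction with
    | mem y hy =>
      induction hz using Submodule.span_induction with
      | mem z hz => exact Submodule.subset_span ⟨x, hx, y, hy, z, hz, rfl⟩
      | zero => rw [(h0 _ _).2.2]; exact Submodule.zero_mem _
      | add u v _ _ hu hv =>
        have : tri x y (u + v) = tri x y u + tri x y v := by ext t; simp [mul_add]
        rw [this]
        exact Submodule.add_mem _ hu hv
      | smul c u _ hu =>
        have : tri x y (c • u) = c • tri x y u := by ext t; simp; ring
        rw [this]
        exact Submodule.smul_mem _ _ hu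
    | zero => rw [(h0 _ _).2.1]; exact Submodule.zero_mem _
    | add u v _ _ hu hv =>
      have : tri x (u + v) z = tri x u z + tri x v z := by ext t; simp [mul_add, add_mul]
      rw [this]
      exact Submodule.add_mem _ hu hv
    | smul c u _ hu =>
      have : tri x (c • u) z = c • tri x u z := by ext t; simp; ring
      rw [this]
      exact Submodule.smul_mem _ _ hu
  | zero => rw [(h0 _ _).1]; exact Submodule.zero_mem _
  | add u v _ _ hu hv =>
    have : tri (u + v) y z = tri u y z + tri v y z := by ext t; simp [add_mul]
    rw [this]
    exact Submodule.add_mem _ hu hv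
  | smul c u _ hu =>
    have : tri (c • u) y z = c • tri u y z := by ext t; simp [mul_assoc]
    rw [this]
    exact Submodule.smul_mem _ _ hu

include hd

/-- Each label lies in a cell, and the local bases of the three sides of that cell generate the
three kets. -/
theorem span_iUnion_block : Submodule.span ℂ (⋃ c, block V c) = ⊤ := by
  rw [eq_top_iff]
  intro f _
  have e : f = ∑ t, f t • tri (ket t.1) (ket t.2.1) (ket t.2.2) := by
    ext s
    simp only [WithLp.ofLp_sum, Finset.sum_apply, PiLp.smul_apply, tri_apply, ket_apply,
      smul_eq_mul]
    rw [Finset.sum_eq_single s]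
    · simp
    · rintro ⟨a, b, r⟩ - hne
      obtain ⟨a', b', r'⟩ := s
      simp only [ne_eq, Prod.mk.injEq, not_and] at hne
      by_cases h1 : a' = a
      · by_cases h2 : b' = b
        · have h3 : ¬ r' = r := fun h3 => hne h1.symm h2.symm h3.symm
          simp [h3]
        · simp [h2]
      · simp [h1]
    · simp
  rw [e]
  refine Submodule.sum_mem _ fun t _ => Submodule.smul_mem _ _ ?_
  obtain ⟨c, hc⟩ := Cell.exists_mem t
  refine Submodule.span_mono (Set.subset_iUnion (block V) c) ?_
  refine tri_mem_span ?_ ?_ ?_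
  · rw [(c.fst.isLocalBasis V hd).span_eq]
    exact Submodule.subset_span ⟨_, hc.1, rfl⟩
  · rw [(c.snd.isLocalBasis V hd).span_eq]
    exact Submodule.subset_span ⟨_, hc.2.1, rfl⟩
  · rw [(c.trd.isLocalBasis V hd).span_eq]
    exact Submodule.subset_span ⟨_, hc.2.2, rfl⟩

omit hd

/-! ## The frozen sets in terms of blocks -/

theorem faceBlock_eq (k : Fin (numLayers d)) (p : Face) :
    faceBlock V k p = block V (.face k p) := by
  ext v
  cases p <;> simp [faceBlock, psi, block, Cell.fst, Cell.snd, Cell.trd, Side.basis]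
  all_goals exact exists_comm

theorem psi00_eq (k : Fin (numLayers d)) (p : Face) : psi00 V k p = cellVec (.face k p) := by
  cases p <;> simp [psi00, psi, cellVec, Cell.fst, Cell.snd, Cell.trd, Side.set, indVec,
    V.eta_zero, V.xi_zero]

theorem diag_low (k : Fin (numLayers d)) : diag (low k) = cellVec (.lo k) := by
  simp [diag, cellVec, Cell.fst, Cell.snd, Cell.trd, Side.set, indVec]

theorem diag_high (k : Fin (numLayers d)) : diag (high k) = cellVec (.hi k) := by
  simp [diag, cellVec, Cell.fst, Cell.snd, Cell.trd, Side.set, indVec]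

theorem block_lo (k : Fin (numLayers d)) : block V (.lo k) = {cellVec (.lo k)} := by
  ext v
  simp [block, Cell.fst, Cell.snd, Cell.trd, Side.basis, ← diag_low, diag]

theorem block_hi (k : Fin (numLayers d)) : block V (.hi k) = {cellVec (.hi k)} := by
  ext v
  simp [block, Cell.fst, Cell.snd, Cell.trd, Side.basis, ← diag_high, diag]

theorem block_core_of_even (he : Even d) : block V .core = centralBlock d := by
  ext v
  simp only [block, Cell.fst, Cell.snd, Cell.trd, Side.basis, he, centralBlock, true_and,
    not_true_eq_false, false_and, Set.mem_union, Set.mem_ofPred_eq, or_false]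
  constructor
  · rintro ⟨_, ⟨l, rfl⟩, _, ⟨m, rfl⟩, _, ⟨p, rfl⟩, rfl⟩
    exact ⟨l, m, p, rfl⟩
  · rintro ⟨l, m, p, rfl⟩
    exact ⟨_, ⟨l, rfl⟩, _, ⟨m, rfl⟩, _, ⟨p, rfl⟩, rfl⟩

theorem block_core_of_odd (ho : ¬ Even d) : block V .core = {cellVec .core} := by
  ext v
  simp [block, Cell.fst, Cell.snd, Cell.trd, Side.basis, ho, cellVec, Side.set]

theorem coreSet_of_odd (ho : ¬ Even d) (a : Fin d) (ha : a ∈ coreSet d) : coreSet d = {a} := by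
  rw [Nat.not_even_iff_odd] at ho
  obtain ⟨m, hm⟩ := ho
  ext b
  simp only [coreSet, Finset.mem_filter, Finset.mem_univ, true_and, Finset.mem_singleton,
    Fin.ext_iff] at ha ⊢
  unfold numLayers at *
  omega

theorem diag_core_of_odd (ho : ¬ Even d) (a : Fin d) (ha : a ∈ coreSet d) :
    diag a = cellVec .core := by
  have h := coreSet_of_odd ho a ha
  simp [diag, cellVec, Cell.fst, Cell.snd, Cell.trd, Side.set, indVec, h]

theorem coord_cases (a : Fin d) :
    (∃ k : Fin (numLayers d), a = low k) ∨ (∃ k : Fin (numLayers d), a = high k) ∨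
      a ∈ coreSet d := by
  by_cases h1 : (a : ℕ) < numLayers d
  · exact Or.inl ⟨⟨a, h1⟩, rfl⟩
  · by_cases h2 : d - 1 - (a : ℕ) < numLayers d
    · refine Or.inr (Or.inl ⟨⟨d - 1 - a, h2⟩, ?_⟩)
      ext
      simp only [high]
      omega
    · refine Or.inr (Or.inr ?_)
      simp only [coreSet, Finset.mem_filter, Finset.mem_univ, true_and]
      omega

theorem not_isMiddle_low (k : Fin (numLayers d)) : ¬ IsMiddle (low k) := by
  have := two_mul_lt k
  rintro ⟨-, h⟩
  simp only [low] at h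
  omega

theorem not_isMiddle_high (k : Fin (numLayers d)) : ¬ IsMiddle (high k) := by
  have := two_mul_lt k
  rintro ⟨-, h⟩
  simp only [high] at h
  omega

include hd

/-- The kets |aaa⟩ are the lone elements of the blocks at the diagonal ends and, for odd d, of the
core. For even d the core carries the central block instead. -/
theorem twistedBasis_eq : twistedBasis V = ⋃ c, block V c := by
  ext v
  simp only [twistedBasis, Set.mem_union, Set.mem_iUnion]
  constructor
  · rintro ((⟨a, ha, rfl⟩ | hv) | ⟨k, p, hv⟩)
    · rcases coord_cases a with ⟨k, rfl⟩ | ⟨k, rfl⟩ | hc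
      · exact ⟨.lo k, by rw [diag_low, block_lo]; rfl⟩
      · exact ⟨.hi k, by rw [diag_high, block_hi]; rfl⟩
      · have ho : ¬ Even d := fun he => ha ⟨he, (middle_iff he hd a).1 hc⟩
        exact ⟨.core, by rw [diag_core_of_odd ho a hc, block_core_of_odd V ho]; rfl⟩
    · exact ⟨.core, by rw [block_core_of_even V hv.1]; exact hv⟩
    · exact ⟨.face k p, faceBlock_eq V k p ▸ hv⟩
  · rintro ⟨⟨k, p⟩ | k | k | _, hv⟩
    · exact Or.inr ⟨k, p, faceBlock_eq V k p ▸ hv⟩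
    · rw [block_lo, ← diag_low] at hv
      exact Or.inl (Or.inl ⟨_, not_isMiddle_low k, hv⟩)
    · rw [block_hi, ← diag_high] at hv
      exact Or.inl (Or.inl ⟨_, not_isMiddle_high k, hv⟩)
    · by_cases he : Even d
      · rw [block_core_of_even V he] at hv
        exact Or.inl (Or.inr hv)
      · have hlt : numLayers d < d := by unfold numLayers at *; omega
        have hm : (⟨numLayers d, hlt⟩ : Fin d) ∈ coreSet d := by
          simp only [coreSet, Finset.mem_filter, Finset.mem_univ, true_and]
          unfold numLayers
          rw [Nat.not_even_iff_odd] at he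
          obtain ⟨m, hm⟩ := he
          omega
        rw [block_core_of_odd V he, ← diag_core_of_odd he _ hm] at hv
        exact Or.inl (Or.inl ⟨_, fun h => he h.1, hv⟩)

/-- The twisted basis without the indicator vectors of the cells. -/
def reducedBasis (V : LayerVectors d) : Set (ThreeQudit d) := ⋃ c, (block V c \ {cellVec c})

theorem cellVec_core_of_even (he : Even d) :
    tri (phi d 0) (phi d 0) (phi d 0) = cellVec (.core : Cell d) := by
  simp [cellVec, Cell.fst, Cell.snd, Cell.trd, Side.set, phi_zero he hd]

/-- The diagonal ends, and the core for odd d, have one-element blocks, which disappear together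
with their indicator. So the removal of one vector per cell is uniform, although no diagonal ket
occurs in the definition of `productBasis`. -/
theorem productBasis_eq : productBasis V = reducedBasis V ∪ {stopper d} := by
  ext v
  simp only [productBasis, reducedBasis, Set.mem_union, Set.mem_iUnion]
  refine or_congr_left ?_
  constructor
  · rintro (⟨k, p, hv⟩ | hv)
    · rw [faceBlock_eq, psi00_eq] at hv
      exact ⟨_, hv⟩
    · have he := hv.1.1
      rw [cellVec_core_of_even hd he, ← block_core_of_even V he] at hv
      exact ⟨_, hv⟩
  · rintro ⟨⟨k, p⟩ | k | k | _, hv⟩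
    · rw [← faceBlock_eq, ← psi00_eq V] at hv
      exact Or.inl ⟨k, p, hv⟩
    · rw [block_lo, Set.sdiff_self] at hv
      exact absurd hv (Set.notMem_empty _)
    · rw [block_hi, Set.sdiff_self] at hv
      exact absurd hv (Set.notMem_empty _)
    · by_cases he : Even d
      · rw [← cellVec_core_of_even hd he, block_core_of_even V he] at hv
        exact Or.inr hv
      · rw [block_core_of_odd V he, Set.sdiff_self] at hv
        exact absurd hv (Set.notMem_empty _)

end

end BlockCube

namespace BlockCube

noncomputable section

open Module

variable {d : ℕ}

/-! ## Counting -/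

theorem card_face : Nat.card Face = 6 := by
  let e : Face ≃ Fin 6 :=
    { toFun := fun p => match p with
        | .f1 => 0 | .f2 => 1 | .f3 => 2 | .f4 => 3 | .f5 => 4 | .f6 => 5
      invFun := ![.f1, .f2, .f3, .f4, .f5, .f6]
      left_inv := by intro p; cases p <;> rfl
      right_inv := by intro i; fin_cases i <;> rfl }
  rw [Nat.card_congr e, Nat.card_eq_fintype_card, Fintype.card_fin]

/-- The cells by kind. -/
def cellKindEquiv (d : ℕ) : Cell d ≃
    (Fin (numLayers d) × Face) ⊕ (Fin (numLayers d) ⊕ (Fin (numLayers d) ⊕ Unit)) where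
  toFun c := match c with
    | .face k p => .inl (k, p)
    | .lo k => .inr (.inl k)
    | .hi k => .inr (.inr (.inl k))
    | .core => .inr (.inr (.inr ()))
  invFun s := match s with
    | .inl (k, p) => .face k p
    | .inr (.inl k) => .lo k
    | .inr (.inr (.inl k)) => .hi k
    | .inr (.inr (.inr ())) => .core
  left_inv := by rintro (⟨k, p⟩ | k | k | _) <;> rfl
  right_inv := by rintro (⟨k, p⟩ | k | k | ⟨⟩) <;> rfl

instance : Finite Face := Nat.finite_of_card_ne_zero (by rw [card_face]; norm_num)

instance : Finite (Cell d) := Finite.of_equiv _ (cellKindEquiv d).symm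

instance : Fintype (Cell d) := Fintype.ofFinite _

theorem card_cell : Nat.card (Cell d) = 8 * numLayers d + 1 := by
  rw [Nat.card_congr (cellKindEquiv d), Nat.card_sum, Nat.card_sum, Nat.card_sum, Nat.card_prod,
    card_face]
  simp only [Nat.card_eq_fintype_card, Fintype.card_fin, Fintype.card_unit]
  ring

/-- The number of basic blocks of a cell. -/
def Cell.size (c : Cell d) : ℕ := c.fst.set.card * c.snd.set.card * c.trd.set.card

theorem size_face (k : Fin (numLayers d)) (p : Face) :
    (Cell.face k p).size = side d k ^ 2 := by
  have h1 : (Side.low k).set.card = 1 := Finset.card_singleton _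
  have h2 : (Side.high k).set.card = 1 := Finset.card_singleton _
  cases p <;> simp only [Cell.size, Cell.fst, Cell.snd, Cell.trd, card_eta, card_xi, h1, h2] <;>
    ring

theorem size_lo (k : Fin (numLayers d)) : (Cell.lo k).size = 1 := by
  simp [Cell.size, Cell.fst, Cell.snd, Cell.trd, Side.set]

theorem size_hi (k : Fin (numLayers d)) : (Cell.hi k).size = 1 := by
  simp [Cell.size, Cell.fst, Cell.snd, Cell.trd, Side.set]

theorem inner_indVec (s s' : Finset (Fin d)) :
    inner ℂ (indVec s) (indVec s') = ((s ∩ s').card : ℂ) := by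
  have e : ∀ b, inner ℂ (indVec s b) (indVec s' b) = if b ∈ s ∩ s' then (1 : ℂ) else 0 := by
    intro b
    by_cases h1 : b ∈ s <;> by_cases h2 : b ∈ s' <;> simp [h1, h2]
  rw [PiLp.inner_apply, Finset.sum_congr rfl fun b _ => e b, Finset.sum_boole,
    Finset.filter_mem_eq_inter, Finset.univ_inter]

theorem inner_cellVec_self (c : Cell d) : inner ℂ (cellVec c) (cellVec c) = (c.size : ℂ) := by
  rw [cellVec, inner_tri, inner_indVec, inner_indVec, inner_indVec, Cell.size]
  simp

theorem stopper_eq : stopper d = tri (indVec Finset.univ) (indVec Finset.univ)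
    (indVec Finset.univ) := rfl

@[simp] theorem stopper_apply (t : Cube d) : stopper d t = 1 := by
  simp [stopper_eq]

theorem inner_stopper_cellVec (c : Cell d) : inner ℂ (stopper d) (cellVec c) = (c.size : ℂ) := by
  rw [stopper_eq, cellVec, inner_tri, inner_indVec, inner_indVec, inner_indVec, Cell.size]
  simp

theorem inner_stopper (f : ThreeQudit d) : inner ℂ (stopper d) f = ∑ t, f t := by
  simp [PiLp.inner_apply]

/-! ## Functions that are constant on the cells -/

/-- `f` takes the value `g c` on the cell `c`. -/
def IsBlockConst {H : Type*} (f : Cube d → H) (g : Cell d → H) : Prop :=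
  ∀ c t, c.Mem t → f t = g c

theorem isBlockConst_sum (g : Cell d → ℂ) :
    IsBlockConst (d := d) (∑ c, g c • cellVec c).ofLp g := by
  classical
  intro c t ht
  simp only [WithLp.ofLp_sum, Finset.sum_apply, PiLp.smul_apply, cellVec_apply, smul_eq_mul]
  rw [Finset.sum_eq_single c]
  · simp [ht]
  · intro c' _ hne
    have : ¬ c'.Mem t := fun h => hne (Cell.eq_of_mem h ht)
    simp [this]
  · simp

theorem IsBlockConst.eq_sum {f : ThreeQudit d} {g : Cell d → ℂ} (h : IsBlockConst f.ofLp g) :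
    f = ∑ c, g c • cellVec c := by
  ext t
  obtain ⟨c, hc⟩ := Cell.exists_mem t
  rw [h c t hc, isBlockConst_sum g c t hc]

theorem stopper_eq_sum : stopper d = ∑ c, cellVec c := by
  have h : IsBlockConst (stopper d).ofLp (fun _ : Cell d => (1 : ℂ)) := fun c t _ => stopper_apply t
  simpa using h.eq_sum

theorem isBlockConst_of_mem_span {f : ThreeQudit d}
    (h : f ∈ Submodule.span ℂ (Set.range (cellVec (d := d)))) :
    ∃ g, IsBlockConst f.ofLp g := by
  obtain ⟨g, rfl⟩ := (Submodule.mem_span_range_iff_exists_fun ℂ).1 h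
  exact ⟨g, isBlockConst_sum g⟩

theorem inner_cellVec_of_ne {c c' : Cell d} (h : c ≠ c') :
    inner ℂ (cellVec c) (cellVec c') = 0 := by
  rw [PiLp.inner_apply]
  refine Finset.sum_eq_zero fun t _ => ?_
  by_cases h1 : c.Mem t
  · have h2 : ¬ c'.Mem t := fun h2 => h (Cell.eq_of_mem h1 h2)
    simp [cellVec_apply, h2]
  · simp [cellVec_apply, h1]

theorem cell_size_ne_zero (c : Cell d) (hc : c ≠ .core) : c.size ≠ 0 := by
  rcases c with ⟨k, p⟩ | k | k | _
  · rw [size_face]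
    exact pow_ne_zero _ (side_pos k).ne'
  · rw [size_lo]; exact one_ne_zero
  · rw [size_hi]; exact one_ne_zero
  · exact absurd rfl hc

variable (V : LayerVectors d) (hd : 1 ≤ numLayers d)

include hd

theorem iUnion_block_eq : (⋃ c, block V c) = reducedBasis V ∪ Set.range cellVec := by
  ext v
  simp only [reducedBasis, Set.mem_union, Set.mem_iUnion, Set.mem_range]
  constructor
  · rintro ⟨c, hc⟩
    by_cases h : v = cellVec c
    · exact Or.inr ⟨c, h.symm⟩
    · exact Or.inl ⟨c, hc, h⟩
  · rintro (⟨c, hc⟩ | ⟨c, rfl⟩)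
    · exact ⟨c, hc.1⟩
    · exact ⟨c, cellVec_mem_block V hd c⟩

theorem isOrthSet_reducedBasis : IsOrthSet (reducedBasis V) :=
  (isOrthSet_iUnion_block V hd).mono (by
    rw [iUnion_block_eq V hd]
    exact Set.subset_union_left)

theorem inner_reducedBasis_cellVec {u : ThreeQudit d} (hu : u ∈ reducedBasis V) (c : Cell d) :
    inner ℂ u (cellVec c) = 0 := by
  obtain ⟨c', hc', hne⟩ := Set.mem_iUnion.1 hu
  refine (isOrthSet_iUnion_block V hd).orthogonal (Set.mem_iUnion.2 ⟨c', hc'⟩)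
    (Set.mem_iUnion.2 ⟨c, cellVec_mem_block V hd c⟩) ?_
  rintro rfl
  by_cases h : c = c'
  · exact hne (by rw [h]; rfl)
  · have := inner_eq_zero_of_mem_blocks hd h (cellVec_mem_block V hd c) hc'
    rw [inner_self_eq_zero] at this
    exact (isOrthSet_block hd c).ne_zero _ (cellVec_mem_block V hd c) this

theorem cellVec_ne_zero (c : Cell d) (V : LayerVectors d) : cellVec c ≠ 0 :=
  (isOrthSet_block hd c).ne_zero _ (cellVec_mem_block V hd c)

/-- The union of all blocks is an orthogonal basis of d³ vectors, and one indicator is removed for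
each of the 8n+1 cells. -/
theorem ncard_reducedBasis : (reducedBasis V).ncard + (8 * numLayers d + 1) = d ^ 3 := by
  have h1 := (isOrthSet_iUnion_block V hd).finrank_span
  rw [span_iUnion_block V hd, finrank_top, finrank_euclideanSpace] at h1
  have h2 := isOrthSet_range (fun c => cellVec_ne_zero hd c V)
    (fun c c' h => inner_cellVec_of_ne h)
  have h3 := (isOrthSet_reducedBasis V hd).ncard_union h2 (by
    rintro u hu _ ⟨c, rfl⟩
    exact inner_reducedBasis_cellVec V hd hu c)
  rw [← iUnion_block_eq V hd, ← h1, ncard_range_of_orthogonal (fun c => cellVec_ne_zero hd c V)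
    (fun c c' h => inner_cellVec_of_ne h), card_cell] at h3
  rw [← h3]
  simp only [Fintype.card_prod, Fintype.card_fin]
  ring

theorem inner_reducedBasis_of_isBlockConst {f : ThreeQudit d} {g : Cell d → ℂ}
    (h : IsBlockConst f.ofLp g) {u : ThreeQudit d} (hu : u ∈ reducedBasis V) :
    inner ℂ u f = 0 := by
  rw [h.eq_sum, inner_sum]
  exact Finset.sum_eq_zero fun c _ => by
    rw [inner_smul_right, inner_reducedBasis_cellVec V hd hu c, mul_zero]

/-- The reduced basis and the indicators together form an orthogonal basis of the whole space, so
the complement of the former is spanned by the latter. -/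
theorem exists_isBlockConst_of_orthogonal {f : ThreeQudit d}
    (h : ∀ u ∈ reducedBasis V, inner ℂ u f = 0) : ∃ g, IsBlockConst f.ofLp g := by
  refine isBlockConst_of_mem_span ?_
  refine IsOrthSet.orthogonal_le_span (U := reducedBasis V) ?_ ?_ (mem_orthogonal_span_iff.2 h)
  · rintro u hu _ ⟨c, rfl⟩
    exact inner_reducedBasis_cellVec V hd hu c
  · rw [← iUnion_block_eq V hd, span_iUnion_block V hd]

/-! ## Adding the stopper and differences of cell vectors -/

omit hd

/-- A multiple of one cell vector minus another one. -/
def minusVec (a : ℕ) (c c' : Cell d) : ThreeQudit d := (a : ℂ) • cellVec c - cellVec c'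

/-- The set consisting of the reduced basis, the stopper and some differences of cell vectors. -/
def extendedBasis {κ : Type*} (a : κ → ℕ) (P N : κ → Cell d) : Set (ThreeQudit d) :=
  reducedBasis V ∪ {stopper d} ∪ Set.range fun i => minusVec (a i) (P i) (N i)

/-- The pairs of cells are disjoint, and the coefficients make the differences orthogonal to the
stopper. -/
structure IsBalanced {κ : Type*} (a : κ → ℕ) (P N : κ → Cell d) : Prop where
  injP : Function.Injective P
  injN : Function.Injective N
  ne : ∀ i j, P i ≠ N j
  size : ∀ i, a i * (P i).size = (N i).size

variable {κ : Type*} {a : κ → ℕ} {P N : κ → Cell d}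

theorem inner_cellVec_of_isBlockConst {f : ThreeQudit d} {g : Cell d → ℂ}
    (h : IsBlockConst f.ofLp g) (c : Cell d) : inner ℂ (cellVec c) f = c.size * g c := by
  rw [h.eq_sum, inner_sum, Finset.sum_eq_single c]
  · rw [inner_smul_right, inner_cellVec_self, mul_comm]
  · intro c' _ hne
    rw [inner_smul_right, inner_cellVec_of_ne hne.symm, mul_zero]
  · simp

/-- The balance a·|P| = |N| gives both terms the same factor. Orthogonality to the difference vector
thus becomes equality of the two values. -/
theorem inner_minusVec_of_isBlockConst (h : IsBalanced a P N) {f : ThreeQudit d}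
    {g : Cell d → ℂ} (hg : IsBlockConst f.ofLp g) (i : κ) :
    inner ℂ (minusVec (a i) (P i) (N i)) f = (N i).size * (g (P i) - g (N i)) := by
  rw [minusVec, inner_sub_left, inner_smul_left, inner_cellVec_of_isBlockConst hg,
    inner_cellVec_of_isBlockConst hg, ← h.size i, Complex.conj_natCast]
  push_cast
  ring

theorem inner_cellVec_minusVec (h : IsBalanced a P N) (i : κ) :
    inner ℂ (cellVec (P i)) (minusVec (a i) (P i) (N i)) = (N i).size := by
  rw [minusVec, inner_sub_right, inner_smul_right, inner_cellVec_self,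
    inner_cellVec_of_ne (h.ne i i), ← h.size i]
  push_cast
  ring

theorem isOrthSet_range_minusVec (h : IsBalanced a P N) (hN : ∀ i, N i ≠ .core) :
    (∀ i, minusVec (a i) (P i) (N i) ≠ 0) ∧
    Pairwise fun i j => inner ℂ (minusVec (a i) (P i) (N i)) (minusVec (a j) (P j) (N j)) = 0 := by
  constructor
  · intro i h0
    have := inner_cellVec_minusVec h i
    rw [h0, inner_zero_right] at this
    exact cell_size_ne_zero _ (hN i) (by exact_mod_cast this.symm)
  · intro i j hij
    simp only [minusVec, inner_sub_left, inner_sub_right, inner_smul_left, inner_smul_right]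
    rw [inner_cellVec_of_ne (fun e => hij (h.injP e)),
      inner_cellVec_of_ne (fun e => hij (h.injN e)), inner_cellVec_of_ne (h.ne i j),
      inner_cellVec_of_ne (h.ne j i).symm]
    simp

theorem finrank_complementary {U : Set (ThreeQudit d)} (hU : IsOrthSet U) {m : ℕ}
    (hm : U.ncard + m = d ^ 3) : finrank ℂ (complementary U) = m := by
  have := hU.ncard_add_finrank_orthogonal
  rw [finrank_euclideanSpace] at this
  simp only [Fintype.card_prod, Fintype.card_fin] at this
  rw [complementary]
  have e : d ^ 3 = d * (d * d) := by ring
  omega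

include hd

theorem stopper_ne_zero : stopper d ≠ 0 := by
  intro h
  have h1 : stopper d (⟨0, by unfold numLayers at hd; omega⟩, ⟨0, by unfold numLayers at hd; omega⟩,
    ⟨0, by unfold numLayers at hd; omega⟩) = 1 := stopper_apply _
  rw [h] at h1
  simp at h1

theorem inner_reducedBasis_stopper {u : ThreeQudit d} (hu : u ∈ reducedBasis V) :
    inner ℂ u (stopper d) = 0 := by
  rw [stopper_eq_sum, inner_sum]
  exact Finset.sum_eq_zero fun c _ => inner_reducedBasis_cellVec V hd hu c

/-- Balance makes the differences orthogonal to the stopper. The count is d³ minus the 8n+1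
indicators, plus the stopper, plus one vector per difference. -/
theorem isOrthSet_extendedBasis [Finite κ] (h : IsBalanced a P N) (hN : ∀ i, N i ≠ .core) :
    IsOrthSet (extendedBasis V a P N) ∧
      (extendedBasis V a P N).ncard + 8 * numLayers d = d ^ 3 + Nat.card κ := by
  have hw := isOrthSet_range_minusVec h hN
  have hR := isOrthSet_range hw.1 hw.2
  have hS : IsOrthSet {stopper d} := by
    refine ⟨?_, Set.pairwise_singleton _ _⟩
    rintro v rfl
    exact stopper_ne_zero hd
  have h1 : ∀ u ∈ reducedBasis V, ∀ v ∈ ({stopper d} : Set (ThreeQudit d)), inner ℂ u v = 0 := by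
    rintro u hu v rfl
    exact inner_reducedBasis_stopper V hd hu
  have h2 : ∀ u ∈ reducedBasis V ∪ {stopper d},
      ∀ v ∈ Set.range fun i => minusVec (a i) (P i) (N i), inner ℂ u v = 0 := by
    rintro u (hu | rfl) _ ⟨i, rfl⟩
    · simp only [minusVec, inner_sub_right, inner_smul_right,
        inner_reducedBasis_cellVec V hd hu, mul_zero, sub_zero]
    · simp only [minusVec, inner_sub_right, inner_smul_right, inner_stopper_cellVec, ← h.size i]
      push_cast
      ring
  have hU := isOrthSet_reducedBasis V hd
  refine ⟨(hU.union hS h1).union hR h2, ?_⟩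
  rw [extendedBasis, (hU.union hS h1).ncard_union hR h2, hU.ncard_union hS h1,
    ncard_range_of_orthogonal hw.1 hw.2, Set.ncard_singleton, ← ncard_reducedBasis V hd]
  ring

theorem mem_complementary_extendedBasis (h : IsBalanced a P N) (hN : ∀ i, N i ≠ .core)
    {f : ThreeQudit d} : f ∈ complementary (extendedBasis V a P N) ↔
      ∃ g, IsBlockConst f.ofLp g ∧ ∑ t, f t = 0 ∧ ∀ i, g (P i) = g (N i) := by
  rw [complementary, mem_orthogonal_span_iff]
  constructor
  · intro hf
    obtain ⟨g, hg⟩ := exists_isBlockConst_of_orthogonal V hd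
      (fun u hu => hf u (Or.inl (Or.inl hu)))
    refine ⟨g, hg, ?_, fun i => ?_⟩
    · rw [← inner_stopper]
      exact hf _ (Or.inl (Or.inr rfl))
    · have := hf _ (Or.inr ⟨i, rfl⟩)
      rw [inner_minusVec_of_isBlockConst h hg, mul_eq_zero, sub_eq_zero] at this
      exact this.resolve_left (Nat.cast_ne_zero.2 (cell_size_ne_zero _ (hN i)))
  · rintro ⟨g, hg, hs, hPN⟩ u ((hu | rfl) | ⟨i, rfl⟩)
    · exact inner_reducedBasis_of_isBlockConst V hd hg hu
    · rw [inner_stopper, hs]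
    · simp only
      rw [inner_minusVec_of_isBlockConst h hg, hPN, sub_self, mul_zero]

end

end BlockCube

namespace BlockCube

noncomputable section

/-! ### Orthogonality relations between the entries of a filter-free family -/

section Filters

variable {α β H : Type*} [Fintype α] [Fintype β] [DecidableEq α] [DecidableEq β]
  [NormedAddCommGroup H] [InnerProductSpace ℂ H]

theorem pair_single (Φ : α × β → H) (a : α) (s : β) :
    pair Φ (Pi.single a 1) (Pi.single s 1) = Φ (a, s) := by
  rw [pair, Finset.sum_eq_single (a, s)]
  · simp
  · rintro ⟨a', s'⟩ - hne
    by_cases h : a' = a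
    · have : s' ≠ s := fun h' => hne (by rw [h, h'])
      simp [this]
    · simp [h]
  · simp

omit [DecidableEq α] [DecidableEq β] in
theorem pair_sub_left (Φ : α × β → H) (x x' : α → ℂ) (y : β → ℂ) :
    pair Φ (x - x') y = pair Φ x y - pair Φ x' y := by
  simp [pair, sub_mul, sub_smul, Finset.sum_sub_distrib]

omit [DecidableEq α] [DecidableEq β] in
theorem pair_sub_right (Φ : α × β → H) (x : α → ℂ) (y y' : β → ℂ) :
    pair Φ x (y - y') = pair Φ x y - pair Φ x y' := by
  simp [pair, mul_sub, sub_smul, Finset.sum_sub_distrib]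

/-- `NoFilter` at the coordinate vector of row a and the difference of the columns s and s', a pair
on which Φ vanishes. -/
theorem NoFilter.inner_row {Φ : α × β → H} (h : NoFilter Φ) {a : α} {s s' : β}
    (e : Φ (a, s) = Φ (a, s')) (a' : α) (s'' : β) :
    inner ℂ (Φ (a, s'')) (Φ (a', s) - Φ (a', s')) = 0 := by
  have := h (Pi.single a 1) (Pi.single a' 1) (Pi.single s 1 - Pi.single s' 1) (Pi.single s'' 1)
    (by rw [pair_sub_right, pair_single, pair_single, e, sub_self])
  simpa only [pair_sub_right, pair_single] using this

/-- The same at the difference of two rows: the vanishing pair is now a mixed second difference. -/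
theorem NoFilter.inner_rows {Φ : α × β → H} (h : NoFilter Φ) {a a' : α} {s s' : β}
    (e : Φ (a, s) - Φ (a, s') = Φ (a', s) - Φ (a', s')) (a'' : α) (s'' : β) :
    inner ℂ (Φ (a, s'') - Φ (a', s'')) (Φ (a'', s) - Φ (a'', s')) = 0 := by
  have := h (Pi.single a 1 - Pi.single a' 1) (Pi.single a'' 1) (Pi.single s 1 - Pi.single s' 1)
    (Pi.single s'' 1)
    (by simp only [pair_sub_right, pair_sub_left, pair_single]
        rw [sub_sub_sub_comm, sub_eq_zero]
        exact e)
  simpa only [pair_sub_right, pair_sub_left, pair_single] using this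

end Filters

/-! ### Explicit membership in cells and induction over the layers -/

variable {d : ℕ}

theorem Cell.mem_f1 {k : Fin (numLayers d)} {a b c : Fin d} : (Cell.face k .f1).Mem (a, b, c) ↔
    (a : ℕ) = k ∧ ((k : ℕ) ≤ b ∧ (b : ℕ) < d - 1 - k) ∧ ((k : ℕ) < c ∧ (c : ℕ) ≤ d - 1 - k) := by
  simp only [Cell.Mem, Cell.fst, Cell.snd, Cell.trd, Side.mem_low, Side.mem_eta, Side.mem_xi]

theorem Cell.mem_f2 {k : Fin (numLayers d)} {a b c : Fin d} : (Cell.face k .f2).Mem (a, b, c) ↔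
    ((k : ℕ) ≤ a ∧ (a : ℕ) < d - 1 - k) ∧ (b : ℕ) = d - 1 - k ∧
      ((k : ℕ) < c ∧ (c : ℕ) ≤ d - 1 - k) := by
  simp only [Cell.Mem, Cell.fst, Cell.snd, Cell.trd, Side.mem_high, Side.mem_eta, Side.mem_xi]

theorem Cell.mem_f3 {k : Fin (numLayers d)} {a b c : Fin d} : (Cell.face k .f3).Mem (a, b, c) ↔
    (a : ℕ) = d - 1 - k ∧ ((k : ℕ) < b ∧ (b : ℕ) ≤ d - 1 - k) ∧
      ((k : ℕ) ≤ c ∧ (c : ℕ) < d - 1 - k) := by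
  simp only [Cell.Mem, Cell.fst, Cell.snd, Cell.trd, Side.mem_high, Side.mem_eta, Side.mem_xi]

theorem Cell.mem_f4 {k : Fin (numLayers d)} {a b c : Fin d} : (Cell.face k .f4).Mem (a, b, c) ↔
    ((k : ℕ) ≤ a ∧ (a : ℕ) < d - 1 - k) ∧ ((k : ℕ) < b ∧ (b : ℕ) ≤ d - 1 - k) ∧
      (c : ℕ) = k := by
  simp only [Cell.Mem, Cell.fst, Cell.snd, Cell.trd, Side.mem_low, Side.mem_eta, Side.mem_xi]

theorem Cell.mem_f5 {k : Fin (numLayers d)} {a b c : Fin d} : (Cell.face k .f5).Mem (a, b, c) ↔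
    ((k : ℕ) < a ∧ (a : ℕ) ≤ d - 1 - k) ∧ (b : ℕ) = k ∧
      ((k : ℕ) ≤ c ∧ (c : ℕ) < d - 1 - k) := by
  simp only [Cell.Mem, Cell.fst, Cell.snd, Cell.trd, Side.mem_low, Side.mem_eta, Side.mem_xi]

theorem Cell.mem_f6 {k : Fin (numLayers d)} {a b c : Fin d} : (Cell.face k .f6).Mem (a, b, c) ↔
    ((k : ℕ) < a ∧ (a : ℕ) ≤ d - 1 - k) ∧ ((k : ℕ) ≤ b ∧ (b : ℕ) < d - 1 - k) ∧
      (c : ℕ) = d - 1 - k := by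
  simp only [Cell.Mem, Cell.fst, Cell.snd, Cell.trd, Side.mem_high, Side.mem_eta, Side.mem_xi]

theorem Cell.mem_lo {k : Fin (numLayers d)} {a b c : Fin d} : (Cell.lo k).Mem (a, b, c) ↔
    (a : ℕ) = k ∧ (b : ℕ) = k ∧ (c : ℕ) = k := by
  simp only [Cell.Mem, Cell.fst, Cell.snd, Cell.trd, Side.mem_low]

theorem Cell.mem_hi {k : Fin (numLayers d)} {a b c : Fin d} : (Cell.hi k).Mem (a, b, c) ↔
    (a : ℕ) = d - 1 - k ∧ (b : ℕ) = d - 1 - k ∧ (c : ℕ) = d - 1 - k := by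
  simp only [Cell.Mem, Cell.fst, Cell.snd, Cell.trd, Side.mem_high]

/-- Sample coordinates for evaluating a layer. As 2k + 2 < d, the coordinate k + 1 lies strictly
between the two ends. -/
theorem exists_low_mid_high (k : Fin (numLayers d)) :
    ∃ L M T : Fin d, (L : ℕ) = k ∧ (M : ℕ) = k + 1 ∧ (T : ℕ) = d - 1 - k := by
  have := two_mul_lt k
  exact ⟨⟨k, by omega⟩, ⟨k + 1, by omega⟩, ⟨d - 1 - k, by omega⟩, rfl, rfl, rfl⟩

/-- A property of the cells of all layers, from outside to inside, extends to all labels. -/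
theorem eq_zero_of_layers {H : Type*} [AddCommGroup H] [Module ℂ H] {Φ : Cube d → H}
    {g : Cell d → H} (hΦ : IsBlockConst Φ g) (hs : ∑ t, Φ t = 0)
    (step : ∀ k : Fin (numLayers d), (∀ t, ¬ InCube d k t → Φ t = 0) →
      (∀ t, Φ t = 0) ∨ g (.lo k) = 0 ∧ g (.hi k) = 0 ∧ ∀ p, g (.face k p) = 0) :
    ∀ t, Φ t = 0 := by
  have main : ∀ j ≤ numLayers d, (∀ t, Φ t = 0) ∨ ∀ t, ¬ InCube d j t → Φ t = 0 := by
    intro j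
    induction j with
    | zero => exact fun _ => Or.inr fun t ht => absurd (inCube_zero t) ht
    | succ j ih =>
      intro hj
      rcases ih (by omega) with h | h
      · exact Or.inl h
      rcases step ⟨j, hj⟩ h with h0 | ⟨hlo, hhi, hf⟩
      · exact Or.inl h0
      refine Or.inr fun t ht => ?_
      by_cases hc : InCube d j t
      · rcases Cell.layer_cases ⟨j, hj⟩ hc with h1 | h1 | ⟨p, h1⟩ | h1
        · rw [hΦ _ _ h1, hlo]
        · rw [hΦ _ _ h1, hhi]
        · rw [hΦ _ _ h1, hf]
        · exact absurd h1 ht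
      · exact h t hc
  rcases main _ le_rfl with h | h
  · exact h
  -- Once all layers are peeled, the core value is the only one left.
  · refine eq_zero_of_two_valued (c := g .core) (fun t => ?_) hs
    by_cases ht : InCube d (numLayers d) t
    · exact Or.inr (hΦ _ _ (inCube_core ht))
    · exact Or.inl (h t ht)

/-! ### The symmetric pattern: filter-free families vanish -/

section Symmetric

variable {H : Type*} [NormedAddCommGroup H] [InnerProductSpace ℂ H]

theorem inner_eq_zero_of_sum {Φ : Cube d → H} (hs : ∑ t, Φ t = 0) {w : H} {z : ℂ}
    (h : ∀ t, inner ℂ (Φ t) w = 0 ∨ inner ℂ (Φ t) w = z) (t : Cube d) : inner ℂ (Φ t) w = 0 :=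
  eq_zero_of_two_valued h (by rw [← sum_inner, hs, inner_zero_left]) t

/-- The layer has five unknown vectors: p, q, r on the three pairs of faces and s, τ at the ends of
the diagonal. The orthogonality relations, with the zero sum supplying the inner products they leave
open, identify all five with one vector and finally show that it is zero. Rows are indexed by the
first party, columns by the other two. -/
theorem symmetric_layer {Φ : Cube d → H} {g : Cell d → H} (hΦ : IsBlockConst Φ g)
    (hs : ∑ t, Φ t = 0) (hn : NoFilter Φ) (k : Fin (numLayers d))
    (h12 : g (.face k .f1) = g (.face k .f2)) (h34 : g (.face k .f3) = g (.face k .f4))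
    (h56 : g (.face k .f5) = g (.face k .f6)) (hz : ∀ t, ¬ InCube d k t → Φ t = 0) :
    g (.lo k) = 0 ∧ g (.hi k) = 0 ∧ ∀ p, g (.face k p) = 0 := by
  obtain ⟨L, M, T, hL, hM, hT⟩ := exists_low_mid_high k
  have hk := two_mul_lt k
  obtain ⟨p, hp⟩ : ∃ p, p = g (.face k .f1) := ⟨_, rfl⟩
  obtain ⟨q, hq⟩ : ∃ q, q = g (.face k .f4) := ⟨_, rfl⟩
  obtain ⟨r, hr⟩ : ∃ r, r = g (.face k .f5) := ⟨_, rfl⟩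
  obtain ⟨s, hlo⟩ : ∃ s, s = g (.lo k) := ⟨_, rfl⟩
  obtain ⟨τ, hhi⟩ : ∃ τ, τ = g (.hi k) := ⟨_, rfl⟩
  have e1 : ∀ {a b c}, (Cell.face k .f1).Mem (a, b, c) → Φ (a, b, c) = p :=
    fun h => (hΦ _ _ h).trans hp.symm
  have e2 : ∀ {a b c}, (Cell.face k .f2).Mem (a, b, c) → Φ (a, b, c) = p :=
    fun h => (hΦ _ _ h).trans (h12.symm.trans hp.symm)
  have e3 : ∀ {a b c}, (Cell.face k .f3).Mem (a, b, c) → Φ (a, b, c) = q :=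
    fun h => (hΦ _ _ h).trans (h34.trans hq.symm)
  have e4 : ∀ {a b c}, (Cell.face k .f4).Mem (a, b, c) → Φ (a, b, c) = q :=
    fun h => (hΦ _ _ h).trans hq.symm
  have e5 : ∀ {a b c}, (Cell.face k .f5).Mem (a, b, c) → Φ (a, b, c) = r :=
    fun h => (hΦ _ _ h).trans hr.symm
  have e6 : ∀ {a b c}, (Cell.face k .f6).Mem (a, b, c) → Φ (a, b, c) = r :=
    fun h => (hΦ _ _ h).trans (h56.symm.trans hr.symm)
  have es : ∀ {a b c}, (Cell.lo k).Mem (a, b, c) → Φ (a, b, c) = s :=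
    fun h => (hΦ _ _ h).trans hlo.symm
  have et : ∀ {a b c}, (Cell.hi k).Mem (a, b, c) → Φ (a, b, c) = τ :=
    fun h => (hΦ _ _ h).trans hhi.symm
  have hout : ∀ {a b c : Fin d}, ((a : ℕ) < k ∨ d - 1 - k < (a : ℕ)) → Φ (a, b, c) = 0 := by
    intro a b c h
    refine hz _ fun h' => ?_
    have := h'.1
    simp only at this
    omega
  -- the value on the first two faces is the value on the next two
  have hpq : p = q := by
    -- The columns (L,M) and (M,L) have the same difference r − q in the rows M and T. In the row L
    -- their difference is p − q, which is also the difference of the rows M and T in the column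
    -- (T,M); hence p − q is orthogonal to itself.
    have h := hn.inner_rows (a := M) (a' := T) (s := (L, M)) (s' := (M, L)) (by
      rw [e5 (Cell.mem_f5.2 (by omega)), e4 (Cell.mem_f4.2 (by omega)),
        e5 (Cell.mem_f5.2 (by omega)), e3 (Cell.mem_f3.2 (by omega))]) L (T, M)
    rw [e2 (Cell.mem_f2.2 (by omega)), e3 (Cell.mem_f3.2 (by omega)),
      e1 (Cell.mem_f1.2 (by omega)), e4 (Cell.mem_f4.2 (by omega)), inner_self_eq_zero,
      sub_eq_zero] at h
    exact h
  subst hpq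
  -- the lower end of the diagonal
  have hps : s = p := by
    -- In each row other than L the columns (L,L) and (L,M) agree, so the whole row is orthogonal to
    -- s − p, their difference in the row L. Only the value s in the row L is left open, and the
    -- zero sum settles it.
    have h1 : ∀ a b c : Fin d, (a : ℕ) ≠ k → inner ℂ (Φ (a, b, c)) (s - p) = 0 := by
      intro a b c ha
      have h := hn.inner_row (a := a) (s := (L, L)) (s' := (L, M)) (by
        by_cases ho : (a : ℕ) < k ∨ d - 1 - k < (a : ℕ)
        · rw [hout ho, hout ho]
        · rw [e5 (Cell.mem_f5.2 (by omega)), e5 (Cell.mem_f5.2 (by omega))]) L (b, c)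
      rwa [es (a := L) (b := L) (c := L) (Cell.mem_lo.2 (by omega)),
        e1 (a := L) (b := L) (c := M) (Cell.mem_f1.2 (by omega))] at h
    have hp0 : inner ℂ p (s - p) = 0 := by
      have := h1 M M L (by omega)
      rwa [e4 (Cell.mem_f4.2 (by omega))] at this
    have h2 : ∀ t, inner ℂ (Φ t) (s - p) = 0 ∨ inner ℂ (Φ t) (s - p) = inner ℂ s (s - p) := by
      rintro ⟨a, b, c⟩
      by_cases ha : (a : ℕ) = k
      · by_cases hc : InCube d k (a, b, c)
        · rcases Cell.layer_cases k hc with h | h | ⟨_ | _ | _ | _ | _ | _, h⟩ | h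
          · exact Or.inr (by rw [es h])
          · exact absurd (Cell.mem_hi.1 h).1 (by omega)
          · exact Or.inl (by rw [e1 h, hp0])
          · exact Or.inl (by rw [e2 h, hp0])
          · exact absurd (Cell.mem_f3.1 h).1 (by omega)
          · exact Or.inl (by rw [e4 h, hp0])
          · exact absurd (Cell.mem_f5.1 h).1 (by omega)
          · exact absurd (Cell.mem_f6.1 h).1 (by omega)
          · have := h.1
            simp only at this
            omega
        · exact Or.inl (by rw [hz _ hc, inner_zero_left])
      · exact Or.inl (h1 a b c ha)
    have h3 := inner_eq_zero_of_sum hs h2 (L, L, L)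
    rw [es (Cell.mem_lo.2 (by omega))] at h3
    rw [← sub_eq_zero, ← inner_self_eq_zero (𝕜 := ℂ), inner_sub_left, h3, hp0, sub_zero]
  subst hps
  -- the value on the last two faces
  have hpr : s = r := by
    -- The columns (M,L) and (L,M) agree in the row L and differ by s − r in the row M.
    have hp0 : inner ℂ s (s - r) = 0 := by
      have h := hn.inner_row (a := L) (s := (M, L)) (s' := (L, M)) (by
        rw [e4 (Cell.mem_f4.2 (by omega)), e1 (Cell.mem_f1.2 (by omega))]) M (L, M)
      rwa [e1 (Cell.mem_f1.2 (by omega)), e4 (Cell.mem_f4.2 (by omega)),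
        e5 (Cell.mem_f5.2 (by omega))] at h
    -- Inner rows and the row T have the same difference s − r in these columns. Their entries
    -- therefore have equal inner products with s − r, which reduces the unknown interior to the row
    -- T.
    have h1 : ∀ a b c : Fin d, (k : ℕ) < a → (a : ℕ) < d - 1 - k →
        inner ℂ (Φ (a, b, c)) (s - r) = inner ℂ (Φ (T, b, c)) (s - r) := by
      intro a b c ha ha'
      have h := hn.inner_rows (a := a) (a' := T) (s := (M, L)) (s' := (L, M)) (by
        rw [e4 (Cell.mem_f4.2 (by omega)), e5 (Cell.mem_f5.2 (by omega)),
          e3 (Cell.mem_f3.2 (by omega)), e5 (Cell.mem_f5.2 (by omega))]) M (b, c)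
      rw [e4 (a := M) (b := M) (c := L) (Cell.mem_f4.2 (by omega)),
        e5 (a := M) (b := L) (c := M) (Cell.mem_f5.2 (by omega)), inner_sub_left] at h
      exact sub_eq_zero.1 h
    have ht0 : inner ℂ τ (s - r) = 0 := by
      have := h1 M T T (by omega) (by omega)
      rw [e2 (Cell.mem_f2.2 (by omega)), et (Cell.mem_hi.2 (by omega)), hp0] at this
      exact this.symm
    have h3 : ∀ b c, inner ℂ (Φ (T, b, c)) (s - r) = 0 ∨
        inner ℂ (Φ (T, b, c)) (s - r) = inner ℂ r (s - r) := by
      intro b c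
      by_cases hc : InCube d k (T, b, c)
      · rcases Cell.layer_cases k hc with h | h | ⟨_ | _ | _ | _ | _ | _, h⟩ | h
        · exact absurd (Cell.mem_lo.1 h).1 (by omega)
        · exact Or.inl (by rw [et h, ht0])
        · exact absurd (Cell.mem_f1.1 h).1 (by omega)
        · exact absurd (Cell.mem_f2.1 h).1 (by omega)
        · exact Or.inl (by rw [e3 h, hp0])
        · exact absurd (Cell.mem_f4.1 h).1 (by omega)
        · exact Or.inr (by rw [e5 h])
        · exact Or.inr (by rw [e6 h])
        · have := h.1
          simp only at this
          omega
      · exact Or.inl (by rw [hz _ hc, inner_zero_left])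
    have h2 : ∀ t, inner ℂ (Φ t) (s - r) = 0 ∨ inner ℂ (Φ t) (s - r) = inner ℂ r (s - r) := by
      rintro ⟨a, b, c⟩
      by_cases hc : InCube d k (a, b, c)
      · by_cases ha : (k : ℕ) < a ∧ (a : ℕ) < d - 1 - k
        · rw [h1 a b c ha.1 ha.2]
          exact h3 b c
        · by_cases haT : a = T
          · rw [haT]
            exact h3 b c
          · have haT' : (a : ℕ) ≠ T := fun e => haT (Fin.ext e)
            have := hc.1
            simp only at this
            rcases Cell.layer_cases k hc with h | h | ⟨_ | _ | _ | _ | _ | _, h⟩ | h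
            · exact Or.inl (by rw [es h, hp0])
            · exact absurd (Cell.mem_hi.1 h).1 (by omega)
            · exact Or.inl (by rw [e1 h, hp0])
            · exact Or.inl (by rw [e2 h, hp0])
            · exact absurd (Cell.mem_f3.1 h).1 (by omega)
            · exact Or.inl (by rw [e4 h, hp0])
            · exact absurd (Cell.mem_f5.1 h).1 (by omega)
            · exact absurd (Cell.mem_f6.1 h).1 (by omega)
            · have := h.1
              simp only at this
              omega
      · exact Or.inl (by rw [hz _ hc, inner_zero_left])
    have h4 := inner_eq_zero_of_sum hs h2 (M, L, L)
    rw [e5 (Cell.mem_f5.2 (by omega))] at h4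
    rw [← sub_eq_zero, ← inner_self_eq_zero (𝕜 := ℂ), inner_sub_left, h4, hp0, sub_zero]
  subst hpr
  -- the upper end of the diagonal
  have hpt : τ = s := by
    -- The argument for the lower end with T in place of L: in every other row the columns (T,T) and
    -- (T,M) agree.
    have h1 : ∀ a b c : Fin d, (a : ℕ) ≠ d - 1 - k → inner ℂ (Φ (a, b, c)) (τ - s) = 0 := by
      intro a b c ha
      have h := hn.inner_row (a := a) (s := (T, T)) (s' := (T, M)) (by
        by_cases ho : (a : ℕ) < k ∨ d - 1 - k < (a : ℕ)
        · rw [hout ho, hout ho]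
        · rw [e2 (Cell.mem_f2.2 (by omega)), e2 (Cell.mem_f2.2 (by omega))]) T (b, c)
      rwa [et (a := T) (b := T) (c := T) (Cell.mem_hi.2 (by omega)),
        e3 (a := T) (b := T) (c := M) (Cell.mem_f3.2 (by omega))] at h
    have hp0 : inner ℂ s (τ - s) = 0 := by
      have := h1 L M L (by omega)
      rwa [e4 (Cell.mem_f4.2 (by omega))] at this
    have h2 : ∀ t, inner ℂ (Φ t) (τ - s) = 0 ∨ inner ℂ (Φ t) (τ - s) = inner ℂ τ (τ - s) := by
      rintro ⟨a, b, c⟩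
      by_cases ha : (a : ℕ) = d - 1 - k
      · by_cases hc : InCube d k (a, b, c)
        · rcases Cell.layer_cases k hc with h | h | ⟨_ | _ | _ | _ | _ | _, h⟩ | h
          · exact Or.inl (by rw [es h, hp0])
          · exact Or.inr (by rw [et h])
          · exact Or.inl (by rw [e1 h, hp0])
          · exact Or.inl (by rw [e2 h, hp0])
          · exact Or.inl (by rw [e3 h, hp0])
          · exact Or.inl (by rw [e4 h, hp0])
          · exact Or.inl (by rw [e5 h, hp0])
          · exact Or.inl (by rw [e6 h, hp0])
          · have := h.1
            simp only at this
            omega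
        · exact Or.inl (by rw [hz _ hc, inner_zero_left])
      · exact Or.inl (h1 a b c ha)
    have h3 := inner_eq_zero_of_sum hs h2 (T, T, T)
    rw [et (Cell.mem_hi.2 (by omega))] at h3
    rw [← sub_eq_zero, ← inner_self_eq_zero (𝕜 := ℂ), inner_sub_left, h3, hp0, sub_zero]
  subst hpt
  -- the common value
  have hp0 : τ = 0 := by
    have h2 : ∀ t, inner ℂ (Φ t) τ = 0 ∨ inner ℂ (Φ t) τ = inner ℂ τ τ := by
      rintro ⟨a, b, c⟩
      by_cases hc : InCube d k (a, b, c)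
      · rcases Cell.layer_cases k hc with h | h | ⟨_ | _ | _ | _ | _ | _, h⟩ | h
        · exact Or.inr (by rw [es h])
        · exact Or.inr (by rw [et h])
        · exact Or.inr (by rw [e1 h])
        · exact Or.inr (by rw [e2 h])
        · exact Or.inr (by rw [e3 h])
        · exact Or.inr (by rw [e4 h])
        · exact Or.inr (by rw [e5 h])
        · exact Or.inr (by rw [e6 h])
        · simp only [InCube] at h
          -- In the row L an inner column (b,c) and the column (M,L) both carry τ. So in an inner
          -- row the entry at (b,c) has the same inner product with τ as the entry at (M,L), which
          -- is τ itself.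
          have h' := hn.inner_row (a := L) (s := (b, c)) (s' := (M, L)) (by
            rw [e1 (Cell.mem_f1.2 (by omega)), e4 (Cell.mem_f4.2 (by omega))]) a (M, L)
          rw [e4 (a := L) (Cell.mem_f4.2 (by omega)), e4 (b := M) (Cell.mem_f4.2 (by omega)), inner_sub_right,
            sub_eq_zero] at h'
          refine Or.inr ?_
          rw [← inner_conj_symm, h', inner_conj_symm]
      · exact Or.inl (by rw [hz _ hc, inner_zero_left])
    have h3 := inner_eq_zero_of_sum hs h2 (L, L, L)
    rwa [es (Cell.mem_lo.2 (by omega)), inner_self_eq_zero] at h3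
  subst hp0
  refine ⟨hlo.symm, hhi.symm, fun p' => ?_⟩
  cases p'
  · exact hp.symm
  · exact h12.symm.trans hp.symm
  · exact h34.trans hq.symm
  · exact hq.symm
  · exact hr.symm
  · exact h56.symm.trans hr.symm

/-- A block-constant family with the symmetric coincidences that vanishes in total and admits no
filter for the first party against the others is zero. -/
theorem symmetric_eq_zero {Φ : Cube d → H} {g : Cell d → H} (hΦ : IsBlockConst Φ g)
    (hs : ∑ t, Φ t = 0) (hn : NoFilter Φ)
    (h12 : ∀ k, g (.face k .f1) = g (.face k .f2)) (h34 : ∀ k, g (.face k .f3) = g (.face k .f4))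
    (h56 : ∀ k, g (.face k .f5) = g (.face k .f6)) : ∀ t, Φ t = 0 :=
  eq_zero_of_layers hΦ hs fun k hz =>
    Or.inr (symmetric_layer hΦ hs hn k (h12 k) (h34 k) (h56 k) hz)

/-- The cyclic permutation of the parties, on cells. -/
def Cell.rot : Cell d → Cell d
  | .face k .f1 => .face k .f5
  | .face k .f5 => .face k .f4
  | .face k .f4 => .face k .f1
  | .face k .f2 => .face k .f6
  | .face k .f6 => .face k .f3
  | .face k .f3 => .face k .f2
  | .lo k => .lo k
  | .hi k => .hi k
  | .core => .core

theorem Cell.Mem.rot {c : Cell d} {t : Cube d} (h : c.Mem t) :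
    c.rot.Mem (t.2.2, t.1, t.2.1) := by
  rcases c with ⟨k, _ | _⟩ | k | k | _ <;> exact ⟨h.2.2, h.1, h.2.1⟩

omit [NormedAddCommGroup H] [InnerProductSpace ℂ H] in
theorem IsBlockConst.rot {Φ : Cube d → H} {g : Cell d → H} (h : IsBlockConst Φ g) :
    IsBlockConst (fun t => Φ (t.2.2, t.1, t.2.1)) (fun c => g c.rot) :=
  fun c _ ht => h c.rot _ ht.rot

/-- Cyclic permutation of the labels. -/
def rotEquiv (d : ℕ) : Cube d ≃ Cube d where
  toFun t := (t.2.2, t.1, t.2.1)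
  invFun t := (t.2.1, t.2.2, t.1)
  left_inv _ := rfl
  right_inv _ := rfl

omit [InnerProductSpace ℂ H] in
theorem sum_rot (Φ : Cube d → H) : ∑ t : Cube d, Φ (t.2.2, t.1, t.2.1) = ∑ t, Φ t :=
  Equiv.sum_comp (rotEquiv d) Φ

theorem NoFilter.reindex {α β β' : Type*} [Fintype α] [Fintype β] [Fintype β'] (e : β' ≃ β)
    {Φ : α × β → H} (h : NoFilter Φ) : NoFilter (fun t : α × β' => Φ (t.1, e t.2)) := by
  have he : ∀ (x : α → ℂ) (y : β' → ℂ),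
      pair (fun t : α × β' => Φ (t.1, e t.2)) x y = pair Φ x (y ∘ e.symm) := by
    intro x y
    rw [pair, pair, ← Equiv.sum_comp ((Equiv.refl α).prodCongr e)]
    simp only [Equiv.prodCongr_apply, Equiv.coe_refl, Prod.map_fst, Prod.map_snd, id,
      Function.comp_apply, Equiv.symm_apply_apply]
    rfl
  intro x x' y y' hxy
  rw [he] at hxy
  rw [he, he]
  exact h _ _ _ _ hxy

/-- The same across any of the three bipartitions. -/
theorem symmetric_eq_zero_across (c : Cut) {Φ : Cube d → H} {g : Cell d → H}
    (hΦ : IsBlockConst Φ g) (hs : ∑ t, Φ t = 0) (hn : NoFilter (fun t => Φ ((cutEquiv d c).symm t)))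
    (h12 : ∀ k, g (.face k .f1) = g (.face k .f2)) (h34 : ∀ k, g (.face k .f3) = g (.face k .f4))
    (h56 : ∀ k, g (.face k .f5) = g (.face k .f6)) : ∀ t, Φ t = 0 := by
  cases c
  · exact symmetric_eq_zero hΦ hs hn h12 h34 h56
  -- Rotating the parties sends the face pairs {1,2}, {3,4}, {5,6} to {5,6}, {1,2}, {3,4}, so the
  -- pattern is preserved. For the cut B|AC the other two parties must also be exchanged, since
  -- `cutEquiv` lists A before C.
  · have h := symmetric_eq_zero hΦ.rot (by rw [sum_rot, hs])
      (hn.reindex (Equiv.prodComm (Fin d) (Fin d))) h56 (fun k => (h12 k).symm)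
      (fun k => (h34 k).symm)
    intro t
    exact h (t.2.1, t.2.2, t.1)
  · have h := symmetric_eq_zero hΦ.rot.rot ((sum_rot _).trans ((sum_rot Φ).trans hs)) hn
      (fun k => (h34 k).symm) (fun k => (h56 k).symm) h12
    intro t
    exact h (t.2.2, t.1, t.2.1)

end Symmetric

end

end BlockCube

/-! ### Product vectors: minors of a layer, asymmetric pattern, fully product case -/

namespace BlockCube

noncomputable section

variable {d : ℕ}

/-- Minors of a rank one matrix whose rows are the low, an inner and the high slice of a layer,
in terms of the values `f₁, …, f₆` on the faces, `s` and `t` at the ends of the diagonal and `z` at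
a point inside the layer. -/
structure LayerMinors (f₁ f₂ f₃ f₄ f₅ f₆ s t z : ℂ) : Prop where
  m1 : f₁ * f₆ = f₅ * f₁
  m2 : f₄ * f₅ = f₄ * f₁
  m3 : f₄ * f₅ = f₃ * f₅
  m4 : f₂ * f₅ = f₂ * f₁
  m5 : f₂ * f₅ = t * f₁
  m6 : f₂ * f₅ = t * f₅
  m7 : f₁ * f₅ = z * f₁
  m8 : f₁ * f₅ = f₃ * f₁
  m9 : s * f₅ = f₅ * f₁
  m10 : f₄ * z = f₄ * f₁
  m11 : s * f₄ = f₅ * f₄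
  m12 : s * z = f₅ * f₁
  m13 : s * t = f₅ * f₂
  n1 : f₃ * f₄ = f₂ * f₃
  n2 : f₆ * f₂ = f₆ * f₃
  n3 : f₆ * f₂ = f₁ * f₂
  n4 : f₅ * f₂ = f₅ * f₃
  n5 : f₅ * f₂ = s * f₃
  n6 : f₅ * f₂ = s * f₂
  n7 : f₃ * f₂ = z * f₃
  n8 : f₃ * f₂ = f₁ * f₃
  n9 : t * f₂ = f₂ * f₃
  n10 : f₆ * z = f₆ * f₃
  n11 : t * f₆ = f₂ * f₆
  n12 : t * z = f₂ * f₃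
  n13 : t * s = f₂ * f₅

/-- The reflection a ↦ d − 1 − a exchanges the faces 1 and 3, 2 and 5, 4 and 6, and the two diagonal
ends; the list of minors is closed under it. -/
theorem LayerMinors.reflect {f₁ f₂ f₃ f₄ f₅ f₆ s t z : ℂ}
    (h : LayerMinors f₁ f₂ f₃ f₄ f₅ f₆ s t z) : LayerMinors f₃ f₅ f₁ f₆ f₂ f₄ t s z :=
  ⟨h.n1, h.n2, h.n3, h.n4, h.n5, h.n6, h.n7, h.n8, h.n9, h.n10, h.n11, h.n12, h.n13,
    h.m1, h.m2, h.m3, h.m4, h.m5, h.m6, h.m7, h.m8, h.m9, h.m10, h.m11, h.m12, h.m13⟩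

/-- `f` is a product of a function of the first coordinate and one of the two others. -/
def IsFstProduct (f : Cube d → ℂ) : Prop :=
  ∃ (x : Fin d → ℂ) (y : Fin d × Fin d → ℂ), ∀ t, f t = x t.1 * y t.2

theorem IsFstProduct.layerMinors {f : Cube d → ℂ} (hf : IsFstProduct f) {g : Cell d → ℂ}
    (hg : IsBlockConst f g) (k : Fin (numLayers d)) {t : Cube d} (ht : InCube d (k + 1) t) :
    LayerMinors (g (.face k .f1)) (g (.face k .f2)) (g (.face k .f3)) (g (.face k .f4))
      (g (.face k .f5)) (g (.face k .f6)) (g (.lo k)) (g (.hi k)) (f t) := by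
  obtain ⟨x, y, hxy⟩ := hf
  obtain ⟨a, b, c⟩ := t
  obtain ⟨L, M, T, hL, hM, hT⟩ := exists_low_mid_high k
  have hk := two_mul_lt k
  simp only [InCube] at ht
  have e : ∀ {c : Cell d} {t : Cube d}, c.Mem t → g c = x t.1 * y t.2 :=
    fun h => (hg _ _ h).symm.trans (hxy _)
  -- The letters s, p, q, r, u, v, w stand for the columns (L,L), (L,M), (M,T), (M,L), (T,M), (T,T),
  -- (b,c), and the digits 0, 1, 2 for the rows L, a, T.
  have s0 : g (.lo k) = x L * y (L, L) := e (Cell.mem_lo.2 (by omega))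
  have s1 : g (.face k .f5) = x a * y (L, L) := e (t := (a, L, L)) (Cell.mem_f5.2 (by omega))
  have s2 : g (.face k .f5) = x T * y (L, L) := e (t := (T, L, L)) (Cell.mem_f5.2 (by omega))
  have p0 : g (.face k .f1) = x L * y (L, M) := e (t := (L, L, M)) (Cell.mem_f1.2 (by omega))
  have p1 : g (.face k .f5) = x a * y (L, M) := e (t := (a, L, M)) (Cell.mem_f5.2 (by omega))
  have p2 : g (.face k .f5) = x T * y (L, M) := e (t := (T, L, M)) (Cell.mem_f5.2 (by omega))
  have q0 : g (.face k .f1) = x L * y (M, T) := e (t := (L, M, T)) (Cell.mem_f1.2 (by omega))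
  have q1 : g (.face k .f6) = x a * y (M, T) := e (t := (a, M, T)) (Cell.mem_f6.2 (by omega))
  have q2 : g (.face k .f6) = x T * y (M, T) := e (t := (T, M, T)) (Cell.mem_f6.2 (by omega))
  have r0 : g (.face k .f4) = x L * y (M, L) := e (t := (L, M, L)) (Cell.mem_f4.2 (by omega))
  have r1 : g (.face k .f4) = x a * y (M, L) := e (t := (a, M, L)) (Cell.mem_f4.2 (by omega))
  have r2 : g (.face k .f3) = x T * y (M, L) := e (t := (T, M, L)) (Cell.mem_f3.2 (by omega))
  have u0 : g (.face k .f2) = x L * y (T, M) := e (t := (L, T, M)) (Cell.mem_f2.2 (by omega))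
  have u1 : g (.face k .f2) = x a * y (T, M) := e (t := (a, T, M)) (Cell.mem_f2.2 (by omega))
  have u2 : g (.face k .f3) = x T * y (T, M) := e (t := (T, T, M)) (Cell.mem_f3.2 (by omega))
  have v0 : g (.face k .f2) = x L * y (T, T) := e (t := (L, T, T)) (Cell.mem_f2.2 (by omega))
  have v1 : g (.face k .f2) = x a * y (T, T) := e (t := (a, T, T)) (Cell.mem_f2.2 (by omega))
  have v2 : g (.hi k) = x T * y (T, T) := e (t := (T, T, T)) (Cell.mem_hi.2 (by omega))
  have w0 : g (.face k .f1) = x L * y (b, c) := e (t := (L, b, c)) (Cell.mem_f1.2 (by omega))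
  have w1 : f (a, b, c) = x a * y (b, c) := hxy _
  have w2 : g (.face k .f3) = x T * y (b, c) := e (t := (T, b, c)) (Cell.mem_f3.2 (by omega))
  refine ⟨?_, ?_, ?_, ?_, ?_, ?_, ?_, ?_, ?_, ?_, ?_, ?_, ?_, ?_, ?_, ?_, ?_, ?_, ?_, ?_, ?_, ?_,
    ?_, ?_, ?_, ?_⟩
  -- Each minor is an instance of (x i · y j)(x i' · y j') = (x i' · y j)(x i · y j'); the
  -- coefficients replace the four entries by these products.
  · linear_combination g (.face k .f1) * q1 + x a * y (M, T) * p0 - g (.face k .f1) * p1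
      - x a * y (L, M) * q0
  · linear_combination g (.face k .f4) * p1 + x a * y (L, M) * r0 - g (.face k .f4) * p0
      - x L * y (L, M) * r1
  · linear_combination g (.face k .f4) * p2 + x T * y (L, M) * r1 - g (.face k .f3) * p1
      - x a * y (L, M) * r2
  · linear_combination g (.face k .f2) * p1 + x a * y (L, M) * u0 - g (.face k .f2) * p0
      - x L * y (L, M) * u1
  · linear_combination g (.face k .f2) * p2 + x T * y (L, M) * v0 - g (.hi k) * p0
      - x L * y (L, M) * v2
  · linear_combination g (.face k .f2) * p2 + x T * y (L, M) * v1 - g (.hi k) * p1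
      - x a * y (L, M) * v2
  · linear_combination g (.face k .f1) * p1 + x a * y (L, M) * w0 - f (a, b, c) * p0
      - x L * y (L, M) * w1
  · linear_combination g (.face k .f1) * p2 + x T * y (L, M) * w0 - g (.face k .f3) * p0
      - x L * y (L, M) * w2
  · linear_combination g (.lo k) * p1 + x a * y (L, M) * s0 - g (.face k .f5) * p0
      - x L * y (L, M) * s1
  · linear_combination g (.face k .f4) * w1 + x a * y (b, c) * r0 - g (.face k .f4) * w0
      - x L * y (b, c) * r1
  · linear_combination g (.lo k) * r1 + x a * y (M, L) * s0 - g (.face k .f5) * r0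
      - x L * y (M, L) * s1
  · linear_combination g (.lo k) * w1 + x a * y (b, c) * s0 - g (.face k .f5) * w0
      - x L * y (b, c) * s1
  · linear_combination g (.lo k) * v2 + x T * y (T, T) * s0 - g (.face k .f5) * v0
      - x L * y (T, T) * s2
  · linear_combination g (.face k .f3) * r0 + x L * y (M, L) * u2 - g (.face k .f2) * r2
      - x T * y (M, L) * u0
  · linear_combination g (.face k .f6) * u1 + x a * y (T, M) * q2 - g (.face k .f6) * u2
      - x T * y (T, M) * q1
  · linear_combination g (.face k .f6) * u0 + x L * y (T, M) * q1 - g (.face k .f1) * u1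
      - x a * y (T, M) * q0
  · linear_combination g (.face k .f5) * u1 + x a * y (T, M) * p2 - g (.face k .f5) * u2
      - x T * y (T, M) * p1
  · linear_combination g (.face k .f5) * u0 + x L * y (T, M) * s2 - g (.lo k) * u2
      - x T * y (T, M) * s0
  · linear_combination g (.face k .f5) * u0 + x L * y (T, M) * s1 - g (.lo k) * u1
      - x a * y (T, M) * s0
  · linear_combination g (.face k .f3) * u1 + x a * y (T, M) * w2 - f (a, b, c) * u2
      - x T * y (T, M) * w1
  · linear_combination g (.face k .f3) * u0 + x L * y (T, M) * w2 - g (.face k .f1) * u2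
      - x T * y (T, M) * w0
  · linear_combination g (.hi k) * u1 + x a * y (T, M) * v2 - g (.face k .f2) * u2
      - x T * y (T, M) * v1
  · linear_combination g (.face k .f6) * w1 + x a * y (b, c) * q2 - g (.face k .f6) * w2
      - x T * y (b, c) * q1
  · linear_combination g (.hi k) * q1 + x a * y (M, T) * v2 - g (.face k .f2) * q2
      - x T * y (M, T) * v1
  · linear_combination g (.hi k) * w1 + x a * y (b, c) * v2 - g (.face k .f2) * w2
      - x T * y (b, c) * v1
  · linear_combination g (.hi k) * s0 + x L * y (L, L) * v2 - g (.face k .f2) * s2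
      - x T * y (L, L) * v0

/-- If the values on a layer and inside it take only one nonzero value, everything vanishes. -/
theorem eq_zero_of_layer {f : Cube d → ℂ} {g : Cell d → ℂ} (hg : IsBlockConst f g)
    (hs : ∑ t, f t = 0) (k : Fin (numLayers d)) (hz : ∀ t, ¬ InCube d k t → f t = 0) {c : ℂ}
    (hlo : g (.lo k) = 0 ∨ g (.lo k) = c) (hhi : g (.hi k) = 0 ∨ g (.hi k) = c)
    (hf : ∀ p, g (.face k p) = 0 ∨ g (.face k p) = c)
    (hin : ∀ t, InCube d (k + 1) t → f t = 0 ∨ f t = c) : ∀ t, f t = 0 := by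
  refine eq_zero_of_two_valued (c := c) (fun t => ?_) hs
  by_cases ht : InCube d k t
  · rcases Cell.layer_cases k ht with h | h | ⟨p, h⟩ | h
    · rwa [hg _ _ h]
    · rwa [hg _ _ h]
    · rw [hg _ _ h]
      exact hf p
    · exact hin t h
  · exact Or.inl (hz t ht)

theorem inCube_mid (k : Fin (numLayers d)) : ∃ t, InCube d (k + 1) t := by
  obtain ⟨L, M, T, hL, hM, hT⟩ := exists_low_mid_high k
  have := two_mul_lt k
  refine ⟨(M, M, M), ?_⟩
  simp only [InCube]
  omega

/-- Coincidence of values that makes a function constant on the asymmetric pattern. -/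
structure IsAsymmetric (g : Cell d → ℂ) : Prop where
  h12 : ∀ k, g (.face k .f1) = g (.face k .f2)
  h35 : ∀ k, g (.face k .f3) = g (.face k .f5)
  hlo : ∀ k, g (.lo k) = g (.face k .f4)
  hhi : ∀ k, g (.hi k) = g (.face k .f6)

section Asymmetric

variable {f : Cube d → ℂ} {g : Cell d → ℂ} (hg : IsBlockConst f g) (hs : ∑ t, f t = 0)
  (ha : IsAsymmetric g)

include hg hs ha

/-- The two alternatives are the two ways to dispose of a layer: all its values vanish and it is
peeled, or a single nonzero value remains in total and the zero sum ends the proof. -/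
theorem asymmetric_layer (k : Fin (numLayers d)) (hz : ∀ t, ¬ InCube d k t → f t = 0)
    (h : (g (.face k .f1) = 0 ∧ g (.face k .f3) = 0 ∧ g (.lo k) = 0 ∧ g (.hi k) = 0) ∨
      ∃ c, (g (.face k .f1) = 0 ∨ g (.face k .f1) = c) ∧ (g (.face k .f3) = 0 ∨ g (.face k .f3) = c) ∧
        (g (.lo k) = 0 ∨ g (.lo k) = c) ∧ (g (.hi k) = 0 ∨ g (.hi k) = c) ∧
        ∀ t, InCube d (k + 1) t → f t = 0 ∨ f t = c) :
    (∀ t, f t = 0) ∨ g (.lo k) = 0 ∧ g (.hi k) = 0 ∧ ∀ p, g (.face k p) = 0 := by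
  rcases h with ⟨h1, h3, hl, hh⟩ | ⟨c, h1, h3, hl, hh, hin⟩
  · refine Or.inr ⟨hl, hh, fun p => ?_⟩
    cases p
    · exact h1
    · exact ha.h12 k ▸ h1
    · exact h3
    · exact ha.hlo k ▸ hl
    · exact ha.h35 k ▸ h3
    · exact ha.hhi k ▸ hh
  · refine Or.inl (eq_zero_of_layer hg hs k hz hl hh (fun p => ?_) hin)
    cases p
    · exact h1
    · exact ha.h12 k ▸ h1
    · exact h3
    · exact ha.hlo k ▸ hl
    · exact ha.h35 k ▸ h3
    · exact ha.hhi k ▸ hh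

/-- After the coincidences are inserted, the minors leave a dichotomy: if p = 0, the other values of
the layer vanish, and if p ≠ 0, these and all inner values equal p. The same dichotomy holds for the
cut B|AC. -/
theorem asymmetric_eq_zero_A (hp : IsFstProduct f) : ∀ t, f t = 0 := by
  refine eq_zero_of_layers hg hs fun k hz => asymmetric_layer hg hs ha k hz ?_
  have key : ∀ t, InCube d (k + 1) t → LayerMinors (g (.face k .f1)) (g (.face k .f1))
      (g (.face k .f3)) (g (.lo k)) (g (.face k .f3)) (g (.hi k)) (g (.lo k)) (g (.hi k)) (f t) := by
    intro t ht
    have := hp.layerMinors hg k ht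
    rwa [← ha.h12 k, ← ha.h35 k, ← ha.hlo k, ← ha.hhi k] at this
  generalize g (.face k .f1) = p at key ⊢
  generalize g (.face k .f3) = q at key ⊢
  generalize g (.lo k) = s at key ⊢
  generalize g (.hi k) = τ at key ⊢
  obtain ⟨t₀, ht₀⟩ := inCube_mid k
  obtain ⟨m1, m2, m3, m4, m5, m6, m7, m8, m9, m10, m11, m12, m13, n1, n2, n3, n4, n5, n6, n7, n8,
    n9, n10, n11, n12, n13⟩ := key t₀ ht₀
  by_cases hp0 : p = 0
  · left
    subst hp0
    grind
  · right
    refine ⟨p, Or.inr rfl, Or.inr ?_, Or.inr ?_, Or.inr ?_, fun t ht => Or.inr ?_⟩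
    · grind
    · grind
    · grind
    · have := (key t ht).m7
      grind

theorem asymmetric_eq_zero_B (hp : IsFstProduct fun t => f (t.2.2, t.1, t.2.1)) :
    ∀ t, f t = 0 := by
  refine eq_zero_of_layers hg hs fun k hz => asymmetric_layer hg hs ha k hz ?_
  have key : ∀ t, InCube d (k + 1) t → LayerMinors (g (.face k .f3)) (g (.hi k))
      (g (.face k .f1)) (g (.face k .f1)) (g (.lo k)) (g (.face k .f3)) (g (.lo k)) (g (.hi k))
      (f t) := by
    intro t ht
    have : LayerMinors (g (.face k .f5)) (g (.face k .f6)) (g (.face k .f2)) (g (.face k .f1))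
      (g (.face k .f4)) (g (.face k .f3)) (g (.lo k)) (g (.hi k)) (f t) :=
      hp.layerMinors hg.rot k (t := (t.2.1, t.2.2, t.1)) ⟨ht.2.1, ht.2.2, ht.1⟩
    rwa [← ha.h12 k, ← ha.h35 k, ← ha.hlo k, ← ha.hhi k] at this
  generalize g (.face k .f1) = p at key ⊢
  generalize g (.face k .f3) = q at key ⊢
  generalize g (.lo k) = s at key ⊢
  generalize g (.hi k) = τ at key ⊢
  obtain ⟨t₀, ht₀⟩ := inCube_mid k
  obtain ⟨m1, m2, m3, m4, m5, m6, m7, m8, m9, m10, m11, m12, m13, n1, n2, n3, n4, n5, n6, n7, n8,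
    n9, n10, n11, n12, n13⟩ := key t₀ ht₀
  by_cases hp0 : p = 0
  · left
    subst hp0
    grind
  · right
    refine ⟨p, Or.inr rfl, Or.inr ?_, Or.inr ?_, Or.inr ?_, fun t ht => Or.inr ?_⟩
    · grind
    · grind
    · grind
    · have := (key t ht).n7
      grind

/-- In this cut p = 0 no longer kills the other values directly. The first nonzero one among p, q,
s, τ then serves as the single nonzero value. -/
theorem asymmetric_eq_zero_C (hp : IsFstProduct fun t => f (t.2.1, t.2.2, t.1)) :
    ∀ t, f t = 0 := by
  refine eq_zero_of_layers hg hs fun k hz => asymmetric_layer hg hs ha k hz ?_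
  have key : ∀ t, InCube d (k + 1) t → LayerMinors (g (.lo k)) (g (.face k .f3))
      (g (.hi k)) (g (.face k .f3)) (g (.face k .f1)) (g (.face k .f1)) (g (.lo k)) (g (.hi k))
      (f t) := by
    intro t ht
    have : LayerMinors (g (.face k .f4)) (g (.face k .f3)) (g (.face k .f6)) (g (.face k .f5))
      (g (.face k .f1)) (g (.face k .f2)) (g (.lo k)) (g (.hi k)) (f t) :=
      hp.layerMinors hg.rot.rot k (t := (t.2.2, t.1, t.2.1)) ⟨ht.2.2, ht.1, ht.2.1⟩
    rwa [← ha.h12 k, ← ha.h35 k, ← ha.hlo k, ← ha.hhi k] at this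
  generalize g (.face k .f1) = p at key ⊢
  generalize g (.face k .f3) = q at key ⊢
  generalize g (.lo k) = s at key ⊢
  generalize g (.hi k) = τ at key ⊢
  obtain ⟨t₀, ht₀⟩ := inCube_mid k
  obtain ⟨m1, m2, m3, m4, m5, m6, m7, m8, m9, m10, m11, m12, m13, n1, n2, n3, n4, n5, n6, n7, n8,
    n9, n10, n11, n12, n13⟩ := key t₀ ht₀
  by_cases hall : p = 0 ∧ q = 0 ∧ s = 0 ∧ τ = 0
  · exact Or.inl hall
  right
  by_cases hp0 : p = 0
  · subst hp0
    by_cases hq0 : q = 0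
    · subst hq0
      by_cases hs0 : s = 0
      · subst hs0
        refine ⟨τ, Or.inl rfl, Or.inl rfl, Or.inl rfl, Or.inr rfl, fun t ht => Or.inl ?_⟩
        have := (key t ht).n12
        grind
      · refine ⟨s, Or.inl rfl, Or.inl rfl, Or.inr rfl, Or.inl ?_, fun t ht => Or.inl ?_⟩
        · grind
        · have := (key t ht).m12
          grind
    · refine ⟨q, Or.inl rfl, Or.inr rfl, Or.inl ?_, Or.inl ?_, fun t ht => Or.inl ?_⟩
      · grind
      · grind
      · have := (key t ht).m10
        grind
  · have hz' : ∀ t, InCube d (k + 1) t → f t = τ := by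
      intro t ht
      have := (key t ht).n10
      grind
    by_cases hq0 : q = 0
    · refine ⟨p, Or.inr rfl, Or.inl hq0, Or.inl ?_, Or.inl ?_, fun t ht => Or.inl ?_⟩
      · grind
      · grind
      · rw [hz' t ht]
        grind
    · refine ⟨p, Or.inr rfl, Or.inr ?_, Or.inr ?_, Or.inr ?_, fun t ht => Or.inr ?_⟩
      · grind
      · grind
      · grind
      · rw [hz' t ht]
        grind

end Asymmetric

/-- Cancelling f₁ gives f₆ = z = f₃ = f₅ from A and s = f₄ from C. If f₅ vanishes, so does
everything except f₁; otherwise cancelling f₅ as well makes all values equal to f₁. -/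
theorem LayerMinors.two_valued {f₁ f₂ f₃ f₄ f₅ f₆ s t z : ℂ}
    (A : LayerMinors f₁ f₂ f₃ f₄ f₅ f₆ s t z) (C : LayerMinors f₄ f₃ f₆ f₅ f₁ f₂ s t z)
    (h : f₁ ≠ 0) :
    (f₂ = 0 ∨ f₂ = f₁) ∧ (f₃ = 0 ∨ f₃ = f₁) ∧ (f₄ = 0 ∨ f₄ = f₁) ∧ (f₅ = 0 ∨ f₅ = f₁) ∧
      (f₆ = 0 ∨ f₆ = f₁) ∧ (s = 0 ∨ s = f₁) ∧ (t = 0 ∨ t = f₁) ∧ (z = 0 ∨ z = f₁) := by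
  have h6 : f₆ = f₅ := mul_left_cancel₀ h (by rw [A.m1, mul_comm])
  have hz : z = f₅ := mul_right_cancel₀ h (by rw [← A.m7, mul_comm])
  have h3 : f₃ = f₅ := mul_right_cancel₀ h (by rw [← A.m8, mul_comm])
  have hs : s = f₄ := mul_right_cancel₀ h (by rw [C.m9, mul_comm])
  subst h6 hz h3 hs
  by_cases h5 : f₃ = 0
  · subst h5
    have h4 : s = 0 := by simpa [h] using A.m2.symm
    have h2 : f₂ = 0 := by simpa [h] using A.m4.symm
    have ht : t = 0 := by simpa [h] using A.m5.symm
    simp [h4, h2, ht]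
  · have e1 : f₃ = s := mul_left_cancel₀ h5 C.m10
    have e2 : s = f₁ := by
      subst e1
      exact mul_left_cancel₀ h5 A.m2
    have e3 : f₂ = f₃ := mul_right_cancel₀ h5 (by rw [← A.n1, e1])
    have e4 : t = f₂ := mul_right_cancel₀ h5 A.m6.symm
    refine ⟨Or.inr ?_, Or.inr ?_, Or.inr e2, Or.inr ?_, Or.inr ?_, Or.inr e2, Or.inr ?_, Or.inr ?_⟩ <;>
      simp only [e4, e3, e1, e2]

/-- Rotating the parties permutes the faces 1, 5, 4 cyclically, and the faces 3, 2, 6 are their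
reflections. So `LayerMinors.two_valued` handles every layer with a nonzero face. -/
theorem product_eq_zero {f : Cube d → ℂ} {g : Cell d → ℂ} (hg : IsBlockConst f g)
    (hs : ∑ t, f t = 0) (hA : IsFstProduct f) (hB : IsFstProduct fun t => f (t.2.2, t.1, t.2.1))
    (hC : IsFstProduct fun t => f (t.2.1, t.2.2, t.1)) : ∀ t, f t = 0 := by
  refine eq_zero_of_layers hg hs fun k hz => ?_
  have kA := fun t (ht : InCube d (k + 1) t) => hA.layerMinors hg k ht
  have kB : ∀ t, InCube d (k + 1) t → LayerMinors (g (.face k .f5)) (g (.face k .f6))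
      (g (.face k .f2)) (g (.face k .f1)) (g (.face k .f4)) (g (.face k .f3)) (g (.lo k))
      (g (.hi k)) (f t) := fun t ht =>
    hB.layerMinors hg.rot k (t := (t.2.1, t.2.2, t.1)) ⟨ht.2.1, ht.2.2, ht.1⟩
  have kC : ∀ t, InCube d (k + 1) t → LayerMinors (g (.face k .f4)) (g (.face k .f3))
      (g (.face k .f6)) (g (.face k .f5)) (g (.face k .f1)) (g (.face k .f2)) (g (.lo k))
      (g (.hi k)) (f t) := fun t ht =>
    hC.layerMinors hg.rot.rot k (t := (t.2.2, t.1, t.2.1)) ⟨ht.2.2, ht.1, ht.2.1⟩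
  obtain ⟨t₀, ht₀⟩ := inCube_mid k
  have fin : ∀ c, (∀ t, InCube d (k + 1) t → ((g (.lo k) = 0 ∨ g (.lo k) = c) ∧
      (g (.hi k) = 0 ∨ g (.hi k) = c) ∧ (∀ p, g (.face k p) = 0 ∨ g (.face k p) = c)) ∧
      (f t = 0 ∨ f t = c)) → (∀ t, f t = 0) ∨ g (.lo k) = 0 ∧ g (.hi k) = 0 ∧
        ∀ p, g (.face k p) = 0 := fun c h =>
    Or.inl (eq_zero_of_layer hg hs k hz (h t₀ ht₀).1.1 (h t₀ ht₀).1.2.1 (h t₀ ht₀).1.2.2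
      fun t ht => (h t ht).2)
  by_cases h1 : g (.face k .f1) = 0
  swap
  · refine fin (g (.face k .f1)) fun t ht => ?_
    obtain ⟨c2, c3, c4, c5, c6, cs, ct, cz⟩ := (kA t ht).two_valued (kC t ht) h1
    exact ⟨⟨cs, ct, fun p => by cases p <;> first | assumption | exact Or.inr rfl⟩, cz⟩
  by_cases h5 : g (.face k .f5) = 0
  swap
  · refine fin (g (.face k .f5)) fun t ht => ?_
    obtain ⟨c2, c3, c4, c5, c6, cs, ct, cz⟩ := (kB t ht).two_valued (kA t ht) h5
    exact ⟨⟨cs, ct, fun p => by cases p <;> first | assumption | exact Or.inr rfl⟩, cz⟩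
  by_cases h4 : g (.face k .f4) = 0
  swap
  · refine fin (g (.face k .f4)) fun t ht => ?_
    obtain ⟨c2, c3, c4, c5, c6, cs, ct, cz⟩ := (kC t ht).two_valued (kB t ht) h4
    exact ⟨⟨cs, ct, fun p => by cases p <;> first | assumption | exact Or.inr rfl⟩, cz⟩
  by_cases h3 : g (.face k .f3) = 0
  swap
  · refine fin (g (.face k .f3)) fun t ht => ?_
    obtain ⟨c2, c3, c4, c5, c6, cs, ct, cz⟩ := (kA t ht).reflect.two_valued (kC t ht).reflect h3
    exact ⟨⟨ct, cs, fun p => by cases p <;> first | assumption | exact Or.inr rfl⟩, cz⟩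
  by_cases h2 : g (.face k .f2) = 0
  swap
  · refine fin (g (.face k .f2)) fun t ht => ?_
    obtain ⟨c2, c3, c4, c5, c6, cs, ct, cz⟩ := (kB t ht).reflect.two_valued (kA t ht).reflect h2
    exact ⟨⟨ct, cs, fun p => by cases p <;> first | assumption | exact Or.inr rfl⟩, cz⟩
  by_cases h6 : g (.face k .f6) = 0
  swap
  · refine fin (g (.face k .f6)) fun t ht => ?_
    obtain ⟨c2, c3, c4, c5, c6, cs, ct, cz⟩ := (kC t ht).reflect.two_valued (kB t ht).reflect h6
    exact ⟨⟨ct, cs, fun p => by cases p <;> first | assumption | exact Or.inr rfl⟩, cz⟩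
  -- With all faces zero, the remaining minors say that the products of either end with an inner
  -- value, and of the two ends, vanish. Either both ends are zero, or one of them is the only
  -- nonzero value.
  have hf : ∀ p, g (.face k p) = 0 := fun p => by cases p <;> assumption
  have zlo : ∀ t, InCube d (k + 1) t → g (.lo k) * f t = 0 := fun t ht => by
    rw [(kA t ht).m12, h5, zero_mul]
  have zhi : ∀ t, InCube d (k + 1) t → g (.hi k) * f t = 0 := fun t ht => by
    rw [(kA t ht).n12, h2, zero_mul]
  have zz : g (.lo k) * g (.hi k) = 0 := by rw [(kA t₀ ht₀).m13, h5, zero_mul]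
  by_cases hlo : g (.lo k) = 0
  · by_cases hhi : g (.hi k) = 0
    · exact Or.inr ⟨hlo, hhi, hf⟩
    · exact fin (g (.hi k)) fun t ht => ⟨⟨Or.inl hlo, Or.inr rfl, fun p => Or.inl (hf p)⟩,
        Or.inl ((mul_eq_zero.1 (zhi t ht)).resolve_left hhi)⟩
  · exact fin (g (.lo k)) fun t ht => ⟨⟨Or.inr rfl, Or.inl ((mul_eq_zero.1 zz).resolve_left hlo),
      fun p => Or.inl (hf p)⟩, Or.inl ((mul_eq_zero.1 (zlo t ht)).resolve_left hlo)⟩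

end

end BlockCube

namespace BlockCube

noncomputable section

open Matrix Module

variable {d : ℕ}

/-! ## Existence of the local vectors -/

/-- The normalized indicator extends to an orthonormal basis of the span, which is rescaled by the
norm of the indicator. -/
theorem exists_orthogonal_family {s : Finset (Fin d)} {m : ℕ} (hm : s.card = m) (i₀ : Fin m) :
    ∃ e : Fin m → Qudit d, e i₀ = indVec s ∧
      (∀ i, e i ∈ Submodule.span ℂ (ket '' (s : Set (Fin d)))) ∧ (∀ i, e i ≠ 0) ∧
      Pairwise fun i j => inner ℂ (e i) (e j) = 0 := by
  set W := Submodule.span ℂ (ket '' (s : Set (Fin d))) with hW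
  have hu : indVec s ∈ W := mem_span_ket_iff.2 fun a ha => by simp [ha]
  have hu0 : indVec s ≠ 0 := by
    intro h
    have h1 := inner_indVec s s
    rw [h, inner_zero_left, Finset.inter_self, hm] at h1
    have := i₀.pos
    have h2 : m = 0 := by exact_mod_cast h1.symm
    omega
  have hn : (‖indVec s‖ : ℂ) ≠ 0 := by simpa using hu0
  let v : Fin m → W := fun _ => (‖indVec s‖ : ℂ)⁻¹ • ⟨indVec s, hu⟩
  have hv : Orthonormal ℂ (Set.domRestrict {i₀} v) := by
    refine ⟨fun i => ?_, fun i j hij => absurd (Subsingleton.elim i j) hij⟩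
    simp only [v, Set.domRestrict_apply, norm_smul, norm_inv, Complex.norm_real, norm_norm,
      Submodule.coe_norm]
    exact inv_mul_cancel₀ (by simpa using hu0)
  obtain ⟨b, hb⟩ := hv.exists_orthonormalBasis_extension_of_card_eq
    (by rw [finrank_span_ket, hm, Fintype.card_fin])
  refine ⟨fun i => (‖indVec s‖ : ℂ) • (b i : Qudit d), ?_, fun i => ?_, fun i => ?_, ?_⟩
  · simp only [hb i₀ rfl, v, Submodule.coe_smul]
    rw [smul_smul, mul_inv_cancel₀ hn, one_smul]
  · exact W.smul_mem _ (b i).2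
  · refine smul_ne_zero hn fun h => ?_
    exact b.orthonormal.ne_zero i (Subtype.ext h)
  · intro i j hij
    have : inner ℂ (b i : Qudit d) (b j) = 0 := b.orthonormal.2 hij
    simp only [inner_smul_left, inner_smul_right, this, mul_zero]

theorem nonempty_layerVectors (d : ℕ) : Nonempty (LayerVectors d) := by
  have h1 := fun k : Fin (numLayers d) => exists_orthogonal_family (card_eta k) (zeroIdx k)
  have h2 := fun k : Fin (numLayers d) => exists_orthogonal_family (card_xi k) (zeroIdx k)
  choose e e0 emem ene eorth using h1
  choose x x0 xmem xne xorth using h2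
  exact ⟨{
    eta := e
    xi := x
    eta_zero := e0
    xi_zero := x0
    eta_mem := fun k i => by simpa [Side.set] using emem k i
    xi_mem := fun k i => by simpa [Side.set] using xmem k i
    eta_ne_zero := ene
    xi_ne_zero := xne
    eta_orthogonal := eorth
    xi_orthogonal := xorth }⟩

/-! ## The three sets as extended bases -/

/-- First cells of the symmetric pairs. -/
def symFst : Fin (numLayers d) × Fin 3 → Cell d
  | (k, 0) => .face k .f1
  | (k, 1) => .face k .f3
  | (k, 2) => .face k .f5

/-- Second cells of the symmetric pairs. -/
def symSnd : Fin (numLayers d) × Fin 3 → Cell d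
  | (k, 0) => .face k .f2
  | (k, 1) => .face k .f4
  | (k, 2) => .face k .f6

/-- First cells of the asymmetric pairs. -/
def asymFst : Fin (numLayers d) × Fin 4 → Cell d
  | (k, 0) => .face k .f1
  | (k, 1) => .face k .f3
  | (k, 2) => .lo k
  | (k, 3) => .hi k

/-- Second cells of the asymmetric pairs. -/
def asymSnd : Fin (numLayers d) × Fin 4 → Cell d
  | (k, 0) => .face k .f2
  | (k, 1) => .face k .f5
  | (k, 2) => .face k .f4
  | (k, 3) => .face k .f6

/-- Coefficients of the first cells of the asymmetric pairs. -/
def asymCoeff : Fin (numLayers d) × Fin 4 → ℕ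
  | (_, 0) => 1
  | (_, 1) => 1
  | (k, 2) => side d k ^ 2
  | (k, 3) => side d k ^ 2

/-- Lets `productBasis` be treated as the extended basis without differences. -/
theorem isBalanced_empty :
    IsBalanced (fun _ : Empty => 1) (fun e => (e.elim : Cell d)) (fun e => (e.elim : Cell d)) :=
  ⟨fun e => e.elim, fun e => e.elim, fun e => e.elim, fun e => e.elim⟩

theorem isBalanced_sym : IsBalanced (fun _ => 1) (symFst (d := d)) symSnd := by
  refine ⟨?_, ?_, ?_, ?_⟩
  · rintro ⟨k, i⟩ ⟨k', i'⟩ h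
    fin_cases i <;> fin_cases i' <;> simp_all [symFst]
  · rintro ⟨k, i⟩ ⟨k', i'⟩ h
    fin_cases i <;> fin_cases i' <;> simp_all [symSnd]
  · rintro ⟨k, i⟩ ⟨k', i'⟩ h
    fin_cases i <;> fin_cases i' <;> simp_all [symFst, symSnd]
  · rintro ⟨k, i⟩
    fin_cases i <;> simp [symFst, symSnd, size_face]

theorem isBalanced_asym : IsBalanced asymCoeff (asymFst (d := d)) asymSnd := by
  refine ⟨?_, ?_, ?_, ?_⟩
  · rintro ⟨k, i⟩ ⟨k', i'⟩ h
    fin_cases i <;> fin_cases i' <;> simp_all [asymFst]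
  · rintro ⟨k, i⟩ ⟨k', i'⟩ h
    fin_cases i <;> fin_cases i' <;> simp_all [asymSnd]
  · rintro ⟨k, i⟩ ⟨k', i'⟩ h
    fin_cases i <;> fin_cases i' <;> simp_all [asymFst, asymSnd]
  · rintro ⟨k, i⟩
    fin_cases i <;> simp [asymFst, asymSnd, asymCoeff, size_face, size_lo, size_hi]

theorem symSnd_ne_core (i : Fin (numLayers d) × Fin 3) : symSnd i ≠ .core := by
  obtain ⟨k, i⟩ := i
  fin_cases i <;> simp [symSnd]

theorem asymSnd_ne_core (i : Fin (numLayers d) × Fin 4) : asymSnd i ≠ .core := by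
  obtain ⟨k, i⟩ := i
  fin_cases i <;> simp [asymSnd]

variable (V : LayerVectors d) (hd : 1 ≤ numLayers d)

include hd

theorem productBasis_eq_extended : productBasis V =
    extendedBasis V (fun _ : Empty => 1) (fun e => e.elim) (fun e => e.elim) := by
  rw [productBasis_eq V hd, extendedBasis, Set.range_eq_empty, Set.union_empty]

theorem symmetricBasis_eq_extended : symmetricBasis V =
    extendedBasis V (fun _ => 1) symFst symSnd := by
  rw [symmetricBasis, productBasis_eq V hd, extendedBasis]
  congr 1
  ext v
  simp only [Set.mem_iUnion, Set.mem_insert_iff, Set.mem_singleton_iff, Set.mem_range, psiMinus,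
    psi00_eq, minusVec, Nat.cast_one, one_smul]
  constructor
  · rintro ⟨k, rfl | rfl | rfl⟩
    · exact ⟨(k, 0), rfl⟩
    · exact ⟨(k, 1), rfl⟩
    · exact ⟨(k, 2), rfl⟩
  · rintro ⟨⟨k, i⟩, rfl⟩
    refine ⟨k, ?_⟩
    fin_cases i
    · exact Or.inl rfl
    · exact Or.inr (Or.inl rfl)
    · exact Or.inr (Or.inr rfl)

theorem asymmetricBasis_eq_extended : asymmetricBasis V =
    extendedBasis V asymCoeff asymFst asymSnd := by
  rw [asymmetricBasis, productBasis_eq V hd, extendedBasis]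
  congr 1
  ext v
  simp only [Set.mem_iUnion, Set.mem_insert_iff, Set.mem_singleton_iff, Set.mem_range, psiMinus,
    psiMinusDiag, psi00_eq, minusVec, diag_low, diag_high]
  constructor
  · rintro ⟨k, rfl | rfl | rfl | rfl⟩
    · exact ⟨(k, 0), by simp [asymCoeff, asymFst, asymSnd]⟩
    · exact ⟨(k, 1), by simp [asymCoeff, asymFst, asymSnd]⟩
    · exact ⟨(k, 2), by simp [asymCoeff, asymFst, asymSnd]⟩
    · exact ⟨(k, 3), by simp [asymCoeff, asymFst, asymSnd]⟩
  · rintro ⟨⟨k, i⟩, rfl⟩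
    refine ⟨k, ?_⟩
    fin_cases i
    · exact Or.inl (by simp [asymCoeff, asymFst, asymSnd])
    · exact Or.inr (Or.inl (by simp [asymCoeff, asymFst, asymSnd]))
    · exact Or.inr (Or.inr (Or.inl (by simp [asymCoeff, asymFst, asymSnd])))
    · exact Or.inr (Or.inr (Or.inr (by simp [asymCoeff, asymFst, asymSnd])))

theorem isOrthSet_productBasis : IsOrthSet (productBasis V) ∧
    (productBasis V).ncard + 8 * numLayers d = d ^ 3 := by
  have h := isOrthSet_extendedBasis V hd isBalanced_empty (fun e => e.elim)
  rw [← productBasis_eq_extended V hd] at h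
  simpa using h

theorem isOrthSet_symmetricBasis : IsOrthSet (symmetricBasis V) ∧
    (symmetricBasis V).ncard + 5 * numLayers d = d ^ 3 := by
  have h := isOrthSet_extendedBasis V hd isBalanced_sym symSnd_ne_core
  rw [← symmetricBasis_eq_extended V hd, Nat.card_prod] at h
  simp only [Nat.card_eq_fintype_card, Fintype.card_fin] at h
  exact ⟨h.1, by have := h.2; omega⟩

theorem isOrthSet_asymmetricBasis : IsOrthSet (asymmetricBasis V) ∧
    (asymmetricBasis V).ncard + 4 * numLayers d = d ^ 3 := by
  have h := isOrthSet_extendedBasis V hd isBalanced_asym asymSnd_ne_core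
  rw [← asymmetricBasis_eq_extended V hd, Nat.card_prod] at h
  simp only [Nat.card_eq_fintype_card, Fintype.card_fin] at h
  exact ⟨h.1, by have := h.2; omega⟩

theorem mem_complementary_productBasis {f : ThreeQudit d} : f ∈ complementary (productBasis V) ↔
    ∃ g, IsBlockConst f.ofLp g ∧ ∑ t, f t = 0 := by
  rw [productBasis_eq_extended V hd,
    mem_complementary_extendedBasis V hd isBalanced_empty (fun e => e.elim)]
  simp

theorem mem_complementary_symmetricBasis {f : ThreeQudit d} :
    f ∈ complementary (symmetricBasis V) ↔ ∃ g, IsBlockConst f.ofLp g ∧ ∑ t, f t = 0 ∧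
      ∀ i, g (symFst i) = g (symSnd i) := by
  rw [symmetricBasis_eq_extended V hd,
    mem_complementary_extendedBasis V hd isBalanced_sym symSnd_ne_core]

theorem mem_complementary_asymmetricBasis {f : ThreeQudit d} :
    f ∈ complementary (asymmetricBasis V) ↔ ∃ g, IsBlockConst f.ofLp g ∧ ∑ t, f t = 0 ∧
      ∀ i, g (asymFst i) = g (asymSnd i) := by
  rw [asymmetricBasis_eq_extended V hd,
    mem_complementary_extendedBasis V hd isBalanced_asym asymSnd_ne_core]

/-! ## Product properties of the members -/

omit hd

theorem isFullyProduct_of_mem_reducedBasis {v : ThreeQudit d} (hv : v ∈ reducedBasis V) :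
    IsFullyProduct v := by
  obtain ⟨c, ⟨x, -, y, -, z, -, rfl⟩, -⟩ := Set.mem_iUnion.1 hv
  exact ⟨x, y, z, rfl⟩

theorem IsFullyProduct.isProductAcross {v : ThreeQudit d} (hv : IsFullyProduct v) (c : Cut) :
    IsProductAcross c v := by
  obtain ⟨x, y, z, rfl⟩ := hv
  cases c
  · exact ⟨x, WithLp.toLp 2 fun s => y s.1 * z s.2, fun t => by
      simp only [tri_apply, cutEquiv, Equiv.refl_apply]; ring⟩
  · exact ⟨y, WithLp.toLp 2 fun s => x s.1 * z s.2, fun t => by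
      simp only [tri_apply, cutEquiv, Equiv.coe_fn_mk]; ring⟩
  · exact ⟨z, WithLp.toLp 2 fun s => x s.1 * y s.2, fun t => by
      simp only [tri_apply, cutEquiv, Equiv.coe_fn_mk]; ring⟩

/-- The indicator of a side common to both cells factors out. The faces 1, 2 share their third side,
3, 4 the second, 5, 6 the first, whereas all asymmetric pairs share the third. -/
theorem minusVec_product_A {a : ℕ} {c c' : Cell d} (h : c.fst = c'.fst) :
    IsProductAcross .A_BC (minusVec a c c') :=
  ⟨indVec c.fst.set, WithLp.toLp 2 fun s =>
    (a : ℂ) * (indVec c.snd.set s.1 * indVec c.trd.set s.2) -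
      indVec c'.snd.set s.1 * indVec c'.trd.set s.2, fun t => by
    simp only [minusVec, cellVec, PiLp.sub_apply, PiLp.smul_apply, tri_apply, smul_eq_mul, cutEquiv,
      Equiv.refl_apply, ← h]
    ring⟩

theorem minusVec_product_B {a : ℕ} {c c' : Cell d} (h : c.snd = c'.snd) :
    IsProductAcross .B_AC (minusVec a c c') :=
  ⟨indVec c.snd.set, WithLp.toLp 2 fun s =>
    (a : ℂ) * (indVec c.fst.set s.1 * indVec c.trd.set s.2) -
      indVec c'.fst.set s.1 * indVec c'.trd.set s.2, fun t => by
    simp only [minusVec, cellVec, PiLp.sub_apply, PiLp.smul_apply, tri_apply, smul_eq_mul, cutEquiv,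
      Equiv.coe_fn_mk, ← h]
    ring⟩

theorem minusVec_product_C {a : ℕ} {c c' : Cell d} (h : c.trd = c'.trd) :
    IsProductAcross .C_AB (minusVec a c c') :=
  ⟨indVec c.trd.set, WithLp.toLp 2 fun s =>
    (a : ℂ) * (indVec c.fst.set s.1 * indVec c.snd.set s.2) -
      indVec c'.fst.set s.1 * indVec c'.snd.set s.2, fun t => by
    simp only [minusVec, cellVec, PiLp.sub_apply, PiLp.smul_apply, tri_apply, smul_eq_mul, cutEquiv,
      Equiv.coe_fn_mk, ← h]
    ring⟩

include hd

theorem isFullyProduct_of_mem_productBasis {v : ThreeQudit d} (hv : v ∈ productBasis V) :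
    IsFullyProduct v := by
  rw [productBasis_eq V hd] at hv
  rcases hv with hv | rfl
  · exact isFullyProduct_of_mem_reducedBasis V hv
  · exact ⟨_, _, _, rfl⟩

theorem isBiseparable_of_mem_symmetricBasis {v : ThreeQudit d} (hv : v ∈ symmetricBasis V) :
    IsBiseparable v := by
  rw [symmetricBasis_eq_extended V hd] at hv
  rcases hv with (hv | rfl) | ⟨⟨k, i⟩, rfl⟩
  · exact ⟨.A_BC, (isFullyProduct_of_mem_reducedBasis V hv).isProductAcross _⟩
  · exact ⟨.A_BC, IsFullyProduct.isProductAcross ⟨_, _, _, rfl⟩ _⟩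
  · fin_cases i
    · exact ⟨_, minusVec_product_C rfl⟩
    · exact ⟨_, minusVec_product_B rfl⟩
    · exact ⟨_, minusVec_product_A rfl⟩

theorem isProductAcross_of_mem_asymmetricBasis {v : ThreeQudit d} (hv : v ∈ asymmetricBasis V) :
    IsProductAcross .C_AB v := by
  rw [asymmetricBasis_eq_extended V hd] at hv
  rcases hv with (hv | rfl) | ⟨⟨k, i⟩, rfl⟩
  · exact (isFullyProduct_of_mem_reducedBasis V hv).isProductAcross _
  · exact IsFullyProduct.isProductAcross ⟨_, _, _, rfl⟩ _
  · fin_cases i <;> exact minusVec_product_C rfl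

omit hd

theorem IsProductAcross.isFstProduct_A {f : ThreeQudit d} (h : IsProductAcross .A_BC f) :
    IsFstProduct f.ofLp := by
  obtain ⟨x, y, hxy⟩ := h
  exact ⟨x, y, hxy⟩

theorem IsProductAcross.isFstProduct_B {f : ThreeQudit d} (h : IsProductAcross .B_AC f) :
    IsFstProduct fun t => f (t.2.2, t.1, t.2.1) := by
  obtain ⟨x, y, hxy⟩ := h
  exact ⟨x, fun s => y s.swap, fun t => hxy _⟩

theorem IsProductAcross.isFstProduct_C {f : ThreeQudit d} (h : IsProductAcross .C_AB f) :
    IsFstProduct fun t => f (t.2.1, t.2.2, t.1) := by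
  obtain ⟨x, y, hxy⟩ := h
  exact ⟨x, y, fun t => hxy _⟩

/-- For a product vector, taken as a family in ℂ, the pairing factorizes. Whichever factor vanishes
for (x, y) reappears in the pairing of (x, y') or of (x', y). -/
theorem IsProductAcross.noFilter {c : Cut} {f : ThreeQudit d} (h : IsProductAcross c f) :
    NoFilter fun t => f ((cutEquiv d c).symm t) := by
  obtain ⟨x, y, hxy⟩ := h
  have e : ∀ x' y', pair (fun t => f ((cutEquiv d c).symm t)) x' y' =
      (∑ a, x' a * x a) * ∑ s, y' s * y s := by
    intro x' y'
    rw [pair, Finset.sum_mul_sum, Fintype.sum_prod_type]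
    refine Finset.sum_congr rfl fun a _ => Finset.sum_congr rfl fun s _ => ?_
    rw [hxy, Equiv.apply_symm_apply, smul_eq_mul]
    ring
  intro x' x'' y' y'' h0
  rw [e, mul_eq_zero] at h0
  rw [e, e]
  rcases h0 with h0 | h0 <;> simp [h0]

/-! ## Unextendibility -/

theorem isUnextendible_of_ncard {P : ThreeQudit d → Prop} {U : Set (ThreeQudit d)} {m : ℕ}
    (hU : IsOrthSet U) (hcard : U.ncard + m = d ^ 3) (hm : 0 < m) (hP : ∀ v ∈ U, P v)
    (h : ∀ v ∈ complementary U, P v → v = 0) : IsUnextendible P U := by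
  refine ⟨⟨hU.ne_zero, hU.orthogonal, hP⟩, fun htop => ?_, h⟩
  have := finrank_complementary hU hcard
  rw [complementary, htop, Submodule.top_orthogonal_eq_bot, finrank_bot] at this
  omega

include hd

theorem isUPB_productBasis : IsUPB (productBasis V) := by
  refine isUnextendible_of_ncard (isOrthSet_productBasis V hd).1 (isOrthSet_productBasis V hd).2
    (by omega) (fun v hv => isFullyProduct_of_mem_productBasis V hd hv) fun v hv hp => ?_
  obtain ⟨g, hg, hs⟩ := (mem_complementary_productBasis V hd).1 hv
  ext t
  exact product_eq_zero hg hs (hp.isProductAcross _).isFstProduct_A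
    (hp.isProductAcross _).isFstProduct_B (hp.isProductAcross _).isFstProduct_C t

theorem isUBB_symmetricBasis : IsUBB (symmetricBasis V) := by
  refine isUnextendible_of_ncard (isOrthSet_symmetricBasis V hd).1
    (isOrthSet_symmetricBasis V hd).2 (by omega)
    (fun v hv => isBiseparable_of_mem_symmetricBasis V hd hv) fun v hv hp => ?_
  obtain ⟨g, hg, hs, hi⟩ := (mem_complementary_symmetricBasis V hd).1 hv
  obtain ⟨c, hc⟩ := hp
  ext t
  exact symmetric_eq_zero_across c hg hs hc.noFilter (fun k => hi (k, 0)) (fun k => hi (k, 1))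
    (fun k => hi (k, 2)) t

theorem eq_zero_of_mem_complementary_asymmetricBasis {v : ThreeQudit d}
    (hv : v ∈ complementary (asymmetricBasis V)) (hp : IsBiseparable v) : v = 0 := by
  obtain ⟨g, hg, hs, hi⟩ := (mem_complementary_asymmetricBasis V hd).1 hv
  have ha : IsAsymmetric g :=
    ⟨fun k => hi (k, 0), fun k => hi (k, 1), fun k => hi (k, 2), fun k => hi (k, 3)⟩
  obtain ⟨c, hc⟩ := hp
  ext t
  cases c
  · exact asymmetric_eq_zero_A hg hs ha hc.isFstProduct_A t
  · exact asymmetric_eq_zero_B hg hs ha hc.isFstProduct_B t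
  · exact asymmetric_eq_zero_C hg hs ha hc.isFstProduct_C t

theorem isUBB_asymmetricBasis : IsUBB (asymmetricBasis V) :=
  isUnextendible_of_ncard (isOrthSet_asymmetricBasis V hd).1
    (isOrthSet_asymmetricBasis V hd).2 (by omega)
    (fun v hv => ⟨_, isProductAcross_of_mem_asymmetricBasis V hd hv⟩)
    fun _ hv hp => eq_zero_of_mem_complementary_asymmetricBasis V hd hv hp

theorem isUPBAcross_asymmetricBasis : IsUPBAcross .C_AB (asymmetricBasis V) :=
  isUnextendible_of_ncard (isOrthSet_asymmetricBasis V hd).1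
    (isOrthSet_asymmetricBasis V hd).2 (by omega)
    (fun v hv => isProductAcross_of_mem_asymmetricBasis V hd hv)
    fun _ hv hp => eq_zero_of_mem_complementary_asymmetricBasis V hd hv ⟨_, hp⟩

end

end BlockCube

namespace BlockCube

noncomputable section

open Matrix Module

/-! ## States supported on a subspace -/

section Support

variable {ι : Type*} [Fintype ι] [DecidableEq ι]

theorem SupportedOn.vecMul_eq_zero {ρ : Matrix ι ι ℂ} {S : Submodule ℂ (EuclideanSpace ℂ ι)}
    (h : SupportedOn ρ S) {w : ι → ℂ} (hw : ∀ f ∈ S, w ⬝ᵥ f.ofLp = 0) : w ᵥ* ρ = 0 :=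
  (vecMul_eq_zero_iff_forall ρ w).2 fun z => hw _ (h z)

omit [DecidableEq ι] in
theorem mem_of_forall_dotProduct {S : Submodule ℂ (EuclideanSpace ℂ ι)} {v : EuclideanSpace ℂ ι}
    (h : ∀ w : ι → ℂ, (∀ f ∈ S, w ⬝ᵥ f.ofLp = 0) → w ⬝ᵥ v.ofLp = 0) : v ∈ S := by
  have e : ∀ u x : EuclideanSpace ℂ ι, star u.ofLp ⬝ᵥ x.ofLp = inner ℂ u x := fun u x => by
    simp [PiLp.inner_apply, dotProduct, mul_comm]
  rw [← Submodule.orthogonal_orthogonal S, Submodule.mem_orthogonal]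
  intro u hu
  rw [← e]
  exact h _ fun f hf => by
    rw [e]
    exact Submodule.inner_left_of_mem_orthogonal hf hu

variable {H : Type*} [NormedAddCommGroup H] [InnerProductSpace ℂ H] {Φ : ι → H}
  {ρ : Matrix ι ι ℂ} {S : Submodule ℂ (EuclideanSpace ℂ ι)}

/-- A functional vanishing on S annihilates ρ from the left. Hence each linear relation valid on S
holds for the Gram vectors, which behave like one vector-valued element of S. -/
theorem IsGram.sum_smul_eq_zero (hΦ : IsGram Φ ρ) (hs : SupportedOn ρ S) {w : ι → ℂ}
    (hw : ∀ f ∈ S, w ⬝ᵥ f.ofLp = 0) : ∑ t, w t • Φ t = 0 :=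
  (hΦ.sum_eq_zero_iff w).2 (hs.vecMul_eq_zero hw)

theorem IsGram.apply_eq (hΦ : IsGram Φ ρ) (hs : SupportedOn ρ S) {t t' : ι}
    (h : ∀ f ∈ S, f t = f t') : Φ t = Φ t' := by
  have := hΦ.sum_smul_eq_zero hs (w := Pi.single t 1 - Pi.single t' 1) fun f hf => by
    rw [sub_dotProduct, single_one_dotProduct, single_one_dotProduct, h f hf, sub_self]
  simpa [sub_smul, Pi.single_apply, sub_eq_zero] using this

theorem IsGram.sum_eq_zero (hΦ : IsGram Φ ρ) (hs : SupportedOn ρ S)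
    (h : ∀ f ∈ S, ∑ t, f t = 0) : ∑ t, Φ t = 0 := by
  have := hΦ.sum_smul_eq_zero hs (w := 1) fun f hf => by
    rw [one_dotProduct, h f hf]
  simpa using this

end Support

variable {d : ℕ}

/-- A biseparable decomposition would place a biseparable unit vector in the range of ρ, hence in
the complement of U. -/
theorem IsUBB.isGenuinelyEntangled {U : Set (ThreeQudit d)} (hU : IsUBB U)
    {ρ : Matrix (Cube d) (Cube d) ℂ} (hs : SupportedOn ρ (complementary U)) :
    IsGenuinelyEntangled ρ := by
  intro h
  obtain ⟨v, hv, hb, hw⟩ := exists_mem_of_mem_convexHull h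
  have : v ∈ complementary U := mem_of_forall_dotProduct fun w hw' => hw w (hs.vecMul_eq_zero hw')
  rw [hU.unextendible v this hb] at hv
  simp at hv

/-! ## Passing to a bipartition -/

theorem across_eq_submatrix (c : Cut) (ρ : Matrix (Cube d) (Cube d) ℂ) :
    across c ρ = ρ.submatrix (cutEquiv d c).symm (cutEquiv d c).symm := rfl

theorem vecMul_across_eq_zero_iff (c : Cut) (ρ : Matrix (Cube d) (Cube d) ℂ)
    (u : Fin d × (Fin d × Fin d) → ℂ) :
    u ᵥ* across c ρ = 0 ↔ (u ∘ cutEquiv d c) ᵥ* ρ = 0 := by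
  rw [across_eq_submatrix, submatrix_vecMul_equiv, Equiv.symm_symm]
  constructor
  · intro h
    ext t
    have := congrFun h (cutEquiv d c t)
    simpa using this
  · intro h
    rw [h]
    rfl

theorem IsGram.across {H : Type*} [NormedAddCommGroup H] [InnerProductSpace ℂ H]
    {Φ : Cube d → H} {ρ : Matrix (Cube d) (Cube d) ℂ} (h : IsGram Φ ρ) (c : Cut) :
    IsGram (fun s => Φ ((cutEquiv d c).symm s)) (across c ρ) := fun _ _ => h _ _

/-- A vector of the three parties as a vector of the bipartite system. -/
def acrossVec (c : Cut) (v : ThreeQudit d) : EuclideanSpace ℂ (Fin d × (Fin d × Fin d)) :=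
  WithLp.toLp 2 fun t => v ((cutEquiv d c).symm t)

@[simp] theorem acrossVec_apply (c : Cut) (v : ThreeQudit d) (t : Fin d × (Fin d × Fin d)) :
    acrossVec c v t = v ((cutEquiv d c).symm t) := rfl

theorem inner_acrossVec (c : Cut) (v w : ThreeQudit d) :
    inner ℂ (acrossVec c v) (acrossVec c w) = inner ℂ v w := by
  simp only [PiLp.inner_apply, acrossVec_apply]
  exact Equiv.sum_comp (cutEquiv d c).symm fun t => inner ℂ (v t) (w t)

theorem norm_acrossVec (c : Cut) (v : ThreeQudit d) : ‖acrossVec c v‖ = ‖v‖ := by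
  rw [@norm_eq_sqrt_re_inner ℂ, @norm_eq_sqrt_re_inner ℂ, inner_acrossVec]

theorem IsProductAcross.isProduct_acrossVec {c : Cut} {v : ThreeQudit d}
    (h : IsProductAcross c v) : IsProduct (acrossVec c v) := by
  obtain ⟨x, y, hxy⟩ := h
  exact ⟨x, y, fun t => by rw [acrossVec_apply, hxy, Equiv.apply_symm_apply]⟩

theorem across_one_sub_familyProj {κ : Type*} [Fintype κ] (c : Cut) (v : κ → ThreeQudit d) :
    across c (1 - familyProj v) = 1 - familyProj fun i => acrossVec c (v i) := by
  ext s t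
  simp [across_eq_submatrix, familyProj, Matrix.sum_apply, pureState, Matrix.one_apply,
    norm_acrossVec]

theorem isPPT_across_projState {c : Cut} {U : Set (ThreeQudit d)} (hU : IsOrthSet U)
    (hp : ∀ v ∈ U, IsProductAcross c v) : IsPPT (across c (projState (complementary U))) := by
  have := hU.finite.fintype
  have e : projMatrix (complementary U) = 1 - familyProj (Subtype.val : U → ThreeQudit d) := by
    rw [← projMatrix_orthogonal_span (fun v : U => hU.ne_zero v v.2)
      (fun v w hvw => hU.orthogonal v.2 w.2 fun h => hvw (Subtype.ext h)), Subtype.range_coe]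
    rfl
  have h1 : IsPPT (across c (projMatrix (complementary U))) := by
    rw [e, across_one_sub_familyProj]
    refine isPPT_one_sub_familyProj (fun v h0 => hU.ne_zero v v.2 ?_) (fun v w hvw => ?_)
      fun v => (hp v v.2).isProduct_acrossVec
    · rw [← norm_eq_zero, ← norm_acrossVec c, h0, norm_zero]
    · simp only [inner_acrossVec]
      exact hU.orthogonal v.2 w.2 fun h => hvw (Subtype.ext h)
  have h2 : (0 : ℂ) ≤ (finrank ℂ (complementary U) : ℂ)⁻¹ := by positivity
  exact PosSemidef.smul h1 h2

/-- The range of a separable state is spanned by the product vectors in it. A functional that kills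
the product vectors of S, but not ρ, therefore witnesses entanglement. -/
theorem not_isSeparable_across {c : Cut} {ρ : Matrix (Cube d) (Cube d) ℂ}
    {S : Submodule ℂ (ThreeQudit d)} (hs : SupportedOn ρ S) {w : Cube d → ℂ}
    (hw : ∀ f ∈ S, IsProductAcross c f → w ⬝ᵥ f.ofLp = 0) (hρ : w ᵥ* ρ ≠ 0) :
    ¬ IsSeparable (across c ρ) := by
  intro h
  apply hρ
  have hcomp : ∀ u : Cube d → ℂ, (u ∘ (cutEquiv d c).symm) ∘ cutEquiv d c = u := fun u => by
    ext t
    simp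
  have hdot : ∀ (u : Cube d → ℂ) (v : EuclideanSpace ℂ (Fin d × (Fin d × Fin d))),
      (u ∘ (cutEquiv d c).symm) ⬝ᵥ v.ofLp = u ⬝ᵥ fun t => v (cutEquiv d c t) := fun u v => by
    rw [comp_equiv_symm_dotProduct]
    rfl
  have := vecMul_eq_zero_of_mem_convexHull h (w := w ∘ (cutEquiv d c).symm) ?_
  · rwa [vecMul_across_eq_zero_iff, hcomp] at this
  rintro v ⟨x, y, hxy⟩ hv
  rw [hdot]
  refine hw (WithLp.toLp 2 fun t => v (cutEquiv d c t)) ?_ ⟨x, y, fun t => hxy _⟩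
  refine mem_of_forall_dotProduct fun u hu => ?_
  rw [← hdot]
  refine hv _ ?_
  rw [vecMul_across_eq_zero_iff, hcomp]
  exact hs.vecMul_eq_zero hu

theorem vecMul_projState_eq_zero_iff {S : Submodule ℂ (ThreeQudit d)} (hS : finrank ℂ S ≠ 0)
    (w : Cube d → ℂ) : w ᵥ* projState S = 0 ↔ ∀ f ∈ S, w ⬝ᵥ f.ofLp = 0 := by
  rw [projState, vecMul_smul, smul_eq_zero, ← vecMul_projMatrix_eq_zero_iff]
  simp [hS]

theorem isBoundEntangled_of_isPPT {α β : Type*} [Fintype α] [Fintype β]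
    {ρ : Matrix (α × β) (α × β) ℂ} (h : IsPPT ρ) (hs : ¬ IsSeparable ρ) : IsBoundEntangled ρ :=
  ⟨hs, h.not_isDistillable⟩

/-! ## The rank criterion -/

/-- The range of ρ lies in S and has the same dimension, so it equals S and ρ has the left kernel of
the projector. -/
theorem vecMul_eq_zero_iff_of_rank {ρ : Matrix (Cube d) (Cube d) ℂ}
    {S : Submodule ℂ (ThreeQudit d)} (hs : SupportedOn ρ S) (hr : ρ.rank = finrank ℂ S)
    (w : Cube d → ℂ) : w ᵥ* ρ = 0 ↔ w ᵥ* projMatrix S = 0 := by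
  rw [vecMul_projMatrix_eq_zero_iff]
  refine ⟨fun h f hf => ?_, fun h => hs.vecMul_eq_zero h⟩
  let e := (WithLp.linearEquiv 2 ℂ (Cube d → ℂ)).symm
  have hle : (LinearMap.range ρ.mulVecLin).map (e : (Cube d → ℂ) →ₗ[ℂ] ThreeQudit d) ≤ S := by
    rintro _ ⟨_, ⟨z, rfl⟩, rfl⟩
    exact hs z
  have heq := Submodule.eq_of_le_of_finrank_eq hle (by
    rw [LinearEquiv.finrank_map_eq, ← hr]
    rfl)
  rw [← heq] at hf
  obtain ⟨_, ⟨z, rfl⟩, rfl⟩ := hf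
  exact (vecMul_eq_zero_iff_forall ρ w).1 h z

theorem isOneDistillable_of_rank_lt {c : Cut} {S : Submodule ℂ (ThreeQudit d)}
    (h : (across c (projMatrix S)).rank < max (reducedFst (across c (projMatrix S))).rank
      (reducedSnd (across c (projMatrix S))).rank)
    {ρ : Matrix (Cube d) (Cube d) ℂ} (hρ : ρ.PosSemidef) (hs : SupportedOn ρ S)
    (hr : ρ.rank = finrank ℂ S) : IsOneDistillable (across c ρ) := by
  by_contra hn
  obtain ⟨m, Φ, hΦ⟩ := exists_isGram hρ
  refine h.not_ge (rank_reduced_le (noFilter_of_not_isOneDistillable (hΦ.across c) hn)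
    ((projMatrix_posSemidef S).submatrix _) fun u => ?_)
  rw [(hΦ.across c).sum_eq_zero_iff, vecMul_across_eq_zero_iff, vecMul_across_eq_zero_iff,
    vecMul_eq_zero_iff_of_rank hs hr]

end

end BlockCube

namespace BlockCube

noncomputable section

open Matrix Module

variable {d : ℕ}

theorem Cell.nonempty (hd : 1 ≤ numLayers d) (c : Cell d) : ∃ t, c.Mem t := by
  have main : ∀ k : Fin (numLayers d), ∃ L M T : Fin d,
      2 * (k : ℕ) + 2 < d ∧ (L : ℕ) = k ∧ (M : ℕ) = k + 1 ∧ (T : ℕ) = d - 1 - k := fun k => by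
    obtain ⟨L, M, T, h⟩ := exists_low_mid_high k
    exact ⟨L, M, T, two_mul_lt k, h⟩
  rcases c with ⟨k, p⟩ | k | k | _
  · obtain ⟨L, M, T, h⟩ := main k
    cases p
    · exact ⟨(L, L, M), Cell.mem_f1.2 (by omega)⟩
    · exact ⟨(L, T, M), Cell.mem_f2.2 (by omega)⟩
    · exact ⟨(T, M, L), Cell.mem_f3.2 (by omega)⟩
    · exact ⟨(L, M, L), Cell.mem_f4.2 (by omega)⟩
    · exact ⟨(M, L, L), Cell.mem_f5.2 (by omega)⟩
    · exact ⟨(M, L, T), Cell.mem_f6.2 (by omega)⟩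
  · obtain ⟨L, M, T, h⟩ := main k
    exact ⟨(L, L, L), Cell.mem_lo.2 (by omega)⟩
  · obtain ⟨L, M, T, h⟩ := main k
    exact ⟨(T, T, T), Cell.mem_hi.2 (by omega)⟩
  · have hn : 2 * numLayers d < d := by
      unfold numLayers at hd ⊢
      omega
    refine ⟨(⟨numLayers d, by omega⟩, ⟨numLayers d, by omega⟩, ⟨numLayers d, by omega⟩), ?_⟩
    refine inCube_core ⟨⟨?_, ?_⟩, ⟨?_, ?_⟩, ?_, ?_⟩ <;> dsimp only <;> omega

/-- A Gram system of a state supported on a space of block constant vectors is block constant, and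
inherits the coincidences of values. -/
theorem IsGram.exists_isBlockConst (hd : 1 ≤ numLayers d) {H : Type*} [NormedAddCommGroup H]
    [InnerProductSpace ℂ H] {Φ : Cube d → H} {ρ : Matrix (Cube d) (Cube d) ℂ}
    {S : Submodule ℂ (ThreeQudit d)} (hΦ : IsGram Φ ρ) (hs : SupportedOn ρ S)
    (hS : ∀ f ∈ S, ∃ g, IsBlockConst f.ofLp g) :
    ∃ g, IsBlockConst Φ g ∧ ∀ c c' : Cell d,
      (∀ f ∈ S, ∀ g', IsBlockConst f.ofLp g' → g' c = g' c') → g c = g c' := by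
  choose pt hpt using Cell.nonempty (d := d) hd
  refine ⟨fun c => Φ (pt c), fun c t ht => hΦ.apply_eq hs fun f hf => ?_,
    fun c c' h => hΦ.apply_eq hs fun f hf => ?_⟩
  · obtain ⟨g, hg⟩ := hS f hf
    rw [hg c t ht, hg c _ (hpt c)]
  · obtain ⟨g, hg⟩ := hS f hf
    rw [hg c _ (hpt c), hg c' _ (hpt c')]
    exact h f hf g hg

theorem IsBlockConst.unique (hd : 1 ≤ numLayers d) {H : Type*} {f : Cube d → H} {g g' : Cell d → H}
    (h : IsBlockConst f g) (h' : IsBlockConst f g') : g = g' := by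
  ext c
  obtain ⟨t, ht⟩ := Cell.nonempty hd c
  rw [← h c t ht, ← h' c t ht]

theorem IsBlockConst.sum_eq {f : Cube d → ℂ} {g : Cell d → ℂ} (h : IsBlockConst f g) :
    ∑ t, f t = ∑ c : Cell d, c.size * g c := by
  have e := IsBlockConst.eq_sum (f := WithLp.toLp 2 f) h
  have h1 := inner_stopper (WithLp.toLp 2 f)
  rw [e, inner_sum] at h1
  rw [← e] at h1
  rw [← h1]
  exact Finset.sum_congr rfl fun c _ => by rw [inner_smul_right, inner_stopper_cellVec, mul_comm]

/-! ## Distillability -/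

/-- Without distillability all Gram vectors would vanish, against the trace being one. -/
theorem isOneDistillable_of_supportedOn_symmetricBasis (V : LayerVectors d)
    (hd : 1 ≤ numLayers d) {ρ : Matrix (Cube d) (Cube d) ℂ} (hρ : IsDensity ρ)
    (hs : SupportedOn ρ (complementary (symmetricBasis V))) (c : Cut) :
    IsOneDistillable (across c ρ) := by
  by_contra hn
  obtain ⟨m, Φ, hΦ⟩ := exists_isGram hρ.1
  have hS := fun f (hf : f ∈ complementary (symmetricBasis V)) =>
    (mem_complementary_symmetricBasis V hd).1 hf
  obtain ⟨g, hg, hgg⟩ := hΦ.exists_isBlockConst hd hs fun f hf => ⟨_, (hS f hf).choose_spec.1⟩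
  have key : ∀ i, g (symFst i) = g (symSnd i) := fun i => hgg _ _ fun f hf g' hg' => by
    obtain ⟨g₁, h1, -, h2⟩ := hS f hf
    rw [hg'.unique hd h1]
    exact h2 i
  have h0 := symmetric_eq_zero_across c hg
    (hΦ.sum_eq_zero hs fun f hf => (hS f hf).choose_spec.2.1)
    (noFilter_of_not_isOneDistillable (hΦ.across c) hn) (fun k => key (k, 0)) (fun k => key (k, 1))
    (fun k => key (k, 2))
  have h1 := hρ.2
  rw [Matrix.trace, Finset.sum_eq_zero fun t _ => by
    rw [Matrix.diag_apply, hΦ, h0, inner_zero_left]] at h1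
  exact zero_ne_one h1

/-- The vector with the values `x` on the cells `c₁`, `c₂` and `y` on the cells `c₃`, `c₄`. -/
def fourCells [DecidableEq (Cell d)] (x y : ℂ) (c₁ c₂ c₃ c₄ : Cell d) : Cell d → ℂ :=
  x • (Pi.single c₁ 1 + Pi.single c₂ 1) + y • (Pi.single c₃ 1 + Pi.single c₄ 1)

theorem exists_mem_complementary_asymmetricBasis (V : LayerVectors d) (hd : 1 ≤ numLayers d)
    (k : Fin (numLayers d)) :
    (∃ f ∈ complementary (asymmetricBasis V), ∃ g, IsBlockConst f.ofLp g ∧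
      g (.lo k) ≠ g (.face k .f1)) ∧
    ∃ f ∈ complementary (asymmetricBasis V), ∃ g, IsBlockConst f.ofLp g ∧
      g (.lo k) ≠ g (.face k .f3) := by
  classical
  have hm : (side d k : ℂ) ≠ 0 := Nat.cast_ne_zero.2 (side_pos k).ne'
  have hm' : (side d k : ℂ) ^ 2 + 1 ≠ -(2 * (side d k : ℂ) ^ 2) := by
    intro h
    have : (3 * side d k ^ 2 + 1 : ℕ) = (0 : ℂ) := by
      push_cast
      linear_combination h
    exact absurd (Nat.cast_eq_zero.1 this) (by omega)
  constructor
  -- Two matched pairs of cells are used, of sizes m², m² and m², 1. The weights m² + 1 and −2m²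
  -- make the total zero, and they differ because 3m² + 1 ≠ 0.
  · let g := fourCells ((side d k : ℂ) ^ 2 + 1) (-(2 * (side d k : ℂ) ^ 2)) (.face k .f1)
      (.face k .f2) (.face k .f4) (.lo k)
    refine ⟨∑ c, g c • cellVec c, (mem_complementary_asymmetricBasis V hd).2
      ⟨g, isBlockConst_sum g, ?_, ?_⟩, g, isBlockConst_sum g, ?_⟩
    · rw [(isBlockConst_sum g).sum_eq]
      simp [g, fourCells, mul_add, Finset.sum_add_distrib, Pi.single_apply, size_face, size_lo]
      ring
    · rintro ⟨k', i⟩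
      fin_cases i <;> simp [g, fourCells, Pi.single_apply, asymFst, asymSnd]
    · simpa [g, fourCells, Pi.single_apply] using hm'.symm
  · let g := fourCells ((side d k : ℂ) ^ 2 + 1) (-(2 * (side d k : ℂ) ^ 2)) (.face k .f3)
      (.face k .f5) (.face k .f4) (.lo k)
    refine ⟨∑ c, g c • cellVec c, (mem_complementary_asymmetricBasis V hd).2
      ⟨g, isBlockConst_sum g, ?_, ?_⟩, g, isBlockConst_sum g, ?_⟩
    · rw [(isBlockConst_sum g).sum_eq]
      simp [g, fourCells, mul_add, Finset.sum_add_distrib, Pi.single_apply, size_face, size_lo]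
      ring
    · rintro ⟨k', i⟩
      fin_cases i <;> simp [g, fourCells, Pi.single_apply, asymFst, asymSnd]
    · simpa [g, fourCells, Pi.single_apply] using hm'.symm

theorem finrank_complementary_asymmetricBasis (V : LayerVectors d) (hd : 1 ≤ numLayers d) :
    finrank ℂ (complementary (asymmetricBasis V)) = 4 * numLayers d :=
  finrank_complementary (isOrthSet_asymmetricBasis V hd).1 (isOrthSet_asymmetricBasis V hd).2

theorem finrank_complementary_productBasis (V : LayerVectors d) (hd : 1 ≤ numLayers d) :
    finrank ℂ (complementary (productBasis V)) = 8 * numLayers d :=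
  finrank_complementary (isOrthSet_productBasis V hd).1 (isOrthSet_productBasis V hd).2

theorem supportedOn_projState (S : Submodule ℂ (ThreeQudit d)) : SupportedOn (projState S) S :=
  supportedOn_projMatrix_smul S _

theorem projState_posSemidef (S : Submodule ℂ (ThreeQudit d)) : (projState S).PosSemidef := by
  have h2 : (0 : ℂ) ≤ (finrank ℂ S : ℂ)⁻¹ := by positivity
  exact (projMatrix_posSemidef S).smul h2

/-- The values at two labels differ for some vector of the support of the projector. -/
theorem IsGram.apply_ne {H : Type*} [NormedAddCommGroup H] [InnerProductSpace ℂ H]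
    {Φ : Cube d → H} {S : Submodule ℂ (ThreeQudit d)} (hS : finrank ℂ S ≠ 0)
    (hΦ : IsGram Φ (projState S)) {t t' : Cube d} {f : ThreeQudit d} (hf : f ∈ S)
    (h : f t ≠ f t') : Φ t ≠ Φ t' := by
  intro e
  have h1 := (hΦ.sum_eq_zero_iff (Pi.single t 1 - Pi.single t' 1)).1 (by
    simp [sub_smul, Pi.single_apply, e])
  have h2 := (vecMul_projState_eq_zero_iff hS _).1 h1 f hf
  rw [sub_dotProduct, single_one_dotProduct, single_one_dotProduct, sub_eq_zero] at h2
  exact h h2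

theorem eq_of_inner_sub_eq_zero {H : Type*} [NormedAddCommGroup H] [InnerProductSpace ℂ H]
    {x y : H} (hx : inner ℂ x (x - y) = 0) (hy : inner ℂ y (x - y) = 0) : x = y := by
  rw [← sub_eq_zero, ← inner_self_eq_zero (𝕜 := ℂ), inner_sub_left, hx, hy, sub_zero]

section AsymmetricDistillable

variable (V : LayerVectors d) (hd : 1 ≤ numLayers d)

include hd

/-- The coincidences of the values of a Gram system of the asymmetric state. -/
theorem exists_asymmetric_gram : ∃ (m : ℕ) (Φ : Cube d → EuclideanSpace ℂ (Fin m))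
    (g : Cell d → EuclideanSpace ℂ (Fin m)),
    IsGram Φ (projState (complementary (asymmetricBasis V))) ∧ IsBlockConst Φ g ∧
      (∀ i, g (asymFst i) = g (asymSnd i)) ∧
      ∀ k, g (.lo k) ≠ g (.face k .f1) ∧ g (.lo k) ≠ g (.face k .f3) := by
  have hfr : finrank ℂ (complementary (asymmetricBasis V)) ≠ 0 := by
    rw [finrank_complementary_asymmetricBasis V hd]
    omega
  have hsup := supportedOn_projState (complementary (asymmetricBasis V))
  obtain ⟨m, Φ, hΦ⟩ := exists_isGram (projState_posSemidef (complementary (asymmetricBasis V)))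
  have hS := fun f (hf : f ∈ complementary (asymmetricBasis V)) =>
    (mem_complementary_asymmetricBasis V hd).1 hf
  obtain ⟨g, hg, hgg⟩ := hΦ.exists_isBlockConst hd hsup fun f hf => ⟨_, (hS f hf).choose_spec.1⟩
  refine ⟨m, Φ, g, hΦ, hg, fun i => hgg _ _ fun f hf g' hg' => ?_, fun k => ?_⟩
  · obtain ⟨g₁, h1, -, h2⟩ := hS f hf
    rw [hg'.unique hd h1]
    exact h2 i
  · have ne : ∀ c c' : Cell d, (∃ f ∈ complementary (asymmetricBasis V), ∃ g,
        IsBlockConst f.ofLp g ∧ g c ≠ g c') → g c ≠ g c' := by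
      rintro c c' ⟨f, hf, g', hg', hne⟩
      obtain ⟨t, ht⟩ := Cell.nonempty hd c
      obtain ⟨t', ht'⟩ := Cell.nonempty hd c'
      rw [← hg c t ht, ← hg c' t' ht']
      rw [← hg' c t ht, ← hg' c' t' ht'] at hne
      exact hΦ.apply_ne hfr hf hne
    obtain ⟨h1, h3⟩ := exists_mem_complementary_asymmetricBasis V hd k
    exact ⟨ne _ _ h1, ne _ _ h3⟩

/-- In Alice's row M the columns (L,M) and (L,L) both lie on face 5. So the row M is orthogonal to
the difference of these columns in the row L, that is, of the values on face 1 and at the low end.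
Both values occur in the row M, on faces 2 and 4, hence they would be equal. -/
theorem isOneDistillable_asymmetric_A :
    IsOneDistillable (across .A_BC (projState (complementary (asymmetricBasis V)))) := by
  by_contra hn
  obtain ⟨m, Φ, g, hΦ, hg, hc, hne⟩ := exists_asymmetric_gram V hd
  have hnf := noFilter_of_not_isOneDistillable (hΦ.across .A_BC) hn
  obtain ⟨L, M, T, hL, hM, hT⟩ := exists_low_mid_high (⟨0, hd⟩ : Fin (numLayers d))
  have hk := two_mul_lt (⟨0, hd⟩ : Fin (numLayers d))
  generalize (⟨0, hd⟩ : Fin (numLayers d)) = k at *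
  have e1 : Φ (M, L, M) = g (.face k .f5) := hg _ _ (Cell.mem_f5.2 (by omega))
  have e2 : Φ (M, L, L) = g (.face k .f5) := hg _ _ (Cell.mem_f5.2 (by omega))
  have e3 : Φ (L, L, M) = g (.face k .f1) := hg _ _ (Cell.mem_f1.2 (by omega))
  have e4 : Φ (L, L, L) = g (.lo k) := hg _ _ (Cell.mem_lo.2 (by omega))
  have e5 : Φ (M, T, M) = g (.face k .f2) := hg _ _ (Cell.mem_f2.2 (by omega))
  have e6 : Φ (M, M, L) = g (.face k .f4) := hg _ _ (Cell.mem_f4.2 (by omega))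
  have c1 : g (.face k .f1) = g (.face k .f2) := hc (k, 0)
  have c2 : g (.lo k) = g (.face k .f4) := hc (k, 2)
  have h1 : inner ℂ (Φ (M, T, M)) (Φ (L, L, M) - Φ (L, L, L)) = 0 :=
    hnf.inner_row (a := M) (s := (L, M)) (s' := (L, L)) (e1.trans e2.symm) L (T, M)
  have h2 : inner ℂ (Φ (M, M, L)) (Φ (L, L, M) - Φ (L, L, L)) = 0 :=
    hnf.inner_row (a := M) (s := (L, M)) (s' := (L, L)) (e1.trans e2.symm) L (M, L)
  rw [e3, e4, e5, ← c1] at h1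
  rw [e3, e4, e6, ← c2] at h2
  exact (hne k).1 (eq_of_inner_sub_eq_zero h1 h2).symm

/-- In Bob's row M the columns (L,L) and (M,L) lie on face 4, while in his row L they give the low
end and face 5. The row M contains both of these values, on faces 4 and 3, so they would coincide.
-/
theorem isOneDistillable_asymmetric_B :
    IsOneDistillable (across .B_AC (projState (complementary (asymmetricBasis V)))) := by
  by_contra hn
  obtain ⟨m, Φ, g, hΦ, hg, hc, hne⟩ := exists_asymmetric_gram V hd
  have hnf := noFilter_of_not_isOneDistillable (hΦ.across .B_AC) hn
  obtain ⟨L, M, T, hL, hM, hT⟩ := exists_low_mid_high (⟨0, hd⟩ : Fin (numLayers d))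
  have hk := two_mul_lt (⟨0, hd⟩ : Fin (numLayers d))
  generalize (⟨0, hd⟩ : Fin (numLayers d)) = k at *
  have e1 : Φ (L, M, L) = g (.face k .f4) := hg _ _ (Cell.mem_f4.2 (by omega))
  have e2 : Φ (M, M, L) = g (.face k .f4) := hg _ _ (Cell.mem_f4.2 (by omega))
  have e3 : Φ (L, L, L) = g (.lo k) := hg _ _ (Cell.mem_lo.2 (by omega))
  have e4 : Φ (M, L, L) = g (.face k .f5) := hg _ _ (Cell.mem_f5.2 (by omega))
  have e6 : Φ (T, M, M) = g (.face k .f3) := hg _ _ (Cell.mem_f3.2 (by omega))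
  have c1 : g (.face k .f3) = g (.face k .f5) := hc (k, 1)
  have c2 : g (.lo k) = g (.face k .f4) := hc (k, 2)
  have h1 : inner ℂ (Φ (L, M, L)) (Φ (L, L, L) - Φ (M, L, L)) = 0 :=
    hnf.inner_row (a := M) (s := (L, L)) (s' := (M, L)) (e1.trans e2.symm) L (L, L)
  have h2 : inner ℂ (Φ (T, M, M)) (Φ (L, L, L) - Φ (M, L, L)) = 0 :=
    hnf.inner_row (a := M) (s := (L, L)) (s' := (M, L)) (e1.trans e2.symm) L (T, M)
  rw [e1, e3, e4, ← c1, ← c2] at h1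
  rw [e3, e4, e6, ← c1] at h2
  exact (hne k).2 (eq_of_inner_sub_eq_zero h1 h2)

end AsymmetricDistillable

end

end BlockCube

namespace BlockCube

noncomputable section

open Matrix Module

variable {d : ℕ}

/-! ## Bound entanglement -/

theorem IsFstProduct.mul_eq {f : Cube d → ℂ} (hf : IsFstProduct f) (a a' : Fin d)
    (s s' : Fin d × Fin d) : f (a, s) * f (a', s') = f (a', s) * f (a, s') := by
  obtain ⟨x, y, hxy⟩ := hf
  simp only [hxy]
  ring

/-- In the outer layer, the values of a product vector on two opposite faces add up to zero. -/
theorem IsFstProduct.face_add_eq_zero {f : Cube d → ℂ} {g : Cell d → ℂ} (hf : IsFstProduct f)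
    (hg : IsBlockConst f g) (hs : ∑ t, f t = 0) {k : Fin (numLayers d)} (h0 : (k : ℕ) = 0) :
    g (.face k .f5) + g (.face k .f6) = 0 := by
  have hin : ∀ t, InCube d k t := fun t => h0 ▸ inCube_zero t
  have minors := fun t (ht : InCube d (k + 1) t) => hf.layerMinors hg k ht
  -- Three further minors outside `LayerMinors`, for the cases in which f₁ or f₅ vanishes and cannot
  -- be cancelled.
  have extra : (∀ t, InCube d (k + 1) t → g (.face k .f5) * f t = g (.face k .f5) * g (.face k .f3))
      ∧ g (.face k .f4) * g (.face k .f6) = g (.face k .f3) * g (.face k .f6)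
      ∧ g (.lo k) * g (.face k .f6) = g (.face k .f5) * g (.face k .f1) := by
    obtain ⟨L, M, T, hL, hM, hT⟩ := exists_low_mid_high k
    have hk := two_mul_lt k
    refine ⟨fun t ht => ?_, ?_, ?_⟩
    · obtain ⟨a, b, c⟩ := t
      simp only [InCube] at ht
      have e := hf.mul_eq T a (L, M) (b, c)
      rwa [hg _ (T, L, M) (Cell.mem_f5 (k := k).2 (by omega)),
        hg _ (a, L, M) (Cell.mem_f5 (k := k).2 (by omega)),
        hg _ (T, b, c) (Cell.mem_f3 (k := k).2 (by omega))] at e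
    · have e := hf.mul_eq M T (M, L) (M, T)
      rwa [hg _ (M, M, L) (Cell.mem_f4 (k := k).2 (by omega)),
        hg _ (T, M, T) (Cell.mem_f6 (k := k).2 (by omega)),
        hg _ (T, M, L) (Cell.mem_f3 (k := k).2 (by omega)),
        hg _ (M, M, T) (Cell.mem_f6 (k := k).2 (by omega))] at e
    · have e := hf.mul_eq L M (L, L) (M, T)
      rwa [hg _ (L, L, L) (Cell.mem_lo (k := k).2 (by omega)),
        hg _ (M, M, T) (Cell.mem_f6 (k := k).2 (by omega)),
        hg _ (M, L, L) (Cell.mem_f5 (k := k).2 (by omega)),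
        hg _ (L, M, T) (Cell.mem_f1 (k := k).2 (by omega))] at e
  obtain ⟨x1, x2, x3⟩ := extra
  obtain ⟨t₀, ht₀⟩ := inCube_mid k
  -- it suffices that everything outside the two faces vanishes
  have fin : g (.lo k) = 0 → g (.hi k) = 0 → g (.face k .f1) = 0 → g (.face k .f2) = 0 →
      g (.face k .f3) = 0 → g (.face k .f4) = 0 → (∀ t, InCube d (k + 1) t → f t = 0) →
      g (.face k .f5) + g (.face k .f6) = 0 := by
    intro hlo hhi h1 h2 h3 h4 hz
    have hzero : ∀ c : Cell d, c ≠ .face k .f5 ∧ c ≠ .face k .f6 → g c = 0 := by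
      rintro c ⟨hc5, hc6⟩
      obtain ⟨t, ht⟩ := Cell.nonempty k.pos c
      rw [← hg c t ht]
      rcases Cell.layer_cases k (hin t) with h | h | ⟨p, h⟩ | h
      · rw [hg _ t h, hlo]
      · rw [hg _ t h, hhi]
      · rw [hg _ t h]
        obtain rfl := Cell.eq_of_mem ht h
        cases p <;> first | assumption | exact absurd rfl hc5 | exact absurd rfl hc6
      · exact hz t h
    rw [hg.sum_eq, Finset.sum_eq_add (.face k .f5) (.face k .f6) (by simp)
      (fun c _ hc => by rw [hzero c hc, mul_zero]) (fun h => absurd (Finset.mem_univ _) h)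
      (fun h => absurd (Finset.mem_univ _) h), size_face, size_face, ← mul_add] at hs
    refine (mul_eq_zero.1 hs).resolve_left ?_
    exact Nat.cast_ne_zero.2 (pow_ne_zero _ (side_pos k).ne')
  have A := minors t₀ ht₀
  -- If g is nonzero on face 6 alone of the two, or nonzero on face 5 and zero on face 1, the minors
  -- kill everything off the two faces, and the zero sum is the claim. If it is nonzero on faces 5
  -- and 1, all values equal the one on face 5, which contradicts the zero sum.
  by_cases h5 : g (.face k .f5) = 0
  · by_cases h6 : g (.face k .f6) = 0
    · rw [h5, h6, add_zero]
    have h1 : g (.face k .f1) = 0 := by simpa [h5, h6] using A.m1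
    have h2 : g (.face k .f2) = 0 := by simpa [h1, h6] using A.n3
    have h3 : g (.face k .f3) = 0 := by simpa [h2, h6] using A.n2
    refine fin ?_ ?_ h1 h2 h3 ?_ fun t ht => ?_
    · simpa [h5, h6] using x3
    · simpa [h2, h6] using A.n11
    · simpa [h3, h6] using x2
    · simpa [h3, h6] using (minors t ht).n10
  by_cases h1 : g (.face k .f1) = 0
  · have h4 : g (.face k .f4) = 0 := by simpa [h1, h5] using A.m2
    have h2 : g (.face k .f2) = 0 := by simpa [h1, h5] using A.m4
    have h3 : g (.face k .f3) = 0 := by simpa [h4, h5] using A.m3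
    refine fin ?_ ?_ h1 h2 h3 h4 fun t ht => ?_
    · simpa [h1, h5] using A.m9
    · simpa [h2, h5] using A.m6
    · simpa [h3, h5] using x1 t ht
  have hz : ∀ t, InCube d (k + 1) t → f t = g (.face k .f5) := fun t ht =>
    mul_right_cancel₀ h1 (by rw [← (minors t ht).m7, mul_comm])
  have e3 : g (.face k .f3) = g (.face k .f5) := mul_right_cancel₀ h1 (by rw [← A.m8, mul_comm])
  have e6 : g (.face k .f6) = g (.face k .f5) := mul_left_cancel₀ h1 (by rw [A.m1, mul_comm])
  have es : g (.lo k) = g (.face k .f1) := mul_right_cancel₀ h5 (by rw [A.m9, mul_comm])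
  have e4 : g (.face k .f4) = g (.face k .f5) := mul_right_cancel₀ h5 (by rw [A.m3, e3])
  have e1 : g (.face k .f1) = g (.face k .f5) := by
    have := A.m2
    rw [e4] at this
    exact (mul_left_cancel₀ h5 this).symm
  have e2 : g (.face k .f2) = g (.face k .f5) := by
    have := A.n1
    rw [e3, e4, mul_comm] at this
    exact (mul_right_cancel₀ h5 this).symm
  have et : g (.hi k) = g (.face k .f5) := by
    rw [← e2]
    exact mul_right_cancel₀ h5 A.m6.symm
  have hall := eq_zero_of_layer hg hs k (fun t ht => absurd (hin t) ht) (c := g (.face k .f5))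
    (Or.inr (es.trans e1)) (Or.inr et)
    (fun p => Or.inr (by cases p <;> first | assumption | rfl)) (fun t ht => Or.inr (hz t ht))
  exact absurd ((hz t₀ ht₀).symm.trans (hall t₀)) h5

/-- Rotations carry the faces 5, 6 to 4, 3 and to 1, 2. The third face only has to differ from both;
it shows later that the equation fails on the whole complement. -/
theorem exists_faces_across (c : Cut) : ∃ p p' p'' : Face, p ≠ p' ∧ p'' ≠ p ∧ p'' ≠ p' ∧
    ∀ (f : ThreeQudit d) (g : Cell d → ℂ), IsProductAcross c f → IsBlockConst f.ofLp g →
      ∑ t, f t = 0 → ∀ k : Fin (numLayers d), (k : ℕ) = 0 → g (.face k p) + g (.face k p') = 0 := by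
  cases c
  · exact ⟨.f5, .f6, .f1, nofun, nofun, nofun, fun f g hf hg hs k hk =>
      hf.isFstProduct_A.face_add_eq_zero hg hs hk⟩
  · exact ⟨.f4, .f3, .f1, nofun, nofun, nofun, fun f g hf hg hs k hk =>
      hf.isFstProduct_B.face_add_eq_zero hg.rot (by rw [sum_rot, hs]) hk⟩
  · exact ⟨.f1, .f2, .f5, nofun, nofun, nofun, fun f g hf hg hs k hk =>
      hf.isFstProduct_C.face_add_eq_zero hg.rot.rot
        ((sum_rot fun t => f (t.2.2, t.1, t.2.1)).trans ((sum_rot f.ofLp).trans hs)) hk⟩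

section

variable (V : LayerVectors d) (hd : 1 ≤ numLayers d)

include hd

theorem isPPT_productBasis (c : Cut) :
    IsPPT (across c (projState (complementary (productBasis V)))) :=
  isPPT_across_projState (isOrthSet_productBasis V hd).1 fun _ hv =>
    (isFullyProduct_of_mem_productBasis V hd hv).isProductAcross c

/-- The complement may contain product vectors across the cut, so unextendibility does not suffice.
All of them satisfy the equation on two opposite outer faces, and the range criterion applies to
this functional. -/
theorem isBoundEntangled_productBasis (c : Cut) :
    IsBoundEntangled (across c (projState (complementary (productBasis V)))) := by
  classical
  refine isBoundEntangled_of_isPPT (isPPT_productBasis V hd c) ?_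
  obtain ⟨p, p', p'', hne, hne1, hne2, h⟩ := exists_faces_across (d := d) c
  let k : Fin (numLayers d) := ⟨0, hd⟩
  obtain ⟨t, ht⟩ := Cell.nonempty hd (.face k p)
  obtain ⟨t', ht'⟩ := Cell.nonempty hd (.face k p')
  have hdot : ∀ (f : ThreeQudit d) (g : Cell d → ℂ), IsBlockConst f.ofLp g →
      (Pi.single t 1 + Pi.single t' 1 : Cube d → ℂ) ⬝ᵥ f.ofLp =
        g (.face k p) + g (.face k p') := fun f g hg => by
    rw [add_dotProduct, single_one_dotProduct, single_one_dotProduct, hg _ _ ht, hg _ _ ht']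
  refine not_isSeparable_across (supportedOn_projState _)
    (w := Pi.single t 1 + Pi.single t' 1) (fun f hf hp => ?_) fun h0 => ?_
  · obtain ⟨g, hg, hs⟩ := (mem_complementary_productBasis V hd).1 hf
    rw [hdot f g hg, h f g hp hg hs k rfl]
  · have hfr : finrank ℂ (complementary (productBasis V)) ≠ 0 := by
      rw [finrank_complementary_productBasis V hd]
      omega
    -- Opposite values on two faces of equal size have zero sum, while the functional takes the
    -- value 1.
    let g : Cell d → ℂ := Pi.single (.face k p) 1 - Pi.single (.face k p'') 1
    have hg := isBlockConst_sum g
    have := (vecMul_projState_eq_zero_iff hfr _).1 h0 (∑ c, g c • cellVec c)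
      ((mem_complementary_productBasis V hd).2 ⟨g, hg, by
        rw [hg.sum_eq]
        simp [g, mul_sub, Pi.single_apply, size_face]⟩)
    rw [hdot _ g hg] at this
    simp [g, hne.symm, hne1.symm, hne2.symm] at this

theorem isPPT_asymmetricBasis :
    IsPPT (across .C_AB (projState (complementary (asymmetricBasis V)))) :=
  isPPT_across_projState (isOrthSet_asymmetricBasis V hd).1 fun _ hv =>
    isProductAcross_of_mem_asymmetricBasis V hd hv

/-- The complement has no nonzero product vector across AB|C, so any coordinate functional that is
nonzero on it serves in the range criterion. -/
theorem isBoundEntangled_asymmetricBasis :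
    IsBoundEntangled (across .C_AB (projState (complementary (asymmetricBasis V)))) := by
  refine isBoundEntangled_of_isPPT (isPPT_asymmetricBasis V hd) ?_
  have hfr : finrank ℂ (complementary (asymmetricBasis V)) ≠ 0 := by
    rw [finrank_complementary_asymmetricBasis V hd]
    omega
  obtain ⟨f, hf, hf0⟩ := Submodule.exists_mem_ne_zero_of_ne_bot
    (fun h : complementary (asymmetricBasis V) = ⊥ => hfr (by rw [h, finrank_bot]))
  obtain ⟨t, ht⟩ : ∃ t, f t ≠ 0 := by
    by_contra! hcon
    exact hf0 (PiLp.ext hcon)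
  refine not_isSeparable_across (supportedOn_projState _) (w := Pi.single t 1)
    (fun v hv hp => ?_) fun h0 => ht ?_
  · rw [(isUPBAcross_asymmetricBasis V hd).unextendible v hv hp]
    simp
  · have := (vecMul_projState_eq_zero_iff hfr _).1 h0 f hf
    rwa [single_one_dotProduct] at this

/-! ## The twisted product basis -/

theorem isOrthogonalProductBasis_twistedBasis : IsOrthogonalProductBasis (twistedBasis V) := by
  rw [twistedBasis_eq V hd]
  have h := isOrthSet_iUnion_block V hd
  refine ⟨⟨h.ne_zero, h.orthogonal, fun v hv => ?_⟩, span_iUnion_block V hd⟩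
  obtain ⟨c, x, -, y, -, z, -, rfl⟩ := Set.mem_iUnion.1 hv
  exact ⟨x, y, z, rfl⟩

end

end

end BlockCube

open BlockCube in
theorem mainTheorem7 (d : ℕ) (hd : 4 ≤ d) :
    -- the construction can be carried out
    Nonempty (LayerVectors d) ∧
    -- and for every choice of the local vectors:
    (∀ V : LayerVectors d,
      -- twisted product basis
      IsOrthogonalProductBasis (twistedBasis V) ∧
      -- unextendible product basis, with a completely entangled complement
      (IsUPB (productBasis V) ∧
        (productBasis V).ncard + 8 * numLayers d = d ^ 3 ∧
        Module.finrank ℂ (complementary (productBasis V)) = 8 * numLayers d) ∧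
      -- symmetric unextendible biseparable basis
      (IsUBB (symmetricBasis V) ∧
        (symmetricBasis V).ncard + 5 * numLayers d = d ^ 3 ∧
        Module.finrank ℂ (complementary (symmetricBasis V)) = 5 * numLayers d) ∧
      -- its complement is genuinely entangled and distillable across every cut
      (∀ ρ : Matrix (Cube d) (Cube d) ℂ, IsDensity ρ →
        SupportedOn ρ (complementary (symmetricBasis V)) →
          IsGenuinelyEntangled ρ ∧
          ∀ c : Cut, IsOneDistillable (across c ρ) ∧ IsDistillable (across c ρ)) ∧
      -- asymmetric unextendible biseparable basis, a UPB in the cut AB|C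
      (IsUBB (asymmetricBasis V) ∧
        IsUPBAcross .C_AB (asymmetricBasis V) ∧
        (asymmetricBasis V).ncard + 4 * numLayers d = d ^ 3 ∧
        Module.finrank ℂ (complementary (asymmetricBasis V)) = 4 * numLayers d) ∧
      (∀ ρ : Matrix (Cube d) (Cube d) ℂ, IsDensity ρ →
        SupportedOn ρ (complementary (asymmetricBasis V)) → IsGenuinelyEntangled ρ) ∧
      -- its normalized projector is bound entangled in AB|C, 1-distillable in the other cuts
      (IsPPT (across .C_AB (projState (complementary (asymmetricBasis V)))) ∧
        IsBoundEntangled (across .C_AB (projState (complementary (asymmetricBasis V)))) ∧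
        IsOneDistillable (across .A_BC (projState (complementary (asymmetricBasis V)))) ∧
        IsOneDistillable (across .B_AC (projState (complementary (asymmetricBasis V))))) ∧
      -- the normalized projector on the complement of the UPB is bound entangled in every cut
      (∀ c : Cut, IsPPT (across c (projState (complementary (productBasis V)))) ∧
        IsBoundEntangled (across c (projState (complementary (productBasis V)))))) ∧
    -- rank criterion for 1-distillability across every cut
    (∀ (c : Cut) (S : Submodule ℂ (ThreeQudit d)),
      (across c (projMatrix S)).rank <
          max (reducedFst (across c (projMatrix S))).rank
            (reducedSnd (across c (projMatrix S))).rank →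
        ∀ ρ : Matrix (Cube d) (Cube d) ℂ, IsDensity ρ → SupportedOn ρ S →
          ρ.rank = Module.finrank ℂ S → IsOneDistillable (across c ρ)) := by
  -- The bound on d enters only through the existence of a layer.
  have hn : 1 ≤ numLayers d := by
    unfold numLayers
    omega
  refine ⟨nonempty_layerVectors d, fun V => ⟨isOrthogonalProductBasis_twistedBasis V hn,
    ⟨isUPB_productBasis V hn, (isOrthSet_productBasis V hn).2,
      finrank_complementary_productBasis V hn⟩,
    ⟨isUBB_symmetricBasis V hn, (isOrthSet_symmetricBasis V hn).2,
      finrank_complementary (isOrthSet_symmetricBasis V hn).1 (isOrthSet_symmetricBasis V hn).2⟩,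
    fun ρ hρ hs => ⟨(isUBB_symmetricBasis V hn).isGenuinelyEntangled hs, fun c =>
      have h := isOneDistillable_of_supportedOn_symmetricBasis V hn hρ hs c
      ⟨h, h.isDistillable⟩⟩,
    ⟨isUBB_asymmetricBasis V hn, isUPBAcross_asymmetricBasis V hn,
      (isOrthSet_asymmetricBasis V hn).2, finrank_complementary_asymmetricBasis V hn⟩,
    fun ρ _ hs => (isUBB_asymmetricBasis V hn).isGenuinelyEntangled hs,
    ⟨isPPT_asymmetricBasis V hn, isBoundEntangled_asymmetricBasis V hn,
      isOneDistillable_asymmetric_A V hn, isOneDistillable_asymmetric_B V hn⟩,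
    fun c => ⟨isPPT_productBasis V hn c, isBoundEntangled_productBasis V hn c⟩⟩,
    fun c S h ρ hρ hs hr => isOneDistillable_of_rank_lt h hρ.1 hs hr⟩
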